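/- **Setting.** Let $d\ge 1$, $\mathfrak m>d$, $\alpha=d/\mathfrak m$, $\sigma\in\mathbb R$, $T>0$. Let $W$ be a white noise on $\mathbb R^d$ defined on a probability space $(\Omega,\mathbb P)$, i.e. $h\mapsto\int h\,dW$ is a linear isometry of $L^2(\mathbb R^d)$ into $L^2(\Omega)$ with centred Gaussian values. Let $G(t,x;y)$ (the Green's function, i.e. the kernel of $e^{-tP(x,D)}$) be real, symmetric in $(x,y)$, continuous on $(0,T)\times\mathbb R^d\times\mathbb R^d$, with $$\sup_{t,y}\int|G(t,x;y)|\,dx+\sup_{t,y}t^{\alpha}\int|G(t,x;y)|^2dx+\sup_{t,x,y}t^{\alpha}|G(t,x;y)|<\infty ,\qquad t\in(0,T).$$ The SPDE $\partial_tu+P(x,D)u-\sigma u\circ\dot W=0$, $u(0,\cdot)=u_0$, is understood in the mild (Stratonovich) sense $$u=e^{-tP}u_0+\mathcal Hu,\quad e^{-tP}u_0(x)=\int G(t,x;\xi)u_0(\xi)\,d\xi,\quad \mathcal Hu(t,x)=\sigma\int_0^t\!\!\int G(t-s,x;y)\,u(s,y)\,dW(y)\,ds .$$ **Stratonovich and Itô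 integrals.** For $f:(\mathbb R^d)^n\to\mathbb R$ let $\|f\|_n^2$ be the sum over all pairings of $2n$ variables of the integral of $|f\otimes f|$ over the diagonal on which paired variables coincide, and let $\mathcal B_n$ be the space of $f$ with $\|f\|_n<\infty$ (functions with prescribed values on the diagonals). The iterated Stratonovich integral $\mathcal I_n$ extends $\prod_k f_k(y_k)\mapsto\prod_k\int f_k\,dW$ by density for $\|\cdot\|_n$. $I_m$ is the multiple Wiener–Itô integral. **Formal series.** Random fields are given by formal series $u=\sum_n\mathcal I_n(f_n(t,x,\cdot))$, $0<t<T$, with $f_n(t,x,y_1,\dots,y_n)$ jointly measurable and symmetric in $y$. The operator $\mathcal H$ acts on series: $(\mathcal Hf)_0=0$, and $(\mathcal Hf)_{n+1}(t,x,y)$ is $\sigma$ times the symmetrization in $y=(y_1,\dots,y_{n+1})$ of $\int_0^tG(t-s,x;y_1)f_n(s,y_1,y_2,\dots,y_{n+1})\,ds$. By the Hu–Meyer formula the chaos expansion of $u$ is $\sum_mI_m(g_m(t,x,\cdot))$ with $$g_m(t,x,y)=\sum_{k\ge0}\frac{(m+2k)!}{m!\,k!\,2^k}\int_{\mathbb R^{kd}}f_{m+2k}(t,x,y,z_1,z_1,\dots,z_k,z_k)\,dz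 .$$ **The space $\mathfrak M(T)$.** Call $(c_p)_{p\ge0}$ a weight if $c_p>0$ is nondecreasing and $c_p\to\infty$. The series $u$ belongs to $\mathfrak M_c(T)$ if all $\mathcal H^pu$ are well defined (for each $t$ their time integrals converge absolutely at almost every point of $\{(x,y)\}$ and of each of its partial diagonals) and $$\sup_{m\ge0}\ \sup_{p\ge0}\ \sup_{0<t<T}\ c_p\int g_{m,p}^2(t,x,y)\,dx\,dy<\infty ,$$ where $g_{m,p}$ is given by the formula above with $|(\mathcal H^pf)_n|$ in place of $f_n$. Two series $u,u'$ are identified if, for every $p\ge0$, $\mathcal H^pu$ and $\mathcal H^pu'$ have the same chaos coefficients for all $t\in(0,T)$ and a.e. $(x,y)$; in particular $u$ and $u'$ are then equal as random fields. A mild solution in $\mathfrak M_c(T)$ is a $u\in\mathfrak M_c(T)$ with $u=e^{-tP}u_0+\mathcal Hu$ in the sense of this identification. $\mathfrak M(T)$ is the union of the $\mathfrak M_c(T)$. **Theorem.** There is a weight $c$, not depending on $u_0$, such that for every $u_0\in L^1(\mathbb R^d)\cap L^2(\mathbb R^d)$ the Duhamel series $u=\sum_{n\ge0}u_n$, $u_n=\mathcal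 H^n(e^{-tP}u_0)=\mathcal I_n(f_n(t,x,\cdot))$, satisfies: 1. $f_n\in L^2(\mathbb R^d;\mathcal B_n)$ uniformly in $t\in(0,T)$ for each $n$; the series $\sum_nu_n$ converges in $L^2(\mathbb R^d\times\Omega)$ uniformly in $t\in(0,T)$, its sum $u$ is bounded there uniformly in $t$, and for all $t\in(0,T)$ and a.e. $x$, $u(t,x)=\sum_mI_m(g_m(t,x,\cdot))$ in $L^2(\Omega)$, with $g_m$ given by the Hu–Meyer formula. 2. $u\in\mathfrak M_c(T)$, and $u$ is a mild solution. 3. For every weight $c'$, every mild solution in $\mathfrak M_{c'}(T)$ coincides with $u$ in the sense of the identification above; in particular its chaos components $I_m(g_m(t,x,\cdot))$ are almost surely those of $u$, for all $m$, all $t\in(0,T)$ and a.e. $x$. That is, the Duhamel solution is the unique mild solution in $\mathfrak M(T)$. -/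

import Mathlib

open MeasureTheory ProbabilityTheory Filter Topology
open scoped ENNReal NNReal Nat

namespace StratonovichSPDE

noncomputable section

/-- The physical space `ℝ^d`. -/
abbrev Space (d : ℕ) : Type := EuclideanSpace ℝ (Fin d)

/-- Real square-integrable functions on `ℝ^d`. -/
abbrev L2Space (d : ℕ) : Type := Lp ℝ 2 (volume : Measure (Space d))

/-- Square-integrable real random variables. -/
abbrev L2Omega {Ω : Type*} [MeasurableSpace Ω] (P : Measure Ω) : Type _ := Lp ℝ 2 P

/-! ### White noise and elementary integrands -/

/-- A spatial white noise on `ℝ^d`, as an isonormal Gaussian process: `h ↦ W h = ∫ h dW` is a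
linear isometry from `L²(ℝ^d)` to `L²(Ω)` and every `W h` is a centred Gaussian variable with
variance `‖h‖²` (linearity makes the family jointly Gaussian). -/
structure WhiteNoise (d : ℕ) {Ω : Type*} [MeasurableSpace Ω] (P : Measure Ω) where
  int : L2Space d →ₗᵢ[ℝ] L2Omega P
  gaussian : ∀ h : L2Space d, P.map (int h : Ω → ℝ) = gaussianReal 0 (‖h‖₊ ^ 2)

/-- A finite linear combination of tensor products `h₁ ⊗ ⋯ ⊗ hₙ` of elements of `L²(ℝ^d)`. -/
structure Elementary (d n : ℕ) where
  size : ℕ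
  coef : Fin size → ℝ
  factor : Fin size → Fin n → L2Space d

/-- The function `(y₁, …, yₙ) ↦ ∑ⱼ aⱼ ∏ᵢ hⱼᵢ(yᵢ)`. -/
def Elementary.toFun {d n : ℕ} (S : Elementary d n) (y : Fin n → Space d) : ℝ :=
  ∑ j, S.coef j * ∏ i, S.factor j i (y i)

/-- The random variable `∑ⱼ aⱼ ∏ᵢ W(hⱼᵢ)`. -/
def Elementary.eval {d n : ℕ} {Ω : Type*} [MeasurableSpace Ω] {P : Measure Ω}
    (S : Elementary d n) (W : WhiteNoise d P) (ω : Ω) : ℝ :=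
  ∑ j, S.coef j * ∏ i, W.int (S.factor j i) ω

/-- The elementary function does not charge the diagonals: in each tensor product the factors have
pairwise disjoint supports. -/
def Elementary.OffDiagonal {d n : ℕ} (S : Elementary d n) : Prop :=
  ∀ j, ∀ i i', i ≠ i' → ∀ᵐ x : Space d, S.factor j i x * S.factor j i' x = 0

/-! ### Diagonals -/

/-- The point of `(ℝ^d)^N` with coordinates identified along the orbits of the involution `l`
(`x_k = x_{l(k)}`); `z` holds the value on each orbit, indexed by the least element. -/
def diagPoint {d N : ℕ} (l : Equiv.Perm (Fin N)) (hl : Function.Involutive l)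
    (z : {k : Fin N // k ≤ l k} → Space d) (k : Fin N) : Space d :=
  if h : k ≤ l k then z ⟨k, h⟩
  else z ⟨l k, by rw [hl k]; exact (not_le.mp h).le⟩

/-- A property of points of `(ℝ^d)^N` holds almost everywhere on every partial diagonal
(for every, possibly empty, set of disjoint pairs of identified coordinates), with respect to
Lebesgue measure on that diagonal. -/
def DiagonalAE {d : ℕ} (N : ℕ) (Q : (Fin N → Space d) → Prop) : Prop :=
  ∀ (l : Equiv.Perm (Fin N)) (hl : Function.Involutive l),
    ∀ᵐ z : ({k : Fin N // k ≤ l k} → Space d), Q (diagPoint l hl z)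

/-- Perfect pairings of `N` points: involutions without fixed points. -/
abbrev Pairing (N : ℕ) : Type :=
  {l : Equiv.Perm (Fin N) // (∀ k, l (l k) = k) ∧ ∀ k, l k ≠ k}

/-! ### Iterated Stratonovich and Itô integrals -/

/-- `‖f‖ₙ²`: the sum over all pairings of the `2n` variables of the integral of `|f ⊗ f|` over the
corresponding diagonal. -/
def stratNormSq {d : ℕ} (n : ℕ) (f : (Fin n → Space d) → ℝ) : ℝ≥0∞ :=
  ∑ l : Pairing (n + n), ∫⁻ z : ({k : Fin (n + n) // k ≤ l.1 k} → Space d),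
    ‖f (fun i => diagPoint l.1 l.2.1 z (Fin.castAdd n i))‖ₑ *
      ‖f (fun i => diagPoint l.1 l.2.1 z (Fin.natAdd n i))‖ₑ

/-- `X` is the iterated Stratonovich integral of `f`: the extension, by density with respect to
`‖·‖ₙ`, of the rule `∏ fᵢ(yᵢ) ↦ ∏ ∫ fᵢ dW`. -/
def IsStratonovich {d : ℕ} {Ω : Type*} [MeasurableSpace Ω] {P : Measure Ω} (W : WhiteNoise d P)
    (n : ℕ) (f : (Fin n → Space d) → ℝ) (X : L2Omega P) : Prop :=
  Measurable f ∧ stratNormSq n f < ∞ ∧ ∃ S : ℕ → Elementary d n,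
    Tendsto (fun k => stratNormSq n (fun y => f y - (S k).toFun y)) atTop (𝓝 0) ∧
    Tendsto (fun k => eLpNorm (fun ω => X ω - (S k).eval W ω) 2 P) atTop (𝓝 0)

/-- `X = I_m(g)` is the multiple Wiener-Itô integral of `g ∈ L²((ℝ^d)^m)`: the extension, by
`L²` density, of the rule `∏ hᵢ(yᵢ) ↦ ∏ ∫ hᵢ dW` for factors with disjoint supports. -/
def IsWienerIto {d : ℕ} {Ω : Type*} [MeasurableSpace Ω] {P : Measure Ω} (W : WhiteNoise d P)
    (m : ℕ) (g : (Fin m → Space d) → ℝ) (X : L2Omega P) : Prop :=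
  MemLp g 2 volume ∧ ∃ S : ℕ → Elementary d m, (∀ k, (S k).OffDiagonal) ∧
    Tendsto (fun k => eLpNorm (fun y => g y - (S k).toFun y) 2 volume) atTop (𝓝 0) ∧
    Tendsto (fun k => eLpNorm (fun ω => X ω - (S k).eval W ω) 2 P) atTop (𝓝 0)

/-! ### The Green's function and the integral operator -/

/-- The assumptions on the Green's function `G(t,x;y)` on `(0,T)`: symmetry, continuity, and the
three uniform bounds, with `α = d/𝔪`. -/
structure IsGreen {d : ℕ} (𝔪 T : ℝ) (G : ℝ → Space d → Space d → ℝ) : Prop where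
  symm : ∀ t ∈ Set.Ioo 0 T, ∀ x y, G t x y = G t y x
  cont : ContinuousOn (fun q : ℝ × Space d × Space d => G q.1 q.2.1 q.2.2)
    (Set.Ioo 0 T ×ˢ Set.univ)
  bounds : ∃ C : ℝ≥0, ∀ t ∈ Set.Ioo 0 T, ∀ y,
    (∫⁻ x, ‖G t x y‖ₑ) ≤ C ∧
    ENNReal.ofReal (t ^ ((d : ℝ) / 𝔪)) * (∫⁻ x, ‖G t x y‖ₑ ^ 2) ≤ C ∧
    ∀ x, t ^ ((d : ℝ) / 𝔪) * |G t x y| ≤ C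

/-- A formal series `u(t,x) = ∑ₙ 𝓘ₙ(fₙ(t,x,·))` of iterated Stratonovich integrals, given by its
coefficients `f n t x y = fₙ(t,x,y₁,…,yₙ)`. The coefficients are functions (not classes of
functions), since their values on the diagonals matter. -/
abbrev StratSeries (d : ℕ) : Type := (n : ℕ) → ℝ → Space d → (Fin n → Space d) → ℝ

/-- The operator `𝓗 u(t,x) = σ ∫₀ᵗ ∫ G(t-s,x;y) u(s,y) dW(y) ds` on formal series:
`(𝓗 f)ₙ₊₁(t,x,y₁,…,yₙ₊₁)` is `σ` times the symmetrization in `(y₁,…,yₙ₊₁)` of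
`∫₀ᵗ G(t-s,x;y₁) fₙ(s,y₁,y₂,…,yₙ₊₁) ds`. -/
def opH {d : ℕ} (σ : ℝ) (G : ℝ → Space d → Space d → ℝ) (f : StratSeries d) : StratSeries d
  | 0, _, _, _ => 0
  | n + 1, t, x, y => σ * (((n + 1)! : ℝ)⁻¹ * ∑ π : Equiv.Perm (Fin (n + 1)),
      ∫ s in (0 : ℝ)..t, G (t - s) x (y (π 0)) * f n s (y (π 0)) (fun i => y (π i.succ)))

/-- The deterministic series `e^{-tP} u₀ (x) = ∫ G(t,x;ξ) u₀(ξ) dξ`. -/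
def freeSeries {d : ℕ} (G : ℝ → Space d → Space d → ℝ) (u₀ : Space d → ℝ) : StratSeries d
  | 0, t, x, _ => ∫ ξ, G t x ξ * u₀ ξ
  | _ + 1, _, _, _ => 0

/-- The Duhamel series `∑ₙ 𝓗ⁿ e^{-tP} u₀`; the term `𝓗ⁿ e^{-tP} u₀` is an `n`-fold Stratonovich
integral. -/
def duhamelSeries {d : ℕ} (σ : ℝ) (G : ℝ → Space d → Space d → ℝ) (u₀ : Space d → ℝ) :
    StratSeries d :=
  fun n => ((opH σ G)^[n] (freeSeries G u₀)) n

/-! ### Chaos coefficients -/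

/-- The coefficient `(m+2k)! / (m! k! 2^k)` of the Hu-Meyer formula. -/
def huMeyerCoef (m k : ℕ) : ℝ := ((m + 2 * k)! : ℝ) / ((m ! : ℝ) * (k ! : ℝ) * 2 ^ k)

/-- The point `(y₁,…,y_m, z₁,z₁, …, z_k,z_k)`. -/
def traceTuple {d m k : ℕ} (y : Fin m → Space d) (z : Fin k → Space d) :
    Fin (m + 2 * k) → Space d :=
  Fin.append y (fun j : Fin (2 * k) => z ⟨j.1 / 2, by have := j.2; omega⟩)

/-- The `m`-th Wiener-Itô chaos coefficient `g_m(t,x,y)` of `∑ₙ 𝓘ₙ(fₙ(t,x,·))`, given by the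
Hu-Meyer formula. -/
def chaosCoef {d : ℕ} (f : StratSeries d) (m : ℕ) (t : ℝ) (x : Space d)
    (y : Fin m → Space d) : ℝ :=
  ∑' k : ℕ, huMeyerCoef m k * ∫ z : Fin k → Space d, f (m + 2 * k) t x (traceTuple y z)

/-- The `m`-th chaos coefficient associated with the absolute values `|fₙ|`. -/
def absChaosCoef {d : ℕ} (f : StratSeries d) (m : ℕ) (t : ℝ) (x : Space d)
    (y : Fin m → Space d) : ℝ≥0∞ :=
  ∑' k : ℕ, ENNReal.ofReal (huMeyerCoef m k) *
    ∫⁻ z : Fin k → Space d, ‖f (m + 2 * k) t x (traceTuple y z)‖ₑ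

/-! ### The space `𝔐(T)` -/

/-- Positive increasing weights `c_p → ∞`. -/
structure IsWeight (c : ℕ → ℝ) : Prop where
  pos : ∀ p, 0 < c p
  mono : Monotone c
  tendsto : Tendsto c atTop atTop

/-- Membership of `∑ₙ 𝓘ₙ(fₙ)` in `𝔐(T)` with weights `c`. -/
structure InM {d : ℕ} (σ : ℝ) (G : ℝ → Space d → Space d → ℝ) (T : ℝ) (c : ℕ → ℝ)
    (f : StratSeries d) : Prop where
  measurable : ∀ n, Measurable
    (fun q : Set.Ioo (0 : ℝ) T × Space d × (Fin n → Space d) => f n q.1 q.2.1 q.2.2)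
  symm : ∀ n, ∀ t ∈ Set.Ioo 0 T, ∀ x y, ∀ π : Equiv.Perm (Fin n),
    f n t x (fun i => y (π i)) = f n t x y
  /-- Every `𝓗^p u` is well defined: the time integrals converge absolutely. -/
  wellDefined : ∀ p n, ∀ t ∈ Set.Ioo 0 T, DiagonalAE (n + 2) (fun w : Fin (n + 2) → Space d =>
    IntervalIntegrable (fun s => G (t - s) (w 0) (w 1) *
      ((opH σ G)^[p] f) n s (w 1) (fun i => w i.succ.succ)) volume 0 t)
  /-- `sup_{m,p} sup_t c_p ∫∫ g_{m,p}(t,x,y)² dx dy < ∞`, where the `g_{m,p}` are the chaos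
  coefficients associated with the absolute values of the coefficients of `𝓗^p u`. -/
  bound : ∃ C : ℝ≥0, ∀ m p, ∀ t ∈ Set.Ioo 0 T,
    ENNReal.ofReal (c p) *
      (∫⁻ x, ∫⁻ y, absChaosCoef ((opH σ G)^[p] f) m t x y ^ 2) ≤ C

/-- Equality of the random fields defined by two formal series, as elements of a space on which
`𝓗` acts: for every `p`, the fields `𝓗^p u` and `𝓗^p u'` have the same Wiener-Itô chaos expansion
at every time. (This is the largest relation that is stable under `𝓗` and contained in equality of
chaos expansions.) -/
def FieldEq {d : ℕ} (σ : ℝ) (G : ℝ → Space d → Space d → ℝ) (T : ℝ)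
    (f f' : StratSeries d) : Prop :=
  ∀ p m, ∀ t ∈ Set.Ioo 0 T, ∀ᵐ q : Space d × (Fin m → Space d),
    chaosCoef ((opH σ G)^[p] f) m t q.1 q.2 = chaosCoef ((opH σ G)^[p] f') m t q.1 q.2

/-- Mild solutions: `u(t,x) = e^{-tP} u₀ (x) + 𝓗 u (t,x)` on `(0,T)`. -/
def IsMild {d : ℕ} (σ : ℝ) (G : ℝ → Space d → Space d → ℝ) (T : ℝ) (u₀ : Space d → ℝ)
    (f : StratSeries d) : Prop :=
  FieldEq σ G T f (fun n t x y => freeSeries G u₀ n t x y + opH σ G f n t x y)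

/-! ### Random fields -/

/-- `V m t x = I_m(g_m(t,x,·))` are the chaos components of the random field
`u = ∑ₙ 𝓘ₙ(fₙ) = ∑_m I_m(g_m)`. -/
def IsChaosField {d : ℕ} {Ω : Type*} [MeasurableSpace Ω] {P : Measure Ω} (W : WhiteNoise d P)
    (T : ℝ) (f : StratSeries d) (V : ℕ → ℝ → Space d → L2Omega P) : Prop :=
  ∀ m, ∀ t ∈ Set.Ioo 0 T, ∀ᵐ x : Space d, IsWienerIto W m (chaosCoef f m t x) (V m t x)

/-- `U` is the Duhamel solution `∑ₙ uₙ`, `uₙ(t,x) = 𝓘ₙ(fₙ(t,x,·))`: the coefficients belong to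
`L²(ℝ^d; 𝓑ₙ)` uniformly in time and the series converges in `L²(ℝ^d × Ω) = L²(ℝ^d; L²(Ω))`
uniformly in time. -/
def IsDuhamelSolution {d : ℕ} {Ω : Type*} [MeasurableSpace Ω] {P : Measure Ω}
    (W : WhiteNoise d P) (σ : ℝ) (G : ℝ → Space d → Space d → ℝ) (T : ℝ) (u₀ : Space d → ℝ)
    (U : ℝ → Space d → L2Omega P) : Prop :=
  ∃ u : ℕ → ℝ → Space d → L2Omega P,
    (∀ n, ∀ t ∈ Set.Ioo 0 T, ∀ᵐ x : Space d,
      IsStratonovich W n (duhamelSeries σ G u₀ n t x) (u n t x)) ∧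
    (∀ n, ∃ C : ℝ≥0, ∀ t ∈ Set.Ioo 0 T,
      (∫⁻ x, stratNormSq n (duhamelSeries σ G u₀ n t x)) ≤ C) ∧
    (∀ n, ∀ t ∈ Set.Ioo 0 T, MemLp (u n t) 2 volume) ∧
    (∀ t ∈ Set.Ioo 0 T, MemLp (U t) 2 volume) ∧
    (∃ C : ℝ≥0, ∀ t ∈ Set.Ioo 0 T, eLpNorm (U t) 2 volume ≤ C) ∧
    Tendsto (fun N : ℕ => ⨆ t ∈ Set.Ioo 0 T,
      eLpNorm (fun x => U t x - ∑ n ∈ Finset.range N, u n t x) 2 volume) atTop (𝓝 0)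

end

end StratonovichSPDE

open StratonovichSPDE

/-! ### Gaussian integration by parts for white noise -/

namespace StratonovichSPDE

/-! Everything rests on one estimate for the traces of the Duhamel coefficients. The absolute value
of `fₙ` is dominated by an iterated nonnegative integral that is linear in its initial term. In such
an integral each kernel is used in one of two ways: it is integrated over one of its space
variables, at the cost of its L¹ bound, or it is replaced by its supremum, of order `t^{-α}`. On a
diagonal of type `(m,k)`, with `n = m + 2k`, Cauchy-Schwarz splits the square of the `k`-fold trace
into a factor bounded uniformly in `(x,y)`, where `k` kernels are integrated and `m + k` bounded,
and a factor integrated over all variables, where `m + k` kernels are integrated and `k` bounded.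
The counts are complementary, so each cost occurs exactly `n` times in the product. Measured against
`e^{λt}` with `λ = n + 1`, the two costs are of order `n^{-1}` and `n^{-(1-α)}`. The factor `m!
huMeyerCoef²` from the Itô isometry is at most `2ⁿ n!`. What remains is `n^{-(1-α)n}` times a
geometric factor, and since `α < 1` this beats every geometric rate; the rate retained is `16^{-n}`.
The estimate is carried by `lintegral_traceSq_le` and `IsGreen.exists_trace_bound`.

Uniqueness needs no contraction. Applying `𝓗^r` to the mild equations of two solutions and
subtracting removes the free term, so the difference of the chaos coefficients of `𝓗^r f` and `𝓗^r
f'` does not depend on `r`. Membership in the space forces it to zero as `r → ∞`, because the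
weights tend to infinity (`IsMild.fieldEq`). The work lies in the fact that coefficients are
functions with values on diagonals: `𝓗` is additive only almost everywhere on each partial diagonal,
where the time integrals converge (`traceAE_iterate_opH_add`), and this must be carried over to the
chaos coefficients (`chaosCoef_iterate_opH_add`). For the Duhamel series, `𝓗^p` simply deletes the
degrees below `p`, so geometric decay in `n` becomes geometric decay in `p` and the weight `2^p` is
admissible.

The probabilistic side identifies both kinds of integral with Hermite polynomials. The relation
`E[H_m(W h) H_m(W g)] = m! ⟨h,g⟩^m` makes `h^{⊗m} ↦ H_m(W h)` a multiple of an isometry; the closure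
of its graph is `I_m`, and polarization together with the density of tensors with disjoint supports
matches it with `IsWienerIto`. For a power `h^{⊗n}` the Hu-Meyer formula is the expansion of `xⁿ` in
Hermite polynomials. Symmetric functions with finite traces are limits of sums of powers in all
trace norms at once, and these norms control `‖·‖ₙ`, since a pairing of two copies of the variables
consists of `m` cross pairs and `k` pairs inside each copy (`isStratonovich_sum_wienerIto`). The Itô
components indexed by `(m,k)` thus form one summable double family: grouped by `m + 2k` it is the
Stratonovich series, grouped by `m` the chaos expansion. -/

open Polynomial in
lemma integrable_eval_gaussianReal (v : ℝ≥0) (p : ℝ[X]) :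
    Integrable (fun x => p.eval x) (gaussianReal 0 v) := by
  induction p using Polynomial.induction_on' with
  | add p q hp hq => simp only [eval_add]; exact hp.add hq
  | monomial n a =>
    simp only [eval_monomial]
    refine Integrable.const_mul ?_ a
    have h := (memLp_id_gaussianReal' (μ := 0) (v := v) (n : ℝ≥0∞) (by simp)).integrable_norm_pow'
    refine (integrable_norm_iff (by fun_prop)).1 ?_
    simpa using h

open Polynomial in
/-- Gaussian integration by parts for polynomials. -/
lemma integral_mul_eval_gaussianReal (v : ℝ≥0) (p : ℝ[X]) :
    ∫ x, x * p.eval x ∂(gaussianReal 0 v) = v * ∫ x, (derivative p).eval x ∂(gaussianReal 0 v) := by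
  by_cases hv : v = 0
  · subst hv; simp
  have hint : ∀ q : ℝ[X], Integrable (fun x => q.eval x * gaussianPDFReal 0 v x) := by
    intro q
    have h := integrable_eval_gaussianReal v q
    rw [gaussianReal_of_var_ne_zero _ hv, integrable_withDensity_iff (measurable_gaussianPDF 0 v)
      (ae_of_all _ fun x => gaussianPDF_lt_top)] at h
    simpa [toReal_gaussianPDF] using h
  have hv' : (v : ℝ) ≠ 0 := by exact_mod_cast hv
  have hder : ∀ x, HasDerivAt (gaussianPDFReal 0 v) (-(x / v) * gaussianPDFReal 0 v x) x := by
    intro x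
    rw [gaussianPDFReal_def]
    have h1 : HasDerivAt (fun x : ℝ => -(x - 0) ^ 2 / (2 * (v : ℝ))) (-(x / v)) x := by
      refine ((((hasDerivAt_id' x).sub_const 0).pow 2).neg.div_const (2 * (v : ℝ))).congr_deriv ?_
      simp; field_simp
    refine (h1.exp.const_mul ((√(2 * Real.pi * v))⁻¹)).congr_deriv ?_
    ring
  have key := integral_mul_deriv_eq_deriv_mul_of_integrable (u := fun x => p.eval x)
    (v := gaussianPDFReal 0 v) (u' := fun x => (derivative p).eval x)
    (v' := fun x => -(x / v) * gaussianPDFReal 0 v x)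
    (fun x _ => p.hasDerivAt x) (fun x _ => hder x)
    (by
      have := (hint (p * C (-(v : ℝ)⁻¹) * X))
      refine this.congr (ae_of_all _ fun x => ?_)
      simp; ring)
    (hint (derivative p)) (hint p)
  rw [integral_gaussianReal_eq_integral_smul hv, integral_gaussianReal_eq_integral_smul hv]
  simp only [smul_eq_mul]
  have e1 : ∫ x, gaussianPDFReal 0 v x * (x * eval x p)
      = -v * ∫ x, eval x p * (-(x / v) * gaussianPDFReal 0 v x) := by
    rw [← integral_const_mul]
    congr 1; ext x; field_simp
  rw [e1, key]
  simp only [mul_comm (gaussianPDFReal 0 v _)]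
  ring

variable {d : ℕ} {Ω : Type*} [MeasurableSpace Ω] {P : Measure Ω}

section Noise

variable (W : WhiteNoise d P)

lemma WhiteNoise.int_add_smul (h g : L2Space d) (a b : ℝ) :
    (W.int (a • h + b • g) : Ω → ℝ) =ᵐ[P] fun ω => a * W.int h ω + b * W.int g ω := by
  rw [map_add, map_smul, map_smul]
  filter_upwards [Lp.coeFn_add (a • W.int h) (b • W.int g), Lp.coeFn_smul a (W.int h),
    Lp.coeFn_smul b (W.int g)] with ω h1 h2 h3
  rw [h1, Pi.add_apply, h2, h3]; simp

lemma WhiteNoise.aemeasurable_int (h : L2Space d) : AEMeasurable (W.int h) P :=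
  (Lp.aestronglyMeasurable _).aemeasurable

lemma WhiteNoise.memLp_int (h : L2Space d) {p : ℝ≥0∞} (hp : p ≠ ∞) : MemLp (W.int h) p P := by
  have := memLp_id_gaussianReal' (μ := 0) (v := ‖h‖₊ ^ 2) p hp
  rw [← W.gaussian h, memLp_map_measure_iff (by fun_prop) (W.aemeasurable_int h)] at this
  exact this

lemma WhiteNoise.integral_int (h : L2Space d) : ∫ ω, W.int h ω ∂P = 0 := by
  have : ∫ x, x ∂(P.map (W.int h)) = 0 := by rw [W.gaussian h]; exact integral_id_gaussianReal
  rwa [integral_map (W.aemeasurable_int h) (by fun_prop)] at this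

lemma WhiteNoise.integral_int_mul_int (h g : L2Space d) :
    ∫ ω, W.int h ω * W.int g ω ∂P = inner ℝ h g := by
  rw [← W.int.inner_map_map, MeasureTheory.L2.inner_def]
  simp [mul_comm]

/-- Joint normality comes from linearity: a linear functional of the pair is `W` of a linear
combination of `h` and `g`, hence Gaussian. -/
lemma WhiteNoise.hasGaussianLaw_pair [IsProbabilityMeasure P] (h g : L2Space d) :
    HasGaussianLaw (fun ω => (W.int h ω, W.int g ω)) P := by
  refine ⟨⟨fun L => ?_⟩⟩
  have hm : AEMeasurable (fun ω => (W.int h ω, W.int g ω)) P :=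
    (W.aemeasurable_int h).prodMk (W.aemeasurable_int g)
  have hL : (L ∘ fun ω => (W.int h ω, W.int g ω)) =ᵐ[P]
      W.int (L (1, 0) • h + L (0, 1) • g) := by
    filter_upwards [W.int_add_smul h g (L (1, 0)) (L (0, 1))] with ω hω
    rw [hω, Function.comp_apply]
    have : ((W.int h ω, W.int g ω) : ℝ × ℝ) = W.int h ω • (1, 0) + W.int g ω • (0, 1) := by simp
    rw [this, map_add, map_smul, map_smul]
    simp [mul_comm]
  have hmap : (P.map fun ω => (W.int h ω, W.int g ω)).map L
      = gaussianReal 0 (‖L (1, 0) • h + L (0, 1) • g‖₊ ^ 2) := by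
    rw [AEMeasurable.map_map_of_aemeasurable (by fun_prop) hm, Measure.map_congr hL, W.gaussian]
  have e1 : ∫ x, L x ∂(P.map fun ω => (W.int h ω, W.int g ω)) = 0 := by
    have : ∫ x, x ∂((P.map fun ω => (W.int h ω, W.int g ω)).map L) = 0 := by
      rw [hmap]; exact integral_id_gaussianReal
    rwa [integral_map (by fun_prop) (by fun_prop)] at this
  have e2 : Var[L; P.map fun ω => (W.int h ω, W.int g ω)]
      = (‖L (1, 0) • h + L (0, 1) • g‖₊ ^ 2 : ℝ≥0) := by
    have : Var[id; (P.map fun ω => (W.int h ω, W.int g ω)).map L]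
        = (‖L (1, 0) • h + L (0, 1) • g‖₊ ^ 2 : ℝ≥0) := by
      rw [hmap]; exact variance_id_gaussianReal
    rwa [variance_map (by fun_prop) (by fun_prop)] at this
  rw [hmap, e1, e2, Real.toNNReal_coe]

lemma WhiteNoise.indepFun_of_inner_eq_zero [IsProbabilityMeasure P] {h g : L2Space d}
    (hg : inner ℝ h g = 0) : IndepFun (W.int h) (W.int g) P := by
  refine (W.hasGaussianLaw_pair h g).indepFun_of_covariance_eq_zero ?_
  rw [covariance_eq_sub (W.memLp_int h (by simp)) (W.memLp_int g (by simp)), W.integral_int]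
  simpa [hg] using W.integral_int_mul_int h g

open Polynomial in
lemma WhiteNoise.memLp_eval [IsProbabilityMeasure P] (h : L2Space d) (p : ℝ[X])
    {r : ℝ≥0∞} (hr : r ≠ ∞) :
    MemLp (fun ω => p.eval (W.int h ω)) r P := by
  have hmul : ∀ n : ℕ, ∀ r : ℝ≥0∞, r ≠ ∞ → MemLp (fun ω => W.int h ω ^ n) r P := by
    intro n
    induction n with
    | zero => intro r _; simpa using memLp_const (1 : ℝ)
    | succ n ih =>
      intro r hr
      have : ENNReal.HolderTriple (2 * r) (2 * r) r := by
        constructor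
        rw [ENNReal.mul_inv (by simp) (by simp), ← add_mul, ENNReal.inv_two_add_inv_two, one_mul]
      have := (W.memLp_int h (p := 2 * r) (ENNReal.mul_ne_top (by simp) hr)).mul'
        (ih (2 * r) (ENNReal.mul_ne_top (by simp) hr)) (r := r)
      simpa [pow_succ, mul_comm] using this
  induction p using Polynomial.induction_on' with
  | add p q hp hq => simp only [eval_add]; exact hp.add hq
  | monomial n a => simpa using (hmul n r hr).const_mul a

open Polynomial in
lemma WhiteNoise.integrable_eval_mul_eval [IsProbabilityMeasure P] (h g : L2Space d) (p q : ℝ[X]) :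
    Integrable (fun ω => p.eval (W.int h ω) * q.eval (W.int g ω)) P :=
  (W.memLp_eval h p (r := 2) (by simp)).integrable_mul (W.memLp_eval g q (r := 2) (by simp))

open Polynomial in
-- Write `g = β h + k` with `k` orthogonal to `h`. Then `W h` and `W k` are independent, and the
-- one-dimensional integration by parts applies in the variable `W h` while `W k` is frozen.
lemma WhiteNoise.integral_mul_eval_mul_eval [IsProbabilityMeasure P] (h g : L2Space d)
    (p q : ℝ[X]) :
    ∫ ω, W.int h ω * (p.eval (W.int h ω) * q.eval (W.int g ω)) ∂P
      = ‖h‖ ^ 2 * ∫ ω, (derivative p).eval (W.int h ω) * q.eval (W.int g ω) ∂P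
        + inner ℝ h g * ∫ ω, p.eval (W.int h ω) * (derivative q).eval (W.int g ω) ∂P := by
  by_cases hh : h = 0
  · subst hh
    simp
  have hn : ‖h‖ ^ 2 ≠ 0 := by simpa using hh
  set β : ℝ := inner ℝ h g / ‖h‖ ^ 2 with hβ
  have hβ' : β * ‖h‖ ^ 2 = inner ℝ h g := by rw [hβ]; field_simp
  set k : L2Space d := (1 : ℝ) • g + (-β) • h with hk
  have horth : inner ℝ h k = 0 := by
    rw [hk, inner_add_right, inner_smul_right, inner_smul_right, real_inner_self_eq_norm_sq]
    linarith
  have hg : (W.int g : Ω → ℝ) =ᵐ[P] fun ω => β * W.int h ω + W.int k ω := by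
    filter_upwards [W.int_add_smul g h 1 (-β)] with ω hω
    rw [hk, hω]; ring
  have hind := W.indepFun_of_inner_eq_zero horth
  have hm : AEMeasurable (fun ω => (W.int h ω, W.int k ω)) P :=
    (W.aemeasurable_int h).prodMk (W.aemeasurable_int k)
  have hprod := (indepFun_iff_map_prod_eq_prod_map_map (W.aemeasurable_int h)
    (W.aemeasurable_int k)).1 hind
  have key : ∀ p q : ℝ[X], Integrable (fun x : ℝ × ℝ => p.eval x.1 * q.eval (β * x.1 + x.2))
        ((gaussianReal 0 (‖h‖₊ ^ 2)).prod (P.map (W.int k))) ∧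
      ∫ ω, p.eval (W.int h ω) * q.eval (W.int g ω) ∂P
      = ∫ z, ∫ x, p.eval x * q.eval (β * x + z) ∂(gaussianReal 0 (‖h‖₊ ^ 2))
        ∂(P.map (W.int k)) := by
    intro p q
    have hc : Continuous (fun x : ℝ × ℝ => p.eval x.1 * q.eval (β * x.1 + x.2)) := by fun_prop
    have e0 : (fun ω => p.eval (W.int h ω) * q.eval (W.int g ω)) =ᵐ[P]
        fun ω => p.eval (W.int h ω) * q.eval (β * W.int h ω + W.int k ω) := by
      filter_upwards [hg] with ω hω
      rw [hω]
    have hi : Integrable (fun x : ℝ × ℝ => p.eval x.1 * q.eval (β * x.1 + x.2))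
        (P.map fun ω => (W.int h ω, W.int k ω)) := by
      rw [integrable_map_measure hc.aestronglyMeasurable hm]
      exact (W.integrable_eval_mul_eval h g p q).congr e0
    have hi' := hi
    rw [hprod, W.gaussian h] at hi'
    refine ⟨hi', ?_⟩
    have : IsProbabilityMeasure (P.map (W.int k)) :=
      Measure.isProbabilityMeasure_map (W.aemeasurable_int k)
    rw [integral_congr_ae e0, ← integral_prod_symm _ hi', ← W.gaussian h, ← hprod,
      integral_map hm hc.aestronglyMeasurable]
  have : IsProbabilityMeasure (P.map (W.int k)) :=
    Measure.isProbabilityMeasure_map (W.aemeasurable_int k)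
  have e1 := (key (X * p) q).2
  have e2 := key (derivative p) q
  have e3 := key p (derivative q)
  have e1' : ∫ ω, W.int h ω * (p.eval (W.int h ω) * q.eval (W.int g ω)) ∂P
      = ∫ ω, (X * p).eval (W.int h ω) * q.eval (W.int g ω) ∂P := by
    congr 1; ext ω; simp; ring
  rw [e1', e1, e2.2, e3.2, ← hβ', mul_comm β, mul_assoc, ← mul_add, ← integral_const_mul β,
    ← integral_add (f := fun z => ∫ x, eval x (derivative p) * eval (β * x + z) q
      ∂gaussianReal 0 (‖h‖₊ ^ 2)) e2.1.swap.integral_prod_left, ← integral_const_mul]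
  · congr 1; ext z
    -- With `z` the frozen value of `W k`, the formula is applied to `p(x) q(βx + z)`. The chain
    -- rule yields the factor `β`, and `β ‖h‖²` is the inner product.
    have := integral_mul_eval_gaussianReal (‖h‖₊ ^ 2) (p * q.comp (C β * X + C z))
    simp only [eval_mul, eval_comp, eval_add, eval_C, eval_X, derivative_mul, derivative_comp] at this
    simp only [eval_mul, eval_X, mul_assoc]
    rw [this]
    simp only [NNReal.coe_pow, coe_nnnorm]
    congr 1
    rw [← integral_const_mul β, ← integral_add]
    · congr 1; ext x; simp
      ring
    · refine (integrable_eval_gaussianReal (‖h‖₊ ^ 2)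
        (derivative p * q.comp (C β * X + C z))).congr (ae_of_all _ fun x => ?_)
      simp only [eval_mul, eval_comp, eval_add, eval_C, eval_X]
    · refine ((integrable_eval_gaussianReal (‖h‖₊ ^ 2)
        (p * (derivative q).comp (C β * X + C z))).const_mul β).congr (ae_of_all _ fun x => ?_)
      simp only [eval_mul, eval_comp, eval_add, eval_C, eval_X]
  · exact e3.1.swap.integral_prod_left.const_mul β

end Noise

/-! ### Hermite polynomials with a variance parameter -/

open Polynomial in
/-- The Hermite polynomial of degree `m` and variance `c`. -/
noncomputable def hermiteVar (c : ℝ) : ℕ → ℝ[X]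
  | 0 => 1
  | 1 => X
  | m + 2 => X * hermiteVar c (m + 1) - C (c * (m + 1)) * hermiteVar c m

open Polynomial in
-- The Appell property, through which integration by parts lowers the degree.
lemma derivative_hermiteVar (c : ℝ) : ∀ m : ℕ,
    derivative (hermiteVar c (m + 1)) = C ((m : ℝ) + 1) * hermiteVar c m
  | 0 => by simp [hermiteVar]
  | 1 => by
    simp only [hermiteVar]
    simp
    rw [← two_mul, one_add_one_eq_two]
  | m + 2 => by
    have h1 := derivative_hermiteVar c (m + 1)
    have h2 := derivative_hermiteVar c m
    rw [hermiteVar, derivative_sub, derivative_mul, derivative_mul, h1, h2]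
    simp only [derivative_X, derivative_C, hermiteVar]
    push_cast
    have h3 : (C (2 : ℝ)) = 2 := rfl
    simp only [C_add, C_mul, C_1]
    ring_nf
    rw [h3]
    ring

open Polynomial in
-- Each integration by parts moves one degree of the first polynomial to a derivative of the second.
-- It contributes one factor `⟨h,g⟩`, and the Appell factors accumulate to `m!`.
lemma WhiteNoise.integral_hermite_mul_hermite [IsProbabilityMeasure P] (W : WhiteNoise d P)
    (h g : L2Space d) (m : ℕ) :
    ∫ ω, (hermiteVar (‖h‖ ^ 2) m).eval (W.int h ω) * (hermiteVar (‖g‖ ^ 2) m).eval (W.int g ω) ∂P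
      = m ! * (inner ℝ h g) ^ m := by
  -- The second term of the Hermite recurrence cancels the term `‖h‖² p'` of the integration by
  -- parts, so the derivative falls on `q` alone.
  have step : ∀ (m : ℕ) (q : ℝ[X]),
      ∫ ω, (hermiteVar (‖h‖ ^ 2) (m + 1)).eval (W.int h ω) * q.eval (W.int g ω) ∂P
      = inner ℝ h g * ∫ ω, (hermiteVar (‖h‖ ^ 2) m).eval (W.int h ω) *
          (derivative q).eval (W.int g ω) ∂P := by
    intro m q
    have hs := W.integral_mul_eval_mul_eval h g (hermiteVar (‖h‖ ^ 2) m) q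
    match m with
    | 0 => simpa [hermiteVar] using hs
    | m + 1 =>
      rw [derivative_hermiteVar] at hs
      have : ∀ ω, (hermiteVar (‖h‖ ^ 2) (m + 2)).eval (W.int h ω) * q.eval (W.int g ω)
          = W.int h ω * ((hermiteVar (‖h‖ ^ 2) (m + 1)).eval (W.int h ω) * q.eval (W.int g ω))
            - ‖h‖ ^ 2 * ((C ((m : ℝ) + 1) * hermiteVar (‖h‖ ^ 2) m).eval (W.int h ω)
              * q.eval (W.int g ω)) := by
        intro ω
        simp [hermiteVar]; ring
      simp_rw [this]
      rw [integral_sub, hs, integral_const_mul]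
      · ring
      · have := W.integrable_eval_mul_eval h g (X * hermiteVar (‖h‖ ^ 2) (m + 1)) q
        simpa [mul_assoc] using this
      · exact (W.integrable_eval_mul_eval h g _ q).const_mul _
  induction m with
  | zero => simp [hermiteVar]
  | succ m ih =>
    rw [step, derivative_hermiteVar]
    simp only [eval_mul, eval_C]
    simp_rw [mul_left_comm _ ((m : ℝ) + 1)]
    rw [integral_const_mul, ih, Nat.factorial_succ]
    push_cast
    ring

end StratonovichSPDE

namespace StratonovichSPDE

/-! ### Polarization -/

/-- The alternating sum over subsets, which extracts the multilinear part. -/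
noncomputable def altSum (N : ℕ) (θ : Finset (Fin N) → ℝ) : ℝ :=
  ∑ A : Finset (Fin N), (∏ i, if i ∈ A then (1 : ℝ) else -1) * θ A

/-- Inclusion-exclusion: expand `∏ᵢ (1 + rᵢ)` with `rᵢ = 0` if `R i` and `rᵢ = -1` otherwise. Only
the sets containing every `i` with `R i` contribute, and the product vanishes as soon as one `R i`
fails. -/
lemma altSum_indicator (N : ℕ) (R : Fin N → Prop) [DecidablePred R] :
    altSum N (fun A => if ∀ i, R i → i ∈ A then 1 else 0) = if ∀ i, R i then 1 else 0 := by
  have h1 : ∀ A : Finset (Fin N), (∏ i, if i ∈ A then (1 : ℝ) else -1) *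
      (if ∀ i, R i → i ∈ A then 1 else 0) =
      (∏ i ∈ A, (1 : ℝ)) * ∏ i ∈ Finset.univ \ A, (if R i then (0 : ℝ) else -1) := by
    intro A
    have h2 : (∏ i, if i ∈ A then (1 : ℝ) else -1) = ∏ i ∈ Finset.univ \ A, (-1 : ℝ) := by
      rw [Finset.prod_ite]
      simp only [Finset.prod_const_one, one_mul]
      congr 1; ext i; simp
    rw [h2]
    split_ifs with h
    · simp only [mul_one, Finset.prod_const_one, one_mul]
      refine Finset.prod_congr rfl fun i hi => ?_
      rw [if_neg]
      intro hR
      simp [h i hR] at hi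
    · push Not at h
      obtain ⟨i, hi, hiA⟩ := h
      rw [mul_zero, eq_comm, mul_eq_zero]
      right
      exact Finset.prod_eq_zero (i := i) (by simp [hiA]) (by simp [hi])
  have h3 := Finset.prod_add (fun _ : Fin N => (1 : ℝ)) (fun i => if R i then (0 : ℝ) else -1)
    Finset.univ
  rw [altSum, Finset.sum_congr rfl fun A _ => h1 A]
  rw [Finset.powerset_univ] at h3
  rw [← h3]
  split_ifs with h
  · exact Finset.prod_eq_one fun i _ => by simp [h i]
  · push Not at h
    obtain ⟨i, hi⟩ := h
    exact Finset.prod_eq_zero (Finset.mem_univ i) (by simp [hi])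

/-- The product of sums expands over maps `θ`. A map contributes to those `A` that contain its
range, and inclusion-exclusion retains exactly the surjective ones. -/
lemma altSum_prod_eq_sum_surjective (N : ℕ) {ι : Type*} [Fintype ι] [DecidableEq ι]
    (v : ι → Fin N → ℝ) :
    altSum N (fun A => ∏ j, ∑ i ∈ A, v j i)
      = ∑ θ : ι → Fin N, if Function.Surjective θ then ∏ j, v j (θ j) else 0 := by
  classical
  have h1 : ∀ A : Finset (Fin N), ∏ j, ∑ i ∈ A, v j i
      = ∑ θ : ι → Fin N, (∏ j, v j (θ j)) * if ∀ i, (∃ j, θ j = i) → i ∈ A then 1 else 0 := by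
    intro A
    rw [Finset.prod_univ_sum, ← Finset.sum_filter_add_sum_filter_not Finset.univ
      (fun θ : ι → Fin N => ∀ j, θ j ∈ A)]
    rw [Finset.sum_eq_zero (s := Finset.univ.filter fun θ : ι → Fin N => ¬ ∀ j, θ j ∈ A), add_zero]
    · refine Finset.sum_congr ?_ ?_
      · ext θ; simp [Fintype.mem_piFinset]
      · intro θ hθ
        rw [if_pos, mul_one]
        rintro i ⟨j, rfl⟩
        exact (Finset.mem_filter.1 hθ).2 j
    · intro θ hθ
      rw [if_neg, mul_zero]
      intro h
      exact (Finset.mem_filter.1 hθ).2 fun j => h _ ⟨j, rfl⟩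
  simp only [altSum, h1, Finset.mul_sum]
  rw [Finset.sum_comm]
  refine Finset.sum_congr rfl fun θ _ => ?_
  have := altSum_indicator N (fun i => ∃ j, θ j = i)
  rw [altSum] at this
  simp_rw [mul_left_comm _ (∏ j, v j (θ j))]
  rw [← Finset.mul_sum, this, mul_ite, mul_one, mul_zero]
  exact if_congr Iff.rfl rfl rfl

lemma altSum_prod_eq_zero {N : ℕ} {ι : Type*} [Fintype ι] (hι : Fintype.card ι < N)
    (v : ι → Fin N → ℝ) : altSum N (fun A => ∏ j, ∑ i ∈ A, v j i) = 0 := by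
  classical
  rw [altSum_prod_eq_sum_surjective]
  refine Finset.sum_eq_zero fun θ _ => if_neg fun h => ?_
  have := Fintype.card_le_of_surjective θ h
  simp at this
  omega

/-- The polarization (Ryser) formula. -/
lemma altSum_prod_eq_sum_perm {N : ℕ} (v : Fin N → Fin N → ℝ) :
    altSum N (fun A => ∏ j, ∑ i ∈ A, v j i) = ∑ π : Equiv.Perm (Fin N), ∏ j, v j (π j) := by
  classical
  rw [altSum_prod_eq_sum_surjective, ← Finset.sum_filter]
  symm
  refine Finset.sum_bij (fun (π : Equiv.Perm (Fin N)) _ => (π : Fin N → Fin N)) ?_ ?_ ?_ ?_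
  · intro π _
    simpa using π.surjective
  · intro π _ π' _ h
    exact DFunLike.coe_injective h
  · intro θ hθ
    have hs : Function.Surjective θ := by simpa using hθ
    exact ⟨Equiv.ofBijective θ ⟨Finite.injective_iff_surjective.2 hs, hs⟩, Finset.mem_univ _, rfl⟩
  · intro π _
    rfl

/-- The alternating sum kills products of fewer than `N` additive set functions. Each correction
term of a Hermite polynomial trades two factors `x` for one factor `c`, hence has fewer than `N`
factors. The list collects the factors split off so far, which is what closes the induction on `m`.
-/
lemma altSum_list_prod_mul_hermite {N : ℕ} (x c : Fin N → ℝ) (m : ℕ) :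
    ∀ l : List (Fin N → ℝ), l.length + m ≤ N →
      altSum N (fun A => (l.map fun v => ∑ i ∈ A, v i).prod *
        (hermiteVar (∑ i ∈ A, c i) m).eval (∑ i ∈ A, x i)) =
      altSum N (fun A => (l.map fun v => ∑ i ∈ A, v i).prod * (∑ i ∈ A, x i) ^ m) := by
  have hlist : ∀ l : List (Fin N → ℝ), l.length < N →
      altSum N (fun A => (l.map fun v => ∑ i ∈ A, v i).prod) = 0 := by
    intro l hl
    rw [← altSum_prod_eq_zero (ι := Fin l.length) (by simpa using hl) (fun j => l[j])]
    congr 1; ext A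
    exact (Fin.prod_univ_fun_getElem l (fun v => ∑ i ∈ A, v i)).symm
  have haddmul : ∀ (θ η : Finset (Fin N) → ℝ) (a : ℝ),
      altSum N (fun A => θ A - a * η A) = altSum N θ - a * altSum N η := by
    intro θ η a
    simp only [altSum, Finset.mul_sum, ← Finset.sum_sub_distrib]
    refine Finset.sum_congr rfl fun A _ => by ring
  induction m using Nat.strong_induction_on with
  | _ m ih =>
    intro l hl
    match m, ih, hl with
    | 0, _, _ => simp [hermiteVar]
    | 1, _, _ => simp [hermiteVar]
    | m + 2, ih, hl =>
      have e1 := ih (m + 1) (by omega) (x :: l) (by simp; omega)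
      have e2 := ih m (by omega) (c :: l) (by simp; omega)
      have e3 := hlist ((List.replicate m x) ++ c :: l) (by simp; omega)
      have e4 : ∀ A : Finset (Fin N), (l.map fun v => ∑ i ∈ A, v i).prod *
          (hermiteVar (∑ i ∈ A, c i) (m + 2)).eval (∑ i ∈ A, x i)
          = ((x :: l).map fun v => ∑ i ∈ A, v i).prod *
              (hermiteVar (∑ i ∈ A, c i) (m + 1)).eval (∑ i ∈ A, x i) - ((m : ℝ) + 1) *
            (((c :: l).map fun v => ∑ i ∈ A, v i).prod *
              (hermiteVar (∑ i ∈ A, c i) m).eval (∑ i ∈ A, x i)) := by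
        intro A
        simp only [hermiteVar, Polynomial.eval_sub, Polynomial.eval_mul, Polynomial.eval_X,
          Polynomial.eval_C, List.map_cons, List.prod_cons]
        ring
      have e5 : altSum N (fun A => ((c :: l).map fun v => ∑ i ∈ A, v i).prod *
          (∑ i ∈ A, x i) ^ m) = 0 := by
        rw [← e3]; congr 1; ext A; simp; ring
      simp_rw [e4]
      rw [haddmul, e1, e2, e5, mul_zero, sub_zero]
      congr 1; ext A; simp; ring

/-- The variance has to be additive in `A`; for vectors `hᵢ` this is provided by orthogonality. -/
lemma altSum_hermite {N : ℕ} (x c : Fin N → ℝ) :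
    altSum N (fun A => (hermiteVar (∑ i ∈ A, c i) N).eval (∑ i ∈ A, x i)) = N ! * ∏ i, x i := by
  have h := altSum_list_prod_mul_hermite x c N [] (by simp)
  simp only [List.map_nil, List.prod_nil, one_mul] at h
  rw [h]
  have h2 := altSum_prod_eq_sum_perm (fun _ : Fin N => x)
  simp only [Finset.prod_const, Finset.card_univ, Fintype.card_fin] at h2
  rw [h2, Finset.sum_congr rfl (fun π _ => Equiv.prod_comp π x)]
  simp [Fintype.card_perm]

/-! ### Monomials in terms of Hermite polynomials -/

open Polynomial in
lemma X_mul_hermiteVar (c : ℝ) (m : ℕ) :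
    X * hermiteVar c m = hermiteVar c (m + 1) + C (c * m) * hermiteVar c (m - 1) := by
  match m with
  | 0 => simp [hermiteVar]
  | m + 1 => simp [hermiteVar]

/-- `huMeyerCoef m k` counts the choices of `k` disjoint pairs among `m + 2k` points. The recursion
distinguishes whether the last point is unpaired, or paired with one of the `r + 2` points left
single by the others. -/
lemma huMeyerCoef_rec (r k : ℕ) :
    huMeyerCoef (r + 1) (k + 1) = huMeyerCoef r (k + 1) + (r + 2) * huMeyerCoef (r + 2) k := by
  simp only [huMeyerCoef]
  rw [show r + 1 + 2 * (k + 1) = (r + 2 * k + 2) + 1 by ring,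
    show r + 2 * (k + 1) = r + 2 * k + 2 by ring, show r + 2 + 2 * k = r + 2 * k + 2 by ring,
    Nat.factorial_succ (r + 2 * k + 2), Nat.factorial_succ k, Nat.factorial_succ (r + 1),
    Nat.factorial_succ r]
  have h1 := Nat.factorial_ne_zero r
  have h2 := Nat.factorial_ne_zero k
  push_cast
  field_simp
  ring

/-- The boundary case of the same count: in a perfect pairing the last point cannot be single. -/
lemma huMeyerCoef_zero_rec (k : ℕ) : huMeyerCoef 0 (k + 1) = huMeyerCoef 1 k := by
  simp only [huMeyerCoef]
  rw [show 0 + 2 * (k + 1) = (1 + 2 * k) + 1 by ring, Nat.factorial_succ (1 + 2 * k),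
    Nat.factorial_succ k]
  have h2 := Nat.factorial_ne_zero k
  push_cast
  field_simp
  simp
  ring

open Polynomial in
-- The Hu-Meyer formula for a single Gaussian variable: `k` contracted pairs contribute `c^k`. The
-- condition `2 * k ≤ n` guards against truncated subtraction.
lemma X_pow_eq_sum_hermiteVar (c : ℝ) (n : ℕ) :
    (X : ℝ[X]) ^ n = ∑ k ∈ Finset.range (n + 1), if 2 * k ≤ n then
      C (huMeyerCoef (n - 2 * k) k * c ^ k) * hermiteVar c (n - 2 * k) else 0 := by
  induction n with
  | zero => simp [huMeyerCoef, hermiteVar]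
  | succ n ih =>
    have ha : ∀ k, X * (if 2 * k ≤ n then
        C (huMeyerCoef (n - 2 * k) k * c ^ k) * hermiteVar c (n - 2 * k) else 0)
        = (if 2 * k ≤ n then C (huMeyerCoef (n - 2 * k) k * c ^ k) * hermiteVar c (n - 2 * k + 1)
            else 0)
          + (if 2 * k ≤ n then C (huMeyerCoef (n - 2 * k) k * c ^ k * (c * (n - 2 * k : ℕ))) *
              hermiteVar c (n - 2 * k - 1) else 0) := by
      intro k
      split_ifs
      · rw [mul_left_comm, X_mul_hermiteVar, mul_add, C_mul (a := huMeyerCoef _ _ * _), mul_assoc]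
      · simp
    -- The coefficient at index `k + 1` collects a raised degree from index `k + 1` and a further
    -- contraction from index `k`. For `n = 2k + 1` only the contraction survives, since all `n + 1`
    -- factors are then paired.
    have hb : ∀ k, (if 2 * (k + 1) ≤ n + 1 then C (huMeyerCoef (n + 1 - 2 * (k + 1)) (k + 1) *
          c ^ (k + 1)) * hermiteVar c (n + 1 - 2 * (k + 1)) else 0)
        = (if 2 * (k + 1) ≤ n then C (huMeyerCoef (n - 2 * (k + 1)) (k + 1) * c ^ (k + 1)) *
            hermiteVar c (n - 2 * (k + 1) + 1) else 0)
          + (if 2 * k ≤ n then C (huMeyerCoef (n - 2 * k) k * c ^ k * (c * (n - 2 * k : ℕ))) *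
              hermiteVar c (n - 2 * k - 1) else 0) := by
      intro k
      by_cases h1 : 2 * (k + 1) ≤ n
      · obtain ⟨r, rfl⟩ := Nat.exists_eq_add_of_le h1
        rw [if_pos h1, if_pos (by omega), if_pos (by omega),
          show 2 * (k + 1) + r + 1 - 2 * (k + 1) = r + 1 by omega,
          show 2 * (k + 1) + r - 2 * (k + 1) = r by omega,
          show 2 * (k + 1) + r - 2 * k = r + 2 by omega, show r + 2 - 1 = r + 1 by omega,
          ← add_mul, ← C_add, huMeyerCoef_rec]
        congr 2; push_cast; ring
      · rw [if_neg h1, zero_add]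
        by_cases h2 : n = 2 * k + 1
        · subst h2
          rw [if_pos (by omega), if_pos (by omega),
            show 2 * k + 1 + 1 - 2 * (k + 1) = 0 by omega,
            show 2 * k + 1 - 2 * k = 1 by omega, huMeyerCoef_zero_rec]
          congr 2; push_cast; ring
        · rw [if_neg (by omega)]
          split_ifs with h3
          · rw [show n - 2 * k = 0 by omega]; simp
          · rfl
    rw [pow_succ', ih, Finset.mul_sum, Finset.sum_congr rfl fun k _ => ha k,
      Finset.sum_add_distrib, Finset.sum_range_succ' _ (n + 1), Finset.sum_congr rfl fun k _ => hb k,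
      Finset.sum_add_distrib, Finset.sum_range_succ (fun k => if 2 * (k + 1) ≤ n then _ else _),
      Finset.sum_range_succ' (fun k => if 2 * k ≤ n then
        C (huMeyerCoef (n - 2 * k) k * c ^ k) * hermiteVar c (n - 2 * k + 1) else 0) n,
      if_neg (by omega : ¬ 2 * (n + 1) ≤ n)]
    have hc : huMeyerCoef (n + 1) 0 = huMeyerCoef n 0 := by
      simp [huMeyerCoef, Nat.factorial_ne_zero]
    simp [hc]
    ring

end StratonovichSPDE

namespace StratonovichSPDE

/-! ### Measure-theoretic preliminaries -/

lemma measurePreserving_comp_equiv {X ι ι' : Type*} [MeasureSpace X]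
    [SigmaFinite (volume : Measure X)] [Fintype ι] [Fintype ι'] (e : ι ≃ ι') :
    MeasurePreserving (fun y : ι' → X => fun i => y (e i)) := by
  have h : (fun y : ι' → X => fun i => y (e i))
      = MeasurableEquiv.piCongrLeft (fun _ : ι => X) e.symm := by
    ext y i
    rw [MeasurableEquiv.coe_piCongrLeft, Equiv.piCongrLeft_apply]
    simp
  rw [h]
  exact volume_measurePreserving_piCongrLeft (fun _ : ι => X) e.symm

/-- Rectangles form a generating π-system. Only rectangles inside a fixed product of sets `B i` are
tested, so the sides may be kept disjoint whenever the `B i` are. -/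
lemma ae_eq_zero_of_setIntegral_pi_eq_zero {X ι : Type*} [MeasurableSpace X] [Fintype ι]
    {ν : Measure (ι → X)} {B : ι → Set X} (hB : ∀ i, MeasurableSet (B i)) {g : (ι → X) → ℝ}
    (hg : IntegrableOn g (Set.univ.pi B) ν)
    (h0 : ∀ A : ι → Set X, (∀ i, MeasurableSet (A i)) → (∀ i, A i ⊆ B i) →
      ∫ y in Set.univ.pi A, g y ∂ν = 0) :
    g =ᵐ[ν.restrict (Set.univ.pi B)] 0 := by
  have hs : MeasurableSet (Set.univ.pi B) := MeasurableSet.univ_pi hB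
  have key : ∀ E : Set (ι → X), MeasurableSet E →
      ∫ y in E, g y ∂(ν.restrict (Set.univ.pi B)) = 0 := by
    have hrect : ∀ A : ι → Set X, (∀ i, MeasurableSet (A i)) →
        ∫ y in Set.univ.pi A, g y ∂(ν.restrict (Set.univ.pi B)) = 0 := by
      intro A hA
      rw [Measure.restrict_restrict (MeasurableSet.univ_pi hA), ← Set.pi_inter_distrib]
      exact h0 _ (fun i => (hA i).inter (hB i)) fun i => Set.inter_subset_right
    have huniv : ∫ y, g y ∂(ν.restrict (Set.univ.pi B)) = 0 := by
      have := hrect (fun _ => Set.univ) fun _ => MeasurableSet.univ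
      simpa using this
    intro E hE
    refine MeasurableSpace.induction_on_inter (C := fun E _ =>
      ∫ y in E, g y ∂(ν.restrict (Set.univ.pi B)) = 0) generateFrom_pi.symm isPiSystem_pi
      (by simp) ?_ ?_ ?_ E hE
    · rintro t ⟨A, hA, rfl⟩
      exact hrect A fun i => hA i (Set.mem_univ i)
    · intro t ht ih
      have := integral_add_compl ht hg
      rw [ih, zero_add, huniv] at this
      exact this
    · intro f hd hf ih
      rw [integral_iUnion hf hd hg.integrable.integrableOn]
      simp [ih]
  exact Integrable.ae_eq_zero_of_forall_setIntegral_eq_zero hg fun s hs _ => key s hs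

variable {d : ℕ}

lemma volume_setOf_eq_eq_zero (hd : 1 ≤ d) {m : ℕ} {i j : Fin m} (hij : i ≠ j) :
    volume {y : Fin m → Space d | y i = y j} = 0 := by
  have : Nonempty (Fin d) := ⟨⟨0, hd⟩⟩
  have hne : LinearMap.ker ((LinearMap.proj i : (Fin m → Space d) →ₗ[ℝ] Space d)
      - LinearMap.proj j) ≠ ⊤ := by
    intro h
    obtain ⟨v, hv⟩ := exists_ne (0 : Space d)
    have h1 : Function.update (0 : Fin m → Space d) i v ∈
        LinearMap.ker ((LinearMap.proj i : (Fin m → Space d) →ₗ[ℝ] Space d)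
      - LinearMap.proj j) := by rw [h]; trivial
    simp [Function.update_of_ne hij.symm, hv] at h1
  have := Measure.addHaar_submodule (volume : Measure (Fin m → Space d)) _ hne
  convert this using 2
  ext y; simp [sub_eq_zero]

/-! ### Tensor products -/

/-- The tensor product `y ↦ ∏ᵢ hᵢ(yᵢ)`. -/
noncomputable def tensor {m : ℕ} (h : Fin m → L2Space d) (y : Fin m → Space d) : ℝ :=
  ∏ i, h i (y i)

lemma stronglyMeasurable_tensor {m : ℕ} (h : Fin m → L2Space d) :
    StronglyMeasurable (tensor h) := by
  unfold tensor
  refine Finset.stronglyMeasurable_fun_prod _ fun i _ => ?_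
  exact (Lp.stronglyMeasurable (h i)).comp_measurable (measurable_pi_apply i)

lemma memLp_tensor {m : ℕ} (h : Fin m → L2Space d) : MemLp (tensor h) 2 := by
  rw [memLp_two_iff_integrable_sq (stronglyMeasurable_tensor h).aestronglyMeasurable]
  simp only [tensor, ← Finset.prod_pow]
  exact Integrable.fintype_prod (f := fun i x => (h i x) ^ 2) fun i => (Lp.memLp (h i)).integrable_sq

/-- The tensor product as an element of `L²`. -/
noncomputable def tensorLp {m : ℕ} (h : Fin m → L2Space d) :
    Lp ℝ 2 (volume : Measure (Fin m → Space d)) := (memLp_tensor h).toLp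

lemma coeFn_tensorLp {m : ℕ} (h : Fin m → L2Space d) : tensorLp h =ᵐ[volume] tensor h :=
  MemLp.coeFn_toLp _

lemma inner_tensorLp {m : ℕ} (h g : Fin m → L2Space d) :
    inner ℝ (tensorLp h) (tensorLp g) = ∏ i, inner ℝ (h i) (g i) := by
  simp only [MeasureTheory.L2.inner_def]
  rw [← integral_fintype_prod_volume_eq_prod]
  refine integral_congr_ae ?_
  filter_upwards [coeFn_tensorLp h, coeFn_tensorLp g] with y h1 h2
  rw [h1, h2]
  simp [tensor, Finset.prod_mul_distrib]

/-- Symmetrization in `L²`. -/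
noncomputable def symLp (m : ℕ) : Lp ℝ 2 (volume : Measure (Fin m → Space d)) →L[ℝ]
    Lp ℝ 2 (volume : Measure (Fin m → Space d)) :=
  ((m ! : ℝ)⁻¹) • ∑ π : Equiv.Perm (Fin m),
    (Lp.compMeasurePreservingₗᵢ ℝ _ (measurePreserving_comp_equiv (X := Space d) π)).toContinuousLinearMap

lemma symLp_apply {m : ℕ} (f : Lp ℝ 2 (volume : Measure (Fin m → Space d))) :
    symLp m f = ((m ! : ℝ)⁻¹) • ∑ π : Equiv.Perm (Fin m),
      Lp.compMeasurePreserving _ (measurePreserving_comp_equiv (X := Space d) π) f := by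
  simp only [symLp, smul_apply, sum_apply]
  rfl

lemma norm_symLp_le {m : ℕ} (f : Lp ℝ 2 (volume : Measure (Fin m → Space d))) :
    ‖symLp m f‖ ≤ ‖f‖ := by
  rw [symLp_apply, norm_smul]
  have h : ‖∑ π : Equiv.Perm (Fin m),
      Lp.compMeasurePreserving _ (measurePreserving_comp_equiv (X := Space d) π) f‖ ≤ m ! * ‖f‖ := by
    refine (norm_sum_le _ _).trans ?_
    simp [Lp.norm_compMeasurePreserving, Fintype.card_perm]
  have hm : (0 : ℝ) < m ! := by exact_mod_cast Nat.factorial_pos m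
  calc _ ≤ ‖(m ! : ℝ)⁻¹‖ * (m ! * ‖f‖) := by gcongr
    _ = ‖f‖ := by rw [Real.norm_of_nonneg (by positivity)]; field_simp

lemma symLp_tensorLp {m : ℕ} (h : Fin m → L2Space d) :
    symLp m (tensorLp h) = ((m ! : ℝ)⁻¹) • ∑ π : Equiv.Perm (Fin m), tensorLp (fun i => h (π i)) := by
  rw [symLp_apply, ← Equiv.sum_comp (Equiv.inv (Equiv.Perm (Fin m)))]
  congr 1
  refine Finset.sum_congr rfl fun π _ => ?_
  rw [tensorLp, Lp.toLp_compMeasurePreserving (memLp_tensor h)]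
  refine MemLp.toLp_congr _ _ (ae_of_all _ fun y => ?_)
  simp only [tensor, Function.comp_apply]
  rw [← Equiv.prod_comp π]
  simp

lemma symLp_tensorLp_const {m : ℕ} (h : L2Space d) :
    symLp m (tensorLp fun _ : Fin m => h) = tensorLp fun _ => h := by
  rw [symLp_tensorLp]
  simp only [Finset.sum_const, Finset.card_univ, Fintype.card_perm, Fintype.card_fin]
  rw [← Nat.cast_smul_eq_nsmul ℝ, smul_smul, inv_mul_cancel₀, one_smul]
  exact_mod_cast Nat.factorial_ne_zero m

lemma coeFn_sum_L2Space {ι : Type*} (A : Finset ι) (h : ι → L2Space d) :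
    (∑ i ∈ A, h i : L2Space d) =ᵐ[volume] fun x => ∑ i ∈ A, h i x := by
  classical
  induction A using Finset.induction_on with
  | empty =>
    simp only [Finset.sum_empty]
    exact Lp.coeFn_zero ℝ 2 (volume : Measure (Space d))
  | insert a s ha ih =>
    rw [Finset.sum_insert ha]
    filter_upwards [Lp.coeFn_add (h a) (∑ i ∈ s, h i), ih] with x h1 h2
    rw [h1, Pi.add_apply, h2, Finset.sum_insert ha]

lemma coeFn_finset_sum_smul {α ι : Type*} [MeasurableSpace α] {μ : Measure α} (A : Finset ι)
    (a : ι → ℝ) (f : ι → Lp ℝ 2 μ) :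
    (∑ i ∈ A, a i • f i : Lp ℝ 2 μ) =ᵐ[μ] fun x => ∑ i ∈ A, a i * f i x := by
  classical
  induction A using Finset.induction_on with
  | empty =>
    simp only [Finset.sum_empty]
    exact Lp.coeFn_zero ℝ 2 μ
  | insert b s hb ih =>
    rw [Finset.sum_insert hb]
    filter_upwards [Lp.coeFn_add (a b • f b) (∑ i ∈ s, a i • f i), ih, Lp.coeFn_smul (a b) (f b)]
      with x h1 h2 h3
    rw [h1, Pi.add_apply, h2, Finset.sum_insert hb, h3]
    rfl

lemma ae_comp_eval {ι : Type*} [Fintype ι] {p : Space d → Prop} (hp : ∀ᵐ x, p x) (i : ι) :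
    ∀ᵐ y : ι → Space d, p (y i) :=
  (Measure.quasiMeasurePreserving_eval (fun _ : ι => (volume : Measure (Space d))) i).ae hp

/-- The sign attached to a subset in the polarization formula. -/
noncomputable def polSign {m : ℕ} (A : Finset (Fin m)) : ℝ :=
  (m ! : ℝ)⁻¹ * ∏ i, if i ∈ A then (1 : ℝ) else -1

/-- Polarization: an operator that sees only symmetrizations is determined by its values on pure
powers `h^{⊗m}`, where it will be a Hermite polynomial. -/
lemma symLp_tensorLp_eq_sum_powers {m : ℕ} (h : Fin m → L2Space d) :
    symLp m (tensorLp h) = ∑ A : Finset (Fin m), polSign A •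
      tensorLp (fun _ : Fin m => ∑ i ∈ A, h i) := by
  have hA : ∀ᵐ y : Fin m → Space d, ∀ A : Finset (Fin m), ∀ j, (∑ i ∈ A, h i : L2Space d) (y j)
      = ∑ i ∈ A, h i (y j) := by
    rw [ae_all_iff]; intro A
    rw [ae_all_iff]; intro j
    exact ae_comp_eval (coeFn_sum_L2Space A h) j
  have h1 : ∀ᵐ y : Fin m → Space d, ∀ A : Finset (Fin m),
      tensorLp (fun _ : Fin m => ∑ i ∈ A, h i) y = tensor (fun _ : Fin m => ∑ i ∈ A, h i) y := by
    rw [ae_all_iff]; intro A; exact coeFn_tensorLp _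
  have h2 : ∀ᵐ y : Fin m → Space d, ∀ π : Equiv.Perm (Fin m),
      tensorLp (fun i => h (π i)) y = tensor (fun i => h (π i)) y := by
    rw [ae_all_iff]; intro A; exact coeFn_tensorLp _
  rw [symLp_tensorLp, Finset.smul_sum]
  refine Lp.ext ?_
  filter_upwards [hA, h1, h2, coeFn_finset_sum_smul Finset.univ polSign
    fun A : Finset (Fin m) => tensorLp (fun _ : Fin m => ∑ i ∈ A, h i),
    coeFn_finset_sum_smul Finset.univ (fun _ => (m ! : ℝ)⁻¹)
      fun π : Equiv.Perm (Fin m) => tensorLp (fun i => h (π i))] with y k1 k2 k3 k4 k5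
  rw [k4, k5]
  simp only [k2, k3, tensor, k1]
  have := altSum_prod_eq_sum_perm (fun j i => h i (y j))
  rw [← Finset.mul_sum, ← this, altSum, Finset.mul_sum]
  simp only [polSign, mul_assoc]

/-! ### Hermite chaos -/

variable {Ω : Type*} [MeasurableSpace Ω] {P : Measure Ω} [IsProbabilityMeasure P]

/-- The Hermite polynomial of degree `m` in `W h`, that is `I_m(h^{⊗m})`. -/
noncomputable def hermiteLp (W : WhiteNoise d P) (m : ℕ) (h : L2Space d) : L2Omega P :=
  (W.memLp_eval h (hermiteVar (‖h‖ ^ 2) m) (r := 2) (by simp)).toLp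

lemma coeFn_hermiteLp (W : WhiteNoise d P) (m : ℕ) (h : L2Space d) :
    hermiteLp W m h =ᵐ[P] fun ω => (hermiteVar (‖h‖ ^ 2) m).eval (W.int h ω) :=
  MemLp.coeFn_toLp _

/-- The graph of `h^{⊗m} ↦ I_m(h^{⊗m})`, extended by linearity. -/
noncomputable def chaosGraph (W : WhiteNoise d P) (m : ℕ) :
    Submodule ℝ (Lp ℝ 2 (volume : Measure (Fin m → Space d)) × L2Omega P) :=
  Submodule.span ℝ (Set.range fun h : L2Space d => (tensorLp (fun _ : Fin m => h), hermiteLp W m h))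

lemma inner_snd_eq_of_mem_span {E F : Type*} [NormedAddCommGroup E] [InnerProductSpace ℝ E]
    [NormedAddCommGroup F] [InnerProductSpace ℝ F] {S : Set (E × F)} {c : ℝ}
    (h : ∀ x ∈ S, ∀ y ∈ S, inner ℝ x.2 y.2 = c * inner ℝ x.1 y.1) {p q : E × F}
    (hp : p ∈ Submodule.span ℝ S) (hq : q ∈ Submodule.span ℝ S) :
    inner ℝ p.2 q.2 = c * inner ℝ p.1 q.1 := by
  induction hp, hq using Submodule.span_induction₂ with
  | mem_mem x y hx hy => exact h x hx y hy
  | zero_left => simp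
  | zero_right => simp
  | add_left x y z _ _ _ h1 h2 => simp only [Prod.snd_add, Prod.fst_add, inner_add_left, h1, h2]; ring
  | add_right x y z _ _ _ h1 h2 =>
    simp only [Prod.snd_add, Prod.fst_add, inner_add_right, h1, h2]; ring
  | smul_left r x y _ _ h1 =>
    simp only [Prod.smul_snd, Prod.smul_fst, real_inner_smul_left, h1]; ring
  | smul_right r x y _ _ h1 =>
    simp only [Prod.smul_snd, Prod.smul_fst, real_inner_smul_right, h1]; ring

/-- The Hermite relation extends bilinearly to the span. The norm of the second component is thus
governed by the first, so the relation is single-valued without any check of linear dependencies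
among powers. -/
lemma inner_chaosGraph (W : WhiteNoise d P) (m : ℕ) {p q} (hp : p ∈ chaosGraph W m)
    (hq : q ∈ chaosGraph W m) : inner ℝ p.2 q.2 = m ! * inner ℝ p.1 q.1 := by
  refine inner_snd_eq_of_mem_span ?_ hp hq
  rintro _ ⟨h, rfl⟩ _ ⟨g, rfl⟩
  simp only [inner_tensorLp, Finset.prod_const, Finset.card_univ, Fintype.card_fin]
  rw [← W.integral_hermite_mul_hermite, MeasureTheory.L2.inner_def]
  refine integral_congr_ae ?_
  filter_upwards [coeFn_hermiteLp W m h, coeFn_hermiteLp W m g] with ω h1 h2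
  rw [h1, h2]; simp [mul_comm]

lemma norm_sq_chaosGraph_closure (W : WhiteNoise d P) (m : ℕ) {p}
    (hp : p ∈ (chaosGraph W m).topologicalClosure) : ‖p.2‖ ^ 2 = m ! * ‖p.1‖ ^ 2 := by
  have hc : IsClosed {p : Lp ℝ 2 (volume : Measure (Fin m → Space d)) × L2Omega P |
      ‖p.2‖ ^ 2 = m ! * ‖p.1‖ ^ 2} := isClosed_eq (by fun_prop) (by fun_prop)
  refine closure_minimal (fun p hp => ?_) hc hp
  have := inner_chaosGraph W m hp hp
  simpa [real_inner_self_eq_norm_sq] using this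

/-- `X` is the Wiener-Itô integral of (the symmetrization of) `g`. -/
def IsChaos (W : WhiteNoise d P) (m : ℕ) (g : Lp ℝ 2 (volume : Measure (Fin m → Space d)))
    (X : L2Omega P) : Prop :=
  (symLp m g, X) ∈ (chaosGraph W m).topologicalClosure

lemma IsChaos.unique {W : WhiteNoise d P} {m : ℕ} {g} {X Y : L2Omega P} (hX : IsChaos W m g X)
    (hY : IsChaos W m g Y) : X = Y := by
  have := norm_sq_chaosGraph_closure W m (Submodule.sub_mem _ hX hY)
  simpa [sub_eq_zero] using this

lemma IsChaos.norm_sq_le {W : WhiteNoise d P} {m : ℕ} {g} {X : L2Omega P} (hX : IsChaos W m g X) :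
    ‖X‖ ^ 2 ≤ m ! * ‖g‖ ^ 2 := by
  rw [norm_sq_chaosGraph_closure W m hX]
  gcongr
  exact norm_symLp_le g

lemma IsChaos.add {W : WhiteNoise d P} {m : ℕ} {g g'} {X Y : L2Omega P} (hX : IsChaos W m g X)
    (hY : IsChaos W m g' Y) : IsChaos W m (g + g') (X + Y) := by
  have := Submodule.add_mem _ hX hY
  rwa [Prod.mk_add_mk, ← map_add] at this

lemma IsChaos.smul {W : WhiteNoise d P} {m : ℕ} {g} {X : L2Omega P} (hX : IsChaos W m g X)
    (a : ℝ) : IsChaos W m (a • g) (a • X) := by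
  have := Submodule.smul_mem _ a hX
  rwa [Prod.smul_mk, ← map_smul] at this

lemma isChaos_hermiteLp (W : WhiteNoise d P) (m : ℕ) (h : L2Space d) :
    IsChaos W m (tensorLp fun _ => h) (hermiteLp W m h) := by
  rw [IsChaos, symLp_tensorLp_const]
  exact Submodule.le_topologicalClosure _ (Submodule.subset_span ⟨h, rfl⟩)

omit [IsProbabilityMeasure P] in
lemma int_sum_ae {ι : Type*} (W : WhiteNoise d P) (A : Finset ι) (h : ι → L2Space d) :
    (W.int (∑ i ∈ A, h i) : Ω → ℝ) =ᵐ[P] fun ω => ∑ i ∈ A, W.int (h i) ω := by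
  rw [map_sum]
  have := coeFn_finset_sum_smul A (fun _ => 1) (fun i => W.int (h i))
  simpa using this

lemma norm_sq_sum_of_orthogonal {ι : Type*} (A : Finset ι) (h : ι → L2Space d)
    (horth : ∀ i i', i ≠ i' → inner ℝ (h i) (h i') = 0) :
    ‖∑ i ∈ A, h i‖ ^ 2 = ∑ i ∈ A, ‖h i‖ ^ 2 := by
  classical
  rw [← real_inner_self_eq_norm_sq, sum_inner]
  refine Finset.sum_congr rfl fun i hi => ?_
  rw [inner_sum, Finset.sum_eq_single i]
  · exact real_inner_self_eq_norm_sq _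
  · intro j _ hj; exact horth i j hj.symm
  · intro h; exact absurd hi h

/-- For orthogonal factors the Wiener-Itô integral of a tensor product is the product. -/
lemma isChaos_tensorLp_of_orthogonal (W : WhiteNoise d P) {m : ℕ} (h : Fin m → L2Space d)
    (horth : ∀ i i', i ≠ i' → inner ℝ (h i) (h i') = 0) :
    ∃ X : L2Omega P, X =ᵐ[P] (fun ω => ∏ i, W.int (h i) ω) ∧ IsChaos W m (tensorLp h) X := by
  -- The witness is the image of the polarized tensor under `h^{⊗m} ↦ H_m(W h)`. Orthogonality makes
  -- the variances additive, and `altSum_hermite` collapses the alternating sum to the product.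
  refine ⟨∑ A : Finset (Fin m), polSign A • hermiteLp W m (∑ i ∈ A, h i), ?_, ?_⟩
  · have h1 : ∀ᵐ ω ∂P, ∀ A : Finset (Fin m), hermiteLp W m (∑ i ∈ A, h i) ω
        = (hermiteVar (∑ i ∈ A, ‖h i‖ ^ 2) m).eval (∑ i ∈ A, W.int (h i) ω) := by
      rw [ae_all_iff]; intro A
      filter_upwards [coeFn_hermiteLp W m (∑ i ∈ A, h i), int_sum_ae W A h] with ω k1 k2
      rw [k1, k2, norm_sq_sum_of_orthogonal A h horth]
    filter_upwards [h1, coeFn_finset_sum_smul Finset.univ polSign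
      fun A : Finset (Fin m) => hermiteLp W m (∑ i ∈ A, h i)] with ω k1 k2
    rw [k2]
    simp only [k1]
    have := altSum_hermite (fun i => W.int (h i) ω) (fun i => ‖h i‖ ^ 2)
    rw [altSum] at this
    simp only [polSign, mul_assoc]
    rw [← Finset.mul_sum, this, ← mul_assoc, inv_mul_cancel₀, one_mul]
    exact_mod_cast Nat.factorial_ne_zero m
  · rw [IsChaos, symLp_tensorLp_eq_sum_powers]
    refine Submodule.le_topologicalClosure _ ?_
    have : (∑ A : Finset (Fin m), polSign A • tensorLp (fun _ : Fin m => ∑ i ∈ A, h i),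
        ∑ A : Finset (Fin m), polSign A • hermiteLp W m (∑ i ∈ A, h i))
        = ∑ A : Finset (Fin m), polSign A •
          (tensorLp (fun _ : Fin m => ∑ i ∈ A, h i), hermiteLp W m (∑ i ∈ A, h i)) := by
      ext1
      · simp [Prod.fst_sum]
      · simp [Prod.snd_sum]
    rw [this]
    exact Submodule.sum_mem _ fun A _ => Submodule.smul_mem _ _ (Submodule.subset_span ⟨_, rfl⟩)

/-! ### Elementary integrands -/

/-- The `L²` class of an elementary function. -/
noncomputable def Elementary.toLp {n : ℕ} (S : Elementary d n) :
    Lp ℝ 2 (volume : Measure (Fin n → Space d)) := ∑ j, S.coef j • tensorLp (S.factor j)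

lemma Elementary.coeFn_toLp {n : ℕ} (S : Elementary d n) : S.toLp =ᵐ[volume] S.toFun := by
  have h1 : ∀ᵐ y : Fin n → Space d, ∀ j, tensorLp (S.factor j) y = tensor (S.factor j) y := by
    rw [ae_all_iff]; intro j; exact coeFn_tensorLp _
  filter_upwards [coeFn_finset_sum_smul Finset.univ S.coef fun j => tensorLp (S.factor j), h1]
    with y k1 k2
  rw [Elementary.toLp, k1]
  simp only [k2]; rfl

lemma Elementary.OffDiagonal.inner_eq_zero {n : ℕ} {S : Elementary d n} (hS : S.OffDiagonal) (j)
    {i i' : Fin n} (hi : i ≠ i') : inner ℝ (S.factor j i) (S.factor j i') = 0 := by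
  rw [MeasureTheory.L2.inner_def]
  refine integral_eq_zero_of_ae ?_
  filter_upwards [hS j i i' hi] with x hx
  simpa [mul_comm] using hx

lemma Elementary.OffDiagonal.exists_isChaos {n : ℕ} {S : Elementary d n} (hS : S.OffDiagonal)
    (W : WhiteNoise d P) : ∃ X : L2Omega P, X =ᵐ[P] S.eval W ∧ IsChaos W n S.toLp X := by
  choose X hX hX' using fun j => isChaos_tensorLp_of_orthogonal W (S.factor j)
    (fun i i' hi => hS.inner_eq_zero j hi)
  refine ⟨∑ j, S.coef j • X j, ?_, ?_⟩
  · have h1 : ∀ᵐ ω ∂P, ∀ j, X j ω = ∏ i, W.int (S.factor j i) ω := by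
      rw [ae_all_iff]; exact hX
    filter_upwards [coeFn_finset_sum_smul Finset.univ S.coef X, h1] with ω k1 k2
    rw [k1]
    simp only [k2]; rfl
  · rw [Elementary.toLp]
    have h0 : IsChaos W n 0 (0 : L2Omega P) := by
      rw [IsChaos, map_zero]; exact Submodule.zero_mem _
    have : ∀ s : Finset (Fin S.size), IsChaos W n (∑ j ∈ s, S.coef j • tensorLp (S.factor j))
        (∑ j ∈ s, S.coef j • X j) := by
      intro s
      induction s using Finset.induction_on with
      | empty => simpa using h0
      | insert a s ha ih =>
        rw [Finset.sum_insert ha, Finset.sum_insert ha]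
        exact ((hX' a).smul _).add ih
    exact this _

/-- Tensor products with disjoint supports span a dense subspace. -/
lemma dense_offDiagonal (hd : 1 ≤ d) (m : ℕ) :
    (Submodule.span ℝ {z | ∃ h : Fin m → L2Space d,
      (∀ i i', i ≠ i' → ∀ᵐ x : Space d, h i x * h i' x = 0) ∧ tensorLp h = z}).topologicalClosure
      = ⊤ := by
  rw [Submodule.topologicalClosure_eq_top_iff, Submodule.eq_bot_iff]
  intro g hg
  have hrect : ∀ A : Fin m → Set (Space d), (∀ i, MeasurableSet (A i)) →
      (∀ i, volume (A i) ≠ ∞) → (∀ i i', i ≠ i' → Disjoint (A i) (A i')) →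
      ∫ y in Set.univ.pi A, g y = 0 := by
    intro A hA hfin hdisj
    have h1 := (Submodule.mem_orthogonal _ g).1 hg
      (tensorLp fun i => indicatorConstLp 2 (hA i) (hfin i) (1 : ℝ)) (Submodule.subset_span
        ⟨_, fun i i' hi => ?_, rfl⟩)
    · rw [MeasureTheory.L2.inner_def] at h1
      rw [← h1, ← integral_indicator (MeasurableSet.univ_pi hA)]
      refine integral_congr_ae ?_
      have h2 : ∀ᵐ y : Fin m → Space d, ∀ i, indicatorConstLp 2 (hA i) (hfin i) (1 : ℝ) (y i)
          = (A i).indicator (fun _ => 1) (y i) := by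
        rw [ae_all_iff]; intro i
        exact ae_comp_eval indicatorConstLp_coeFn i
      filter_upwards [h2, coeFn_tensorLp fun i => indicatorConstLp 2 (hA i) (hfin i) (1 : ℝ)]
        with y k1 k2
      rw [k2]
      simp only [tensor, k1]
      by_cases hy : y ∈ Set.univ.pi A
      · have : ∀ i, y i ∈ A i := fun i => hy i (Set.mem_univ i)
        simp [hy, this]
      · have : ∃ i, y i ∉ A i := by simpa using hy
        obtain ⟨i, hi⟩ := this
        rw [Finset.prod_eq_zero (Finset.mem_univ i) (by simp [hi])]
        simp [hy]
    · filter_upwards [indicatorConstLp_coeFn (p := 2) (hs := hA i) (hμs := hfin i) (c := (1 : ℝ)),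
        indicatorConstLp_coeFn (p := 2) (hs := hA i') (hμs := hfin i') (c := (1 : ℝ))] with x k1 k2
      rw [k1, k2]
      by_cases hx : x ∈ A i
      · have := Set.disjoint_left.1 (hdisj i i' hi) hx
        simp [this]
      · simp [hx]
  -- Off the diagonals, which are null sets, a point lies in a product of pairwise disjoint balls
  -- with centres in a countable dense set and common radius `1/(n+1)`. An orthogonal `g` vanishes
  -- on each such product, and there are countably many of them.
  obtain ⟨D, hDc, hDd⟩ := TopologicalSpace.exists_countable_dense (Space d)
  have hcover : ∀ c : Fin m → D, ∀ n : ℕ, (∀ i i', i ≠ i' →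
      Disjoint (Metric.ball (c i : Space d) (1 / (n + 1))) (Metric.ball (c i' : Space d) (1 / (n + 1)))) →
      ∀ᵐ y, y ∈ Set.univ.pi (fun i => Metric.ball (c i : Space d) (1 / (n + 1))) → g y = 0 := by
    intro c n hdisj
    have hB : ∀ i, MeasurableSet (Metric.ball (c i : Space d) (1 / (n + 1))) :=
      fun i => measurableSet_ball
    have hvol : volume (Set.univ.pi (fun i => Metric.ball (c i : Space d) (1 / (n + 1)))) ≠ ∞ := by
      rw [volume_pi_pi]
      exact ENNReal.prod_ne_top fun i _ => measure_ball_lt_top.ne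
    have := ae_eq_zero_of_setIntegral_pi_eq_zero (ν := volume) hB (g := g) ?_ ?_
    · exact (ae_restrict_iff' (MeasurableSet.univ_pi hB)).1 this
    · have hgm : MemLp g 2 (volume.restrict
          (Set.univ.pi (fun i => Metric.ball (c i : Space d) (1 / (n + 1))))) :=
        (Lp.memLp g).restrict _
      have : IsFiniteMeasure (volume.restrict
          (Set.univ.pi (fun i => Metric.ball (c i : Space d) (1 / (n + 1))))) :=
        ⟨by simpa using hvol.lt_top⟩
      exact hgm.integrable (by norm_num)
    · intro A hA hAB
      exact hrect A hA (fun i => measure_ne_top_of_subset (hAB i) measure_ball_lt_top.ne)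
        fun i i' hi => (hdisj i i' hi).mono (hAB i) (hAB i')
  have : Countable D := hDc.to_subtype
  have hall : ∀ᵐ y : Fin m → Space d, ∀ c : Fin m → D, ∀ n : ℕ, (∀ i i', i ≠ i' →
      Disjoint (Metric.ball (c i : Space d) (1 / (n + 1))) (Metric.ball (c i' : Space d) (1 / (n + 1)))) →
      y ∈ Set.univ.pi (fun i => Metric.ball (c i : Space d) (1 / (n + 1))) → g y = 0 := by
    rw [ae_all_iff]; intro c
    rw [ae_all_iff]; intro n
    by_cases hdisj : (∀ i i', i ≠ i' →
      Disjoint (Metric.ball (c i : Space d) (1 / (n + 1))) (Metric.ball (c i' : Space d) (1 / (n + 1))))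
    · filter_upwards [hcover c n hdisj] with y hy _ using hy
    · exact ae_of_all _ fun y h => absurd h hdisj
  have hinj : ∀ᵐ y : Fin m → Space d, ∀ i j, i ≠ j → y i ≠ y j := by
    rw [ae_all_iff]; intro i
    rw [ae_all_iff]; intro j
    by_cases hij : i = j
    · exact ae_of_all _ fun y h => absurd hij h
    · have : ∀ᵐ y : Fin m → Space d, y i ≠ y j := by
        rw [ae_iff]; simpa using volume_setOf_eq_eq_zero hd hij
      filter_upwards [this] with y hy _ using hy
  refine Lp.ext ?_
  filter_upwards [hall, hinj, Lp.coeFn_zero ℝ 2 (volume : Measure (Fin m → Space d))]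
    with y h1 h2 h3
  rw [h3]
  -- Moving two points to nearby centres costs less than `2/(n+1)`; out of a separation `4/(n+1)`
  -- there remains at least the sum of the two radii.
  have hδ : ∃ n : ℕ, ∀ i j, i ≠ j → 4 / ((n : ℝ) + 1) < dist (y i) (y j) := by
    have h4 : ∀ᶠ n : ℕ in atTop, ∀ i j, i ≠ j → 4 / ((n : ℝ) + 1) < dist (y i) (y j) := by
      rw [eventually_all]; intro i
      rw [eventually_all]; intro j
      by_cases hij : i = j
      · exact Eventually.of_forall fun n h => absurd hij h
      · have ht : Tendsto (fun n : ℕ => 4 / ((n : ℝ) + 1)) atTop (𝓝 0) := by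
          simpa [div_eq_mul_inv] using (tendsto_one_div_add_atTop_nhds_zero_nat (𝕜 := ℝ)).const_mul 4
        filter_upwards [ht.eventually (gt_mem_nhds (dist_pos.2 (h2 i j hij)))] with n hn _ using hn
    exact h4.exists
  obtain ⟨n, hn⟩ := hδ
  have hpos : (0 : ℝ) < 1 / (n + 1) := by positivity
  choose c hcD hc using fun i => hDd.exists_dist_lt (y i) hpos
  refine h1 (fun i => ⟨c i, hcD i⟩) n ?_ ?_
  · intro i j hij
    refine Metric.ball_disjoint_ball ?_
    have t1 := hn i j hij
    have t2 := dist_triangle4 (y i) (c i) (c j) (y j)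
    have t3 := hc i
    have t4 := hc j
    rw [dist_comm] at t4
    have : 4 / ((n : ℝ) + 1) = 1 / (n + 1) + 1 / (n + 1) + (1 / (n + 1) + 1 / (n + 1)) := by ring
    simp only
    linarith
  · intro i _
    exact hc i

lemma exists_offDiagonal_dist_lt (hd : 1 ≤ d) {m : ℕ}
    (g : Lp ℝ 2 (volume : Measure (Fin m → Space d))) {ε : ℝ} (hε : 0 < ε) :
    ∃ S : Elementary d m, S.OffDiagonal ∧ dist g S.toLp < ε := by
  have hg : g ∈ (Submodule.span ℝ {z | ∃ h : Fin m → L2Space d,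
      (∀ i i', i ≠ i' → ∀ᵐ x : Space d, h i x * h i' x = 0) ∧ tensorLp h = z}).topologicalClosure := by
    rw [dense_offDiagonal hd]; trivial
  obtain ⟨z, hz, hzd⟩ := Metric.mem_closure_iff.1 hg ε hε
  obtain ⟨N, a, s, rfl⟩ := Submodule.mem_span_set'.1 hz
  choose h hh hh' using fun j => (s j).2
  refine ⟨⟨N, a, h⟩, fun j i i' hi => hh j i i' hi, ?_⟩
  simp only [Elementary.toLp, hh']
  exact hzd

/-- The identity `‖X‖² = m! ‖g‖²` on the closed graph makes the projection to the first component
antilipschitz, so its range is closed. The preimage of this range under `symLp` contains the dense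
set of off-diagonal elementary functions. -/
lemma exists_isChaos (hd : 1 ≤ d) (W : WhiteNoise d P) {m : ℕ}
    (g : Lp ℝ 2 (volume : Measure (Fin m → Space d))) : ∃ X, IsChaos W m g X := by
  let Γ := (chaosGraph W m).topologicalClosure
  have hΓ : IsClosed (Γ : Set (Lp ℝ 2 (volume : Measure (Fin m → Space d)) × L2Omega P)) :=
    Submodule.isClosed_topologicalClosure _
  have : CompleteSpace Γ := hΓ.completeSpace_coe
  have hanti : AntilipschitzWith (m ! + 1) (fun p : Γ => p.1.1) := by
    refine AntilipschitzWith.of_le_mul_dist fun p q => ?_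
    have h1 := norm_sq_chaosGraph_closure W m (Submodule.sub_mem _ p.2 q.2)
    rw [Subtype.dist_eq, dist_eq_norm, dist_eq_norm]
    have h2 : (1 : ℝ) ≤ m ! := by exact_mod_cast Nat.factorial_pos m
    rw [Prod.norm_def]
    simp only [Prod.fst_sub, Prod.snd_sub] at h1 ⊢
    have h3 : 0 ≤ ‖p.1.1 - q.1.1‖ := norm_nonneg _
    refine max_le ?_ ?_
    · push_cast; nlinarith
    · push_cast
      refine abs_le_of_sq_le_sq' ?_ (by positivity) |>.2
      rw [h1]
      nlinarith [sq_nonneg ‖p.1.1 - q.1.1‖]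
  have hcl : IsClosed (Set.range (fun p : Γ => p.1.1)) :=
    hanti.isClosed_range (uniformContinuous_fst.comp uniformContinuous_subtype_val)
  have hcl' : IsClosed ((symLp m) ⁻¹' (Set.range (fun p : Γ => p.1.1))) :=
    hcl.preimage (symLp m).continuous
  have hmem : g ∈ (symLp m) ⁻¹' (Set.range (fun p : Γ => p.1.1)) := by
    rw [← hcl'.closure_eq, Metric.mem_closure_iff]
    intro ε hε
    obtain ⟨S, hS, hSd⟩ := exists_offDiagonal_dist_lt hd g hε
    obtain ⟨X, _, hX⟩ := hS.exists_isChaos W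
    exact ⟨S.toLp, ⟨⟨_, hX⟩, rfl⟩, hSd⟩
  obtain ⟨⟨⟨z, X⟩, hp⟩, hz⟩ := hmem
  simp only at hz
  subst hz
  exact ⟨X, hp⟩

/-- The Wiener-Itô integral `I_m`. -/
noncomputable def wienerIto (hd : 1 ≤ d) (W : WhiteNoise d P) (m : ℕ) :
    Lp ℝ 2 (volume : Measure (Fin m → Space d)) →L[ℝ] L2Omega P :=
  LinearMap.mkContinuous
    { toFun := fun g => (exists_isChaos hd W g).choose
      map_add' := fun g g' => (exists_isChaos hd W (g + g')).choose_spec.unique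
        ((exists_isChaos hd W g).choose_spec.add (exists_isChaos hd W g').choose_spec)
      map_smul' := fun a g => (exists_isChaos hd W (a • g)).choose_spec.unique
        ((exists_isChaos hd W g).choose_spec.smul a) } (√(m ! : ℝ)) fun g => by
    have := (exists_isChaos hd W g).choose_spec.norm_sq_le
    refine abs_le_of_sq_le_sq' ?_ (by positivity) |>.2
    rw [mul_pow, Real.sq_sqrt (by positivity)]
    exact this

lemma isChaos_wienerIto (hd : 1 ≤ d) (W : WhiteNoise d P) {m : ℕ}
    (g : Lp ℝ 2 (volume : Measure (Fin m → Space d))) : IsChaos W m g (wienerIto hd W m g) :=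
  (exists_isChaos hd W g).choose_spec

lemma norm_wienerIto_sq_le (hd : 1 ≤ d) (W : WhiteNoise d P) {m : ℕ}
    (g : Lp ℝ 2 (volume : Measure (Fin m → Space d))) : ‖wienerIto hd W m g‖ ^ 2 ≤ m ! * ‖g‖ ^ 2 :=
  (isChaos_wienerIto hd W g).norm_sq_le

lemma wienerIto_tensorLp_const (hd : 1 ≤ d) (W : WhiteNoise d P) {m : ℕ} (h : L2Space d) :
    wienerIto hd W m (tensorLp fun _ => h) = hermiteLp W m h :=
  (isChaos_wienerIto hd W _).unique (isChaos_hermiteLp W m h)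

lemma tendsto_eLpNorm_sub_iff {α : Type*} [MeasurableSpace α] {μ : Measure α} {f : ℕ → Lp ℝ 2 μ}
    {g : Lp ℝ 2 μ} {f' : ℕ → α → ℝ} {g' : α → ℝ} (hf : ∀ k, f k =ᵐ[μ] f' k) (hg : g =ᵐ[μ] g') :
    Tendsto (fun k => eLpNorm (fun x => g' x - f' k x) 2 μ) atTop (𝓝 0) ↔
      Tendsto f atTop (𝓝 g) := by
  rw [Lp.tendsto_Lp_iff_tendsto_eLpNorm']
  refine tendsto_congr fun k => ?_
  rw [eLpNorm_sub_comm]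
  refine eLpNorm_congr_ae ?_
  filter_upwards [hf k, hg] with x h1 h2
  simp [h1, h2]

lemma IsWienerIto.eq_wienerIto (hd : 1 ≤ d) {W : WhiteNoise d P} {m : ℕ}
    {g : (Fin m → Space d) → ℝ} {X : L2Omega P} (h : IsWienerIto W m g X) :
    X = wienerIto hd W m h.1.toLp := by
  obtain ⟨hg, S, hS, h1, h2⟩ := h
  choose Y hY hY' using fun k => (hS k).exists_isChaos W
  rw [tendsto_eLpNorm_sub_iff (fun k => (S k).coeFn_toLp) hg.coeFn_toLp] at h1
  rw [tendsto_eLpNorm_sub_iff hY (EventuallyEq.refl _ _)] at h2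
  refine IsChaos.unique (g := hg.toLp) ?_ (isChaos_wienerIto hd W _)
  have ht : Tendsto (fun k => (symLp m (S k).toLp, Y k)) atTop (𝓝 (symLp m hg.toLp, X)) :=
    (((symLp m).continuous.tendsto _).comp h1).prodMk_nhds h2
  exact (Submodule.isClosed_topologicalClosure _).mem_of_tendsto ht
    (Eventually.of_forall hY')

lemma isWienerIto_wienerIto (hd : 1 ≤ d) (W : WhiteNoise d P) {m : ℕ}
    {g : (Fin m → Space d) → ℝ} (hg : MemLp g 2) : IsWienerIto W m g (wienerIto hd W m hg.toLp) := by
  choose S hS hSd using fun k : ℕ => exists_offDiagonal_dist_lt hd hg.toLp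
    (Nat.one_div_pos_of_nat (n := k) (α := ℝ))
  choose Y hY hY' using fun k => (hS k).exists_isChaos W
  have ht : Tendsto (fun k => (S k).toLp) atTop (𝓝 hg.toLp) := by
    rw [tendsto_iff_dist_tendsto_zero]
    refine squeeze_zero (fun _ => dist_nonneg) (fun k => ?_) tendsto_one_div_add_atTop_nhds_zero_nat
    rw [dist_comm]; exact (hSd k).le
  refine ⟨hg, S, hS, ?_, ?_⟩
  · rwa [tendsto_eLpNorm_sub_iff (fun k => (S k).coeFn_toLp) hg.coeFn_toLp]
  · rw [tendsto_eLpNorm_sub_iff hY (EventuallyEq.refl _ _)]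
    have : Y = fun k => wienerIto hd W m (S k).toLp := by
      ext1 k; exact (hY' k).unique (isChaos_wienerIto hd W _)
    rw [this]
    exact ((wienerIto hd W m).continuous.tendsto _).comp ht

end StratonovichSPDE

namespace StratonovichSPDE

/-! ### Reindexing of diagonals -/

section Reindex

variable {X : Type*} [MeasureSpace X] [SigmaFinite (volume : Measure X)]

lemma lintegral_comp_equiv {ι ι' : Type*} [Fintype ι] [Fintype ι'] (e : ι ≃ ι')
    (f : (ι → X) → ℝ≥0∞) : ∫⁻ y : ι' → X, f (fun i => y (e i)) = ∫⁻ y : ι → X, f y := by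
  have h := measurePreserving_comp_equiv (X := X) e
  have h2 := measurePreserving_comp_equiv (X := X) e.symm
  let E : (ι' → X) ≃ᵐ (ι → X) :=
    { toFun := fun y i => y (e i), invFun := fun y i => y (e.symm i),
      left_inv := fun y => by ext i; simp, right_inv := fun y => by ext i; simp,
      measurable_toFun := h.measurable, measurable_invFun := h2.measurable }
  exact h.lintegral_comp_emb E.measurableEmbedding f

lemma lintegral_sumElim {ι ι' : Type*} [Fintype ι] [Fintype ι'] {f : (ι ⊕ ι' → X) → ℝ≥0∞}
    (hf : Measurable f) :
    ∫⁻ y, f y = ∫⁻ y : ι → X, ∫⁻ z : ι' → X, f (Sum.elim y z) := by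
  have h := volume_measurePreserving_sumPiEquivProdPi_symm (fun _ : ι ⊕ ι' => X)
  have he : ∀ q : (ι → X) × (ι' → X),
      (MeasurableEquiv.sumPiEquivProdPi (fun _ : ι ⊕ ι' => X)).symm q = Sum.elim q.1 q.2 := by
    intro q; ext i; cases i <;> rfl
  rw [← h.lintegral_comp hf, Measure.volume_eq_prod, lintegral_prod
    (f := fun q => f ((MeasurableEquiv.sumPiEquivProdPi fun _ : ι ⊕ ι' => X).symm q))
    (hf.comp h.measurable).aemeasurable]
  simp only [he]

omit [SigmaFinite (volume : Measure X)] in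
lemma measurable_sumElim {ι ι' : Type*} :
    Measurable (fun q : (ι → X) × (ι' → X) => (Sum.elim q.1 q.2 : ι ⊕ ι' → X)) := by
  refine measurable_pi_iff.2 fun i => ?_
  cases i with
  | inl i => exact (measurable_pi_apply i).comp measurable_fst
  | inr i => exact (measurable_pi_apply i).comp measurable_snd

lemma quasiMeasurePreserving_comp_injective {ι ι' : Type*} [Fintype ι] [Fintype ι'] {e : ι → ι'}
    (he : Function.Injective e) :
    Measure.QuasiMeasurePreserving (fun y : ι' → X => fun i => y (e i)) := by
  classical
  have h1 := (volume_preserving_piEquivPiSubtypeProd (fun _ : ι' => X)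
    (fun j => j ∈ Set.range e)).quasiMeasurePreserving
  have h2 := Measure.quasiMeasurePreserving_fst.comp h1
  have h3 := (@measurePreserving_comp_equiv X ι {j // j ∈ Set.range e} _ _ _
    (Subtype.fintype fun j => j ∈ Set.range e) (Equiv.ofInjective e he)).quasiMeasurePreserving
  exact h3.comp h2

end Reindex

/-- The representative of the orbit of `k` under the involution `l`. -/
def orbitRep {N : ℕ} (l : Equiv.Perm (Fin N)) (hl : Function.Involutive l) (k : Fin N) :
    {k : Fin N // k ≤ l k} :=
  if h : k ≤ l k then ⟨k, h⟩ else ⟨l k, by rw [hl k]; exact (not_le.mp h).le⟩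

lemma diagPoint_eq {d N : ℕ} (l : Equiv.Perm (Fin N)) (hl : Function.Involutive l)
    (z : {k : Fin N // k ≤ l k} → Space d) : diagPoint l hl z = fun k => z (orbitRep l hl k) := by
  ext1 k
  unfold diagPoint orbitRep
  split_ifs <;> rfl

lemma orbitRep_eq_iff {N : ℕ} (l : Equiv.Perm (Fin N)) (hl : Function.Involutive l) (k : Fin N)
    (v : {k : Fin N // k ≤ l k}) : orbitRep l hl k = v ↔ k = v ∨ k = l v := by
  obtain ⟨v, hv⟩ := v
  unfold orbitRep
  split_ifs with h
  · simp only [Subtype.mk.injEq]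
    constructor
    · exact Or.inl
    · rintro (h1 | h1)
      · exact h1
      · subst h1; rw [hl v] at h; exact le_antisymm h hv
  · simp only [Subtype.mk.injEq]
    constructor
    · intro h1; right; rw [← h1, hl k]
    · rintro (h1 | h1)
      · subst h1; exact absurd hv h
      · rw [h1, hl v]

/-- Permutations relating two maps with the same fibre cardinalities. -/
lemma exists_equiv_of_card_fibre_eq {α β V : Type*} [Fintype α] [Fintype β] [DecidableEq V]
    (f : α → V) (g : β → V)
    (h : ∀ v, (Finset.univ.filter fun a => f a = v).card = (Finset.univ.filter fun b => g b = v).card) :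
    ∃ τ : α ≃ β, ∀ a, f a = g (τ a) := by
  have e : ∀ v, Nonempty ({a // f a = v} ≃ {b // g b = v}) := by
    intro v
    refine Fintype.card_eq.1 ?_
    rw [Fintype.card_subtype, Fintype.card_subtype]
    exact h v
  exact ⟨Equiv.ofFiberEquiv fun v => (e v).some, fun a => (Equiv.ofFiberEquiv_map _ a).symm⟩

/-- The index map underlying `traceTuple`. -/
def traceIdx (m k : ℕ) (i : Fin (m + 2 * k)) : Fin m ⊕ Fin k :=
  Fin.addCases (motive := fun _ => Fin m ⊕ Fin k) (fun j => Sum.inl j)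
    (fun j => Sum.inr ⟨j.1 / 2, by have := j.2; omega⟩) i

lemma traceTuple_eq {d m k : ℕ} (y : Fin m → Space d) (z : Fin k → Space d) :
    traceTuple y z = fun i => Sum.elim y z (traceIdx m k i) := by
  ext1 i
  refine Fin.addCases (fun j => ?_) (fun j => ?_) i
  · simp [traceTuple, traceIdx]
  · simp [traceTuple, traceIdx]

lemma measurable_traceTuple {d m k : ℕ} :
    Measurable (fun q : (Fin m → Space d) × (Fin k → Space d) => traceTuple q.1 q.2) := by
  simp only [traceTuple_eq]
  exact measurable_pi_iff.2 fun i => (measurable_pi_apply _).comp measurable_sumElim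

lemma card_filter_addCases {m n : ℕ} (p : Fin (m + n) → Prop) [DecidablePred p] :
    (Finset.univ.filter p).card = (Finset.univ.filter fun j => p (Fin.castAdd n j)).card +
      (Finset.univ.filter fun j => p (Fin.natAdd m j)).card := by
  simp only [Finset.card_filter, Fin.sum_univ_add]

lemma card_traceIdx_inl (m k : ℕ) (c : Fin m) :
    (Finset.univ.filter fun i => traceIdx m k i = Sum.inl c).card = 1 := by
  rw [card_filter_addCases]
  simp [traceIdx, Finset.filter_eq']

lemma card_traceIdx_inr (m k : ℕ) (c : Fin k) :
    (Finset.univ.filter fun i => traceIdx m k i = Sum.inr c).card = 2 := by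
  rw [card_filter_addCases]
  simp only [traceIdx, Fin.addCases_left, reduceCtorEq, Finset.filter_false, Finset.card_empty,
    Fin.addCases_right, Sum.inr.injEq, zero_add]
  have hc := c.2
  rw [Finset.card_eq_two]
  refine ⟨⟨2 * c.1, by omega⟩, ⟨2 * c.1 + 1, by omega⟩, by simp, ?_⟩
  ext j
  simp only [Finset.mem_filter, Finset.mem_univ, true_and, Finset.mem_insert,
    Finset.mem_singleton, Fin.ext_iff]
  omega

/-! ### Pairings of two copies of the variables and the traces they induce -/

section Pairings

variable {d : ℕ}

/-- Every orbit has two members: one in each copy (`m` orbits), both in the first (`k` orbits), or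
both in the second. Since each copy has `n` coordinates, the last two kinds are equally numerous. -/
lemma exists_fibre_equiv {n : ℕ} {V : Type*} [Fintype V] [DecidableEq V] (κ κ' : Fin n → V)
    (hκ : ∀ v, (Finset.univ.filter fun i => κ i = v).card +
      (Finset.univ.filter fun i => κ' i = v).card = 2) :
    ∃ m k, m + 2 * k = n ∧ ∃ e : Fin m ⊕ (Fin k ⊕ Fin k) ≃ V,
      (∀ c, (Finset.univ.filter fun i => κ i = e (Sum.inl c)).card = 1) ∧
      (∀ c, (Finset.univ.filter fun i => κ i = e (Sum.inr (Sum.inl c))).card = 2) ∧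
      (∀ c, (Finset.univ.filter fun i => κ i = e (Sum.inr (Sum.inr c))).card = 0) := by
  set a : V → ℕ := fun v => (Finset.univ.filter fun i => κ i = v).card with ha
  set b : V → ℕ := fun v => (Finset.univ.filter fun i => κ' i = v).card with hb
  have hab : ∀ v, a v + b v = 2 := hκ
  have hsa : ∑ v, a v = n := by
    have := Finset.card_eq_sum_card_fiberwise (f := κ) (s := Finset.univ) (t := Finset.univ)
      (fun _ _ => Finset.mem_coe.2 (Finset.mem_univ _))
    simpa [ha] using this.symm
  have hsb : ∑ v, b v = n := by
    have := Finset.card_eq_sum_card_fiberwise (f := κ') (s := Finset.univ) (t := Finset.univ)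
      (fun _ _ => Finset.mem_coe.2 (Finset.mem_univ _))
    simpa [hb] using this.symm
  clear_value a b
  set m := Fintype.card {v // a v = 1} with hm
  set k := Fintype.card {v // a v = 2} with hk
  set k' := Fintype.card {v // a v = 0} with hk'
  have hcount : ∀ (c : ℕ), Fintype.card {v // a v = c} = ∑ v, if a v = c then 1 else 0 := by
    intro c; rw [Fintype.card_subtype, Finset.card_filter]
  have h1 : m + 2 * k = n := by
    rw [hm, hk, hcount, hcount, ← hsa, Finset.mul_sum, ← Finset.sum_add_distrib]
    refine Finset.sum_congr rfl fun v _ => ?_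
    have := hab v
    split_ifs <;> omega
  have h2 : m + 2 * k' = n := by
    rw [hm, hk', hcount, hcount, ← hsb, Finset.mul_sum, ← Finset.sum_add_distrib]
    refine Finset.sum_congr rfl fun v _ => ?_
    have := hab v
    split_ifs <;> omega
  have h3 : k' = k := by omega
  have e1 : Fin m ≃ {v // a v = 1} := (Fintype.equivFin _).symm
  have e2 : Fin k ≃ {v // a v = 2} := (Fintype.equivFin _).symm
  have e0 : Fin k ≃ {v // a v = 0} := (finCongr h3.symm).trans (Fintype.equivFin _).symm
  let ef : Fin m ⊕ (Fin k ⊕ Fin k) → V := Sum.elim (fun i => e1 i)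
    (Sum.elim (fun i => e2 i) (fun i => e0 i))
  have hainl : ∀ i, a (ef (Sum.inl i)) = 1 := fun i => (e1 i).2
  have hainrl : ∀ i, a (ef (Sum.inr (Sum.inl i))) = 2 := fun i => (e2 i).2
  have hainrr : ∀ i, a (ef (Sum.inr (Sum.inr i))) = 0 := fun i => (e0 i).2
  have hbij : Function.Bijective ef := by
    constructor
    · intro x y hxy
      have hxa : a (ef x) = a (ef y) := by rw [hxy]
      rcases x with x | x | x <;> rcases y with y | y | y <;>
        simp only [hainl, hainrl, hainrr] at hxa <;> try omega
      · have := e1.injective (Subtype.ext hxy); rw [this]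
      · have := e2.injective (Subtype.ext hxy); rw [this]
      · have := e0.injective (Subtype.ext hxy); rw [this]
    · intro v
      have := hab v
      have h : a v = 1 ∨ a v = 2 ∨ a v = 0 := by omega
      rcases h with h | h | h
      · exact ⟨Sum.inl (e1.symm ⟨v, h⟩), by simp [ef]⟩
      · exact ⟨Sum.inr (Sum.inl (e2.symm ⟨v, h⟩)), by simp [ef]⟩
      · exact ⟨Sum.inr (Sum.inr (e0.symm ⟨v, h⟩)), by simp [ef]⟩
  have haf : ∀ v, (Finset.univ.filter fun i => κ i = v).card = a v := fun v => (congrFun ha v).symm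
  refine ⟨m, k, h1, Equiv.ofBijective ef hbij, fun c => ?_, fun c => ?_, fun c => ?_⟩
  · exact (haf _).trans (hainl c)
  · exact (haf _).trans (hainrl c)
  · exact (haf _).trans (hainrr c)

/-- Two index maps with the same fibre cardinalities differ by a permutation, which a symmetric
function does not see. -/
lemma apply_comp_eq_traceIdx {n m k : ℕ} (hmk : m + 2 * k = n) {V : Type*} [DecidableEq V]
    (Φ : (n : ℕ) → (Fin n → Space d) → ℝ≥0∞)
    (hsymm : ∀ (π : Equiv.Perm (Fin n)) y, Φ n (fun i => y (π i)) = Φ n y)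
    (κ : Fin n → V) {ι : Fin m ⊕ Fin k → V} (hι : Function.Injective ι)
    (c1 : ∀ c, (Finset.univ.filter fun i => κ i = ι (Sum.inl c)).card = 1)
    (c2 : ∀ c, (Finset.univ.filter fun i => κ i = ι (Sum.inr c)).card = 2)
    (c0 : ∀ v, (∀ c, v ≠ ι c) → (Finset.univ.filter fun i => κ i = v).card = 0)
    (z : V → Space d) :
    Φ n (fun i => z (κ i)) = Φ (m + 2 * k) (fun i => z (ι (traceIdx m k i))) := by
  subst hmk
  obtain ⟨τ, hτ⟩ := exists_equiv_of_card_fibre_eq κ (fun i => ι (traceIdx m k i)) (by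
    intro v
    by_cases hc : ∃ c, v = ι c
    · obtain ⟨c, rfl⟩ := hc
      simp only [hι.eq_iff]
      rcases c with c | c
      · rw [c1, card_traceIdx_inl]
      · rw [c2, card_traceIdx_inr]
    · push Not at hc
      rw [c0 v hc, eq_comm, Finset.card_eq_zero, Finset.filter_eq_empty_iff]
      intro i _ h
      exact hc _ h.symm)
  simp only [hτ]
  exact hsymm τ (fun i => z (ι (traceIdx m k i)))

/-- The orbits joining the two copies are the common variables `y`. The orbits inside one copy are
integrated independently of those inside the other, which turns the product into the square of a
single trace. -/
lemma lintegral_pairing_eq {n : ℕ} {V : Type*} [Fintype V] (κ κ' : Fin n → V)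
    [DecidableEq V]
    (hκ : ∀ v, (Finset.univ.filter fun i => κ i = v).card +
      (Finset.univ.filter fun i => κ' i = v).card = 2)
    (Φ : (n : ℕ) → (Fin n → Space d) → ℝ≥0∞) (hΦ : Measurable (Φ n))
    (hsymm : ∀ (π : Equiv.Perm (Fin n)) y, Φ n (fun i => y (π i)) = Φ n y) :
    ∃ m k, m + 2 * k = n ∧ ∫⁻ z : V → Space d, Φ n (fun i => z (κ i)) * Φ n (fun i => z (κ' i))
      = ∫⁻ y : Fin m → Space d, (∫⁻ w : Fin k → Space d, Φ (m + 2 * k) (traceTuple y w)) ^ 2 := by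
  obtain ⟨m, k, hmk, e, h1, h2, h0⟩ := exists_fibre_equiv κ κ' hκ
  refine ⟨m, k, hmk, ?_⟩
  have h1' : ∀ c, (Finset.univ.filter fun i => κ' i = e (Sum.inl c)).card = 1 := fun c => by
    have := hκ (e (Sum.inl c)); rw [h1] at this; omega
  have h2' : ∀ c, (Finset.univ.filter fun i => κ' i = e (Sum.inr (Sum.inr c))).card = 2 :=
    fun c => by have := hκ (e (Sum.inr (Sum.inr c))); rw [h0] at this; omega
  have h0' : ∀ c, (Finset.univ.filter fun i => κ' i = e (Sum.inr (Sum.inl c))).card = 0 :=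
    fun c => by have := hκ (e (Sum.inr (Sum.inl c))); rw [h2] at this; omega
  have hκ1 := apply_comp_eq_traceIdx hmk Φ hsymm κ (ι := fun c => e (Sum.map id Sum.inl c))
    (e.injective.comp (Sum.map_injective.2 ⟨Function.injective_id, Sum.inl_injective⟩)) h1 h2 (by
      intro v hv
      obtain ⟨c, rfl⟩ := e.surjective v
      rcases c with c | c | c
      · exact absurd rfl (hv (Sum.inl c))
      · exact absurd rfl (hv (Sum.inr c))
      · exact h0 c)
  have hκ2 := apply_comp_eq_traceIdx hmk Φ hsymm κ' (ι := fun c => e (Sum.map id Sum.inr c))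
    (e.injective.comp (Sum.map_injective.2 ⟨Function.injective_id, Sum.inr_injective⟩)) h1' h2' (by
      intro v hv
      obtain ⟨c, rfl⟩ := e.surjective v
      rcases c with c | c | c
      · exact absurd rfl (hv (Sum.inl c))
      · exact h0' c
      · exact absurd rfl (hv (Sum.inr c)))
  simp only [hκ1, hκ2]
  have hΦ' : Measurable (Φ (m + 2 * k)) := by
    subst hmk
    exact hΦ
  have hm1 : Measurable fun x : Fin m ⊕ (Fin k ⊕ Fin k) → Space d =>
      Φ (m + 2 * k) (fun i => x (Sum.map id Sum.inl (traceIdx m k i))) :=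
    hΦ'.comp (measurable_pi_iff.2 fun i => measurable_pi_apply _)
  have hm2 : Measurable fun x : Fin m ⊕ (Fin k ⊕ Fin k) → Space d =>
      Φ (m + 2 * k) (fun i => x (Sum.map id Sum.inr (traceIdx m k i))) :=
    hΦ'.comp (measurable_pi_iff.2 fun i => measurable_pi_apply _)
  have hm12 : Measurable fun x : Fin m ⊕ (Fin k ⊕ Fin k) → Space d =>
      Φ (m + 2 * k) (fun i => x (Sum.map id Sum.inl (traceIdx m k i))) *
      Φ (m + 2 * k) (fun i => x (Sum.map id Sum.inr (traceIdx m k i))) := hm1.mul hm2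
  rw [lintegral_comp_equiv (X := Space d) e (fun x : Fin m ⊕ (Fin k ⊕ Fin k) → Space d =>
    Φ (m + 2 * k) (fun i => x (Sum.map id Sum.inl (traceIdx m k i))) *
    Φ (m + 2 * k) (fun i => x (Sum.map id Sum.inr (traceIdx m k i)))),
    lintegral_sumElim hm12]
  refine lintegral_congr fun y => ?_
  have hy : Measurable fun x : Fin k ⊕ Fin k → Space d =>
      (Sum.elim y x : Fin m ⊕ (Fin k ⊕ Fin k) → Space d) :=
    measurable_sumElim.comp (measurable_const.prodMk measurable_id)
  rw [lintegral_sumElim (X := Space d) (f := fun x : Fin k ⊕ Fin k → Space d =>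
      Φ (m + 2 * k) (fun i => (Sum.elim y x : Fin m ⊕ (Fin k ⊕ Fin k) → Space d)
        (Sum.map id Sum.inl (traceIdx m k i))) *
      Φ (m + 2 * k) (fun i => (Sum.elim y x : Fin m ⊕ (Fin k ⊕ Fin k) → Space d)
        (Sum.map id Sum.inr (traceIdx m k i)))) (hm12.comp hy)]
  have t1 : ∀ w w' : Fin k → Space d,
      (fun i => (Sum.elim y (Sum.elim w w') : Fin m ⊕ (Fin k ⊕ Fin k) → Space d)
        (Sum.map id Sum.inl (traceIdx m k i))) = traceTuple y w := by
    intro w w'; rw [traceTuple_eq]; ext1 i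
    cases traceIdx m k i <;> rfl
  have t2 : ∀ w w' : Fin k → Space d,
      (fun i => (Sum.elim y (Sum.elim w w') : Fin m ⊕ (Fin k ⊕ Fin k) → Space d)
        (Sum.map id Sum.inr (traceIdx m k i))) = traceTuple y w' := by
    intro w w'; rw [traceTuple_eq]; ext1 i
    cases traceIdx m k i <;> rfl
  simp only [t1, t2]
  have hw : Measurable fun w : Fin k → Space d => Φ (m + 2 * k) (traceTuple y w) :=
    hΦ'.comp (measurable_traceTuple.comp (measurable_const.prodMk measurable_id))
  simp_rw [lintegral_const_mul _ hw]
  rw [lintegral_mul_const _ hw, sq]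

/-- Squared norm of the `k`-fold trace of `|f|`. -/
noncomputable def traceSq (F : (n : ℕ) → (Fin n → Space d) → ℝ) (m k : ℕ) : ℝ≥0∞ :=
  ∫⁻ y : Fin m → Space d, (∫⁻ w : Fin k → Space d, ‖F (m + 2 * k) (traceTuple y w)‖ₑ) ^ 2

/-- The pairs `(m,k)` with `m + 2k = n`. -/
def chaosPairs (n : ℕ) : Finset (ℕ × ℕ) :=
  (Finset.range (n + 1) ×ˢ Finset.range (n + 1)).filter fun q => q.1 + 2 * q.2 = n

lemma mem_chaosPairs {n : ℕ} {q : ℕ × ℕ} : q ∈ chaosPairs n ↔ q.1 + 2 * q.2 = n := by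
  simp only [chaosPairs, Finset.mem_filter, Finset.mem_product, Finset.mem_range]
  omega

/-- Each pairing contributes exactly the trace norm of the type `(m,k)` it induces, so the number of
pairings bounds every multiplicity. -/
lemma stratNormSq_le {n : ℕ} (F : (n : ℕ) → (Fin n → Space d) → ℝ) (hF : Measurable (F n))
    (hsymm : ∀ (π : Equiv.Perm (Fin n)) y, F n (fun i => y (π i)) = F n y) :
    stratNormSq n (F n) ≤ Fintype.card (Pairing (n + n)) * ∑ q ∈ chaosPairs n, traceSq F q.1 q.2 := by
  classical
  have h : ∀ l : Pairing (n + n), (∫⁻ z : ({k : Fin (n + n) // k ≤ l.1 k} → Space d),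
    ‖F n (fun i => diagPoint l.1 l.2.1 z (Fin.castAdd n i))‖ₑ *
      ‖F n (fun i => diagPoint l.1 l.2.1 z (Fin.natAdd n i))‖ₑ) ≤
      ∑ q ∈ chaosPairs n, traceSq F q.1 q.2 := by
    intro l
    have hl : Function.Involutive l.1 := l.2.1
    obtain ⟨m, k, hmk, heq⟩ := lintegral_pairing_eq
      (κ := fun i => orbitRep l.1 hl (Fin.castAdd n i))
      (κ' := fun i => orbitRep l.1 hl (Fin.natAdd n i)) (by
        intro v
        rw [← card_filter_addCases (fun k => orbitRep l.1 hl k = v)]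
        simp only [orbitRep_eq_iff]
        rw [Finset.card_eq_two]
        refine ⟨v, l.1 v, (l.2.2 v).symm, ?_⟩
        ext k; simp) (fun n y => ‖F n y‖ₑ) hF.enorm (fun π y => by rw [hsymm])
    have e1 : ∀ z : ({k : Fin (n + n) // k ≤ l.1 k} → Space d),
        diagPoint l.1 l.2.1 z = fun k => z (orbitRep l.1 hl k) := fun z => diagPoint_eq l.1 hl z
    rw [lintegral_congr fun z => by rw [e1 z]]
    rw [heq]
    exact Finset.single_le_sum (f := fun q : ℕ × ℕ => traceSq F q.1 q.2) (fun _ _ => zero_le)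
      (mem_chaosPairs (q := (m, k)).2 hmk)
  refine (Finset.sum_le_sum fun l _ => h l).trans ?_
  simp

/-- Almost everywhere statements on partial diagonals, for arbitrary identifications of at most two
coordinates. -/
lemma DiagonalAE.ae_comp {N : ℕ} {Q : (Fin N → Space d) → Prop} (hQ : DiagonalAE N Q)
    {V : Type*} [Fintype V] [DecidableEq V] (κ : Fin N → V)
    (hκ : ∀ v, (Finset.univ.filter fun i => κ i = v).card ≤ 2) :
    ∀ᵐ z : V → Space d, Q (fun i => z (κ i)) := by
  classical
  have huniq : ∀ i j j', κ j = κ i → κ j' = κ i → j ≠ i → j' ≠ i → j = j' := by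
    intro i j j' h1 h2 h3 h4
    by_contra hne
    have := hκ (κ i)
    have h5 : ({i, j, j'} : Finset (Fin N)) ⊆ Finset.univ.filter fun i' => κ i' = κ i := by
      intro x hx
      simp only [Finset.mem_insert, Finset.mem_singleton] at hx
      rcases hx with rfl | rfl | rfl <;> simp [h1, h2]
    have h6 := Finset.card_le_card h5
    rw [Finset.card_eq_three.2 ⟨i, j, j', h3.symm, h4.symm, hne, rfl⟩] at h6
    omega
  -- The involution exchanging the two members of each two-point fibre of `κ`; the orbits of this
  -- involution embed into `V`.
  let l0 : Fin N → Fin N := fun i => if h : ∃ j, j ≠ i ∧ κ j = κ i then h.choose else i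
  have hl0κ : ∀ i, κ (l0 i) = κ i := by
    intro i
    simp only [l0]
    split_ifs with h
    · exact h.choose_spec.2
    · rfl
  have hl0 : ∀ i j, j ≠ i → κ j = κ i → l0 i = j := by
    intro i j h1 h2
    have h : ∃ j, j ≠ i ∧ κ j = κ i := ⟨j, h1, h2⟩
    simp only [l0, dif_pos h]
    exact huniq i _ _ h.choose_spec.2 h2 h.choose_spec.1 h1
  have hinv : Function.Involutive l0 := by
    intro i
    by_cases h : l0 i = i
    · rw [h, h]
    · exact hl0 _ _ (Ne.symm h) (hl0κ i).symm
  let l : Equiv.Perm (Fin N) := hinv.toPerm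
  have hl : Function.Involutive l := hinv
  have hae := hQ l hl
  let e : {k : Fin N // k ≤ l k} → V := fun k => κ k
  have he : Function.Injective e := by
    rintro ⟨x, hx⟩ ⟨y, hy⟩ hxy
    by_contra hne
    have hne' : x ≠ y := fun h => hne (Subtype.ext h)
    have h1 : l x = y := hl0 x y hne'.symm hxy.symm
    have h2 : l y = x := hl0 y x hne' hxy
    rw [h1] at hx; rw [h2] at hy
    exact hne' (le_antisymm hx hy)
  have hκe : ∀ i, κ i = e (orbitRep l hl i) := by
    intro i
    simp only [orbitRep, e]
    split_ifs
    · rfl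
    · exact (hl0κ i).symm
  have := (quasiMeasurePreserving_comp_injective (X := Space d) he).ae hae
  filter_upwards [this] with z hz
  rw [diagPoint_eq] at hz
  simpa only [hκe] using hz

end Pairings

end StratonovichSPDE

namespace StratonovichSPDE

lemma ennreal_add_sq_le (a b : ℝ≥0∞) : (a + b) ^ 2 ≤ 2 * a ^ 2 + 2 * b ^ 2 := by
  rcases eq_or_ne a ∞ with rfl | ha
  · simp
  rcases eq_or_ne b ∞ with rfl | hb
  · simp
  lift a to ℝ≥0 using ha
  lift b to ℝ≥0 using hb
  norm_cast
  rw [← NNReal.coe_le_coe]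
  push_cast
  nlinarith [sq_nonneg ((a : ℝ) - b)]

/-- Cauchy-Schwarz. -/
lemma sq_lintegral_mul_le {α : Type*} [MeasurableSpace α] (μ : Measure α) {f g : α → ℝ≥0∞}
    (hf : AEMeasurable f μ) (hg : AEMeasurable g μ) :
    (∫⁻ x, f x * g x ∂μ) ^ 2 ≤ (∫⁻ x, f x ^ 2 ∂μ) * ∫⁻ x, g x ^ 2 ∂μ := by
  have h := ENNReal.lintegral_mul_le_Lp_mul_Lq μ (p := 2) (q := 2)
    ⟨by norm_num, by norm_num, by norm_num⟩ hf hg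
  have h2 : ∀ a : ℝ≥0∞, (a ^ (1 / 2 : ℝ)) ^ 2 = a := by
    intro a
    rw [← ENNReal.rpow_natCast, ← ENNReal.rpow_mul]; norm_num
  calc (∫⁻ x, f x * g x ∂μ) ^ 2 ≤ _ := pow_le_pow_left₀ (zero_le) h 2
    _ = _ := by
      rw [mul_pow, h2, h2]
      simp

lemma sq_lintegral_le {α : Type*} [MeasurableSpace α] (μ : Measure α) {f : α → ℝ≥0∞}
    (hf : AEMeasurable f μ) : (∫⁻ x, f x ∂μ) ^ 2 ≤ μ Set.univ * ∫⁻ x, f x ^ 2 ∂μ := by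
  have := sq_lintegral_mul_le μ (f := fun _ => 1) (g := f) aemeasurable_const hf
  simpa using this

lemma eLpNorm_two_sq {α E : Type*} [MeasurableSpace α] [NormedAddCommGroup E] (μ : Measure α)
    (f : α → E) : eLpNorm f 2 μ ^ 2 = ∫⁻ x, ‖f x‖ₑ ^ 2 ∂μ := by
  have := eLpNorm_nnreal_pow_eq_lintegral (μ := μ) (f := f) (p := 2) (by norm_num)
  simpa using this

/-! ### Truncation, and the measures carried by the diagonals -/

section Trace

variable {d : ℕ}

lemma measurable_comp_traceTuple {m k : ℕ} {g : (Fin (m + 2 * k) → Space d) → ℝ} (hg : Measurable g) :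
    Measurable (fun q : (Fin m → Space d) × (Fin k → Space d) => g (traceTuple q.1 q.2)) :=
  hg.comp measurable_traceTuple

lemma traceSq_add_le {F G H : (n : ℕ) → (Fin n → Space d) → ℝ} {m k : ℕ}
    (hF : Measurable (F (m + 2 * k))) (hG : Measurable (G (m + 2 * k)))
    (hH : ∀ y, ‖H (m + 2 * k) y‖ₑ ≤ ‖F (m + 2 * k) y‖ₑ + ‖G (m + 2 * k) y‖ₑ) :
    traceSq H m k ≤ 2 * traceSq F m k + 2 * traceSq G m k := by
  unfold traceSq
  have mF := (measurable_comp_traceTuple hF).enorm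
  have mG := (measurable_comp_traceTuple hG).enorm
  rw [← lintegral_const_mul _ (mF.lintegral_prod_right'.pow_const 2),
    ← lintegral_const_mul _ (mG.lintegral_prod_right'.pow_const 2),
    ← lintegral_add_left ((mF.lintegral_prod_right'.pow_const 2).const_mul 2)]
  refine lintegral_mono fun y => ?_
  refine le_trans ?_ (ennreal_add_sq_le _ _)
  have hm : Measurable fun w : Fin k → Space d => ‖F (m + 2 * k) (traceTuple y w)‖ₑ :=
    mF.comp (measurable_const.prodMk measurable_id)
  simp only
  rw [← lintegral_add_left hm]
  exact pow_le_pow_left₀ zero_le (lintegral_mono fun w => hH _) 2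

/-- Truncation of a family of functions. -/
noncomputable def truncFamily (F : (n : ℕ) → (Fin n → Space d) → ℝ) (M : ℕ) (n : ℕ)
    (y : Fin n → Space d) : ℝ :=
  {y : Fin n → Space d | |F n y| ≤ M ∧ ∀ i, y i ∈ Metric.closedBall (0 : Space d) M}.indicator (F n) y

lemma measurable_truncFamily {F : (n : ℕ) → (Fin n → Space d) → ℝ} {n : ℕ} (hF : Measurable (F n))
    (M : ℕ) : Measurable (truncFamily F M n) := by
  refine hF.indicator ?_
  refine MeasurableSet.inter ?_ ?_
  · exact measurableSet_le hF.abs measurable_const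
  · have : {y : Fin n → Space d | ∀ i, y i ∈ Metric.closedBall (0 : Space d) M}
        = ⋂ i, (fun y : Fin n → Space d => y i) ⁻¹' Metric.closedBall (0 : Space d) M := by
      ext; simp
    rw [show (fun y : Fin n → Space d => ∀ i, y i ∈ Metric.closedBall (0 : Space d) M)
      = {y : Fin n → Space d | ∀ i, y i ∈ Metric.closedBall (0 : Space d) M} from rfl, this]
    exact MeasurableSet.iInter fun i => (measurable_pi_apply i) measurableSet_closedBall

/-- At every point, diagonal points included, the truncation is eventually inactive. Dominated
convergence is used for the inner trace and then for the integral of its square. -/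
lemma tendsto_traceSq_truncFamily {F : (n : ℕ) → (Fin n → Space d) → ℝ} {m k : ℕ}
    (hF : Measurable (F (m + 2 * k))) (hfin : traceSq F m k ≠ ∞) :
    Tendsto (fun M => traceSq (fun n y => F n y - truncFamily F M n y) m k) atTop (𝓝 0) := by
  have mF := (measurable_comp_traceTuple hF).enorm
  have hle : ∀ M (y : Fin (m + 2 * k) → Space d),
      ‖F (m + 2 * k) y - truncFamily F M (m + 2 * k) y‖ₑ ≤ ‖F (m + 2 * k) y‖ₑ := by
    intro M y
    simp only [truncFamily, Set.indicator]
    split_ifs <;> simp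
  have hmeas : ∀ M, Measurable fun q : (Fin m → Space d) × (Fin k → Space d) =>
      ‖F (m + 2 * k) (traceTuple q.1 q.2) - truncFamily F M (m + 2 * k) (traceTuple q.1 q.2)‖ₑ :=
    fun M => ((measurable_comp_traceTuple hF).sub
      (measurable_comp_traceTuple (measurable_truncFamily hF M))).enorm
  have hpt : ∀ y : Fin (m + 2 * k) → Space d,
      Tendsto (fun M : ℕ => ‖F (m + 2 * k) y - truncFamily F M (m + 2 * k) y‖ₑ) atTop (𝓝 0) := by
    intro y
    refine tendsto_const_nhds.congr' ?_
    obtain ⟨M1, hM1⟩ := exists_nat_ge (|F (m + 2 * k) y|)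
    have h2 : ∀ᶠ M : ℕ in atTop, ∀ i, y i ∈ Metric.closedBall (0 : Space d) M := by
      rw [eventually_all]; intro i
      obtain ⟨M2, hM2⟩ := exists_nat_ge ‖y i‖
      filter_upwards [eventually_ge_atTop M2] with M hM
      simp only [Metric.mem_closedBall, dist_zero_right]
      exact hM2.trans (by exact_mod_cast hM)
    filter_upwards [eventually_ge_atTop M1, h2] with M hM hM'
    have : y ∈ {y : Fin (m + 2 * k) → Space d | |F (m + 2 * k) y| ≤ M ∧
        ∀ i, y i ∈ Metric.closedBall (0 : Space d) M} :=
      ⟨hM1.trans (by exact_mod_cast hM), hM'⟩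
    rw [truncFamily, Set.indicator_of_mem this]
    simp
  have hinner : ∀ᵐ y : Fin m → Space d,
      (∫⁻ w : Fin k → Space d, ‖F (m + 2 * k) (traceTuple y w)‖ₑ) ^ 2 < ∞ :=
    ae_lt_top (mF.lintegral_prod_right'.pow_const 2) hfin
  have := tendsto_lintegral_of_dominated_convergence (μ := (volume : Measure (Fin m → Space d)))
    (F := fun M y => (∫⁻ w : Fin k → Space d, ‖F (m + 2 * k) (traceTuple y w) -
      truncFamily F M (m + 2 * k) (traceTuple y w)‖ₑ) ^ 2) (f := fun _ => 0)
    (fun y => (∫⁻ w : Fin k → Space d, ‖F (m + 2 * k) (traceTuple y w)‖ₑ) ^ 2)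
    (fun M => (hmeas M).lintegral_prod_right'.pow_const 2)
    (fun M => ae_of_all _ fun y => pow_le_pow_left₀ zero_le
      (lintegral_mono fun w => hle M _) 2) hfin ?_
  · simpa [traceSq] using this
  · filter_upwards [hinner] with y hy
    have hy' : ∫⁻ w : Fin k → Space d, ‖F (m + 2 * k) (traceTuple y w)‖ₑ ≠ ∞ := by
      intro h; rw [h] at hy; simp at hy
    have h0 := tendsto_lintegral_of_dominated_convergence (μ := (volume : Measure (Fin k → Space d)))
      (F := fun M w => ‖F (m + 2 * k) (traceTuple y w) -
        truncFamily F M (m + 2 * k) (traceTuple y w)‖ₑ) (f := fun _ => 0)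
      (fun w => ‖F (m + 2 * k) (traceTuple y w)‖ₑ)
      (fun M => (hmeas M).comp (measurable_const.prodMk measurable_id))
      (fun M => ae_of_all _ fun w => hle M _) hy' (ae_of_all _ fun w => hpt _)
    have := ENNReal.Tendsto.pow (n := 2) h0
    simpa using this

/-! ### Density of sums of powers -/

/-- The Lebesgue measure of `B^{m+k}` carried by the diagonal of type `(m,k)`. -/
noncomputable def traceMeasure (n : ℕ) (q : ℕ × ℕ) (B : Set (Space d)) :
    Measure (Fin n → Space d) :=
  if h : q.1 + 2 * q.2 = n then
    Measure.map (fun z : Fin q.1 ⊕ Fin q.2 → Space d => fun i =>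
      z (traceIdx q.1 q.2 (Fin.cast h.symm i))) (volume.restrict (Set.univ.pi fun _ => B))
  else 0

/-- The sum of the traces of the Lebesgue measure on all diagonals, symmetrized. -/
noncomputable def diagMeasure (n : ℕ) (B : Set (Space d)) : Measure (Fin n → Space d) :=
  ∑ π : Equiv.Perm (Fin n), ∑ q ∈ chaosPairs n,
    (traceMeasure n q B).map (fun y i => y (π i))

lemma measurable_comp_perm {n : ℕ} (π : Equiv.Perm (Fin n)) :
    Measurable (fun y : Fin n → Space d => fun i => y (π i)) :=
  measurable_pi_iff.2 fun _ => measurable_pi_apply _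

lemma lintegral_diagMeasure (n : ℕ) (B : Set (Space d)) {g : (Fin n → Space d) → ℝ≥0∞}
    (hg : Measurable g) : ∫⁻ y, g y ∂(diagMeasure n B) =
      ∑ π : Equiv.Perm (Fin n), ∑ q ∈ chaosPairs n, ∫⁻ y, g (fun i => y (π i)) ∂(traceMeasure n q B) := by
  simp only [diagMeasure, lintegral_finsetSum_measure]
  refine Finset.sum_congr rfl fun π _ => Finset.sum_congr rfl fun q _ => ?_
  rw [lintegral_map hg (measurable_comp_perm π)]

lemma measurePreserving_diagMeasure (n : ℕ) (B : Set (Space d)) (ρ : Equiv.Perm (Fin n)) :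
    MeasurePreserving (fun y : Fin n → Space d => fun i => y (ρ i)) (diagMeasure n B)
      (diagMeasure n B) := by
  refine ⟨measurable_comp_perm ρ, ?_⟩
  refine Measure.ext_of_lintegral _ fun g hg => ?_
  rw [lintegral_map hg (measurable_comp_perm ρ), lintegral_diagMeasure _ _ hg,
    lintegral_diagMeasure _ _ (g := fun y => g (fun i => y (ρ i))) (hg.comp (measurable_comp_perm ρ))]
  exact Equiv.sum_comp (Equiv.mulRight ρ) (fun π : Equiv.Perm (Fin n) => ∑ q ∈ chaosPairs n,
    ∫⁻ y, g (fun i => y (π i)) ∂(traceMeasure n q B))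

lemma isFiniteMeasure_traceMeasure (n : ℕ) (q : ℕ × ℕ) {B : Set (Space d)} (hB : volume B ≠ ∞) :
    IsFiniteMeasure (traceMeasure n q B) := by
  unfold traceMeasure
  split_ifs
  · have : IsFiniteMeasure ((volume : Measure (Fin q.1 ⊕ Fin q.2 → Space d)).restrict
        (Set.univ.pi fun _ => B)) := by
      refine ⟨?_⟩
      rw [Measure.restrict_apply_univ, volume_pi_pi]
      exact ENNReal.prod_lt_top fun i _ => hB.lt_top
    exact Measure.isFiniteMeasure_map _ _
  · infer_instance

lemma isFiniteMeasure_diagMeasure (n : ℕ) {B : Set (Space d)} (hB : volume B ≠ ∞) :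
    IsFiniteMeasure (diagMeasure n B) := by
  have := fun q => isFiniteMeasure_traceMeasure n q hB
  refine ⟨?_⟩
  have h := lintegral_diagMeasure n B (g := fun _ => 1) measurable_const
  rw [lintegral_one] at h
  rw [h]
  refine ENNReal.sum_lt_top.2 fun π _ => ENNReal.sum_lt_top.2 fun q _ => ?_
  simp

lemma diagMeasure_compl (n : ℕ) {B : Set (Space d)} (hB : MeasurableSet B) :
    ∀ᵐ y ∂(diagMeasure n B), y ∈ Set.univ.pi fun _ => B := by
  have hm : MeasurableSet (Set.univ.pi fun _ : Fin n => B) := MeasurableSet.univ_pi fun _ => hB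
  rw [ae_iff]
  change diagMeasure n B (Set.univ.pi fun _ => B)ᶜ = 0
  rw [← lintegral_indicator_one hm.compl, lintegral_diagMeasure _ _
    (measurable_one.indicator hm.compl)]
  refine Finset.sum_eq_zero fun π _ => Finset.sum_eq_zero fun q hq => ?_
  have hq' := mem_chaosPairs.1 hq
  rw [traceMeasure, dif_pos hq', lintegral_map]
  · rw [lintegral_eq_zero_iff']
    · rw [Filter.EventuallyEq, ae_restrict_iff' (MeasurableSet.univ_pi fun _ => hB)]
      refine ae_of_all _ fun z hz => ?_
      simp only [Pi.zero_apply, Set.indicator_apply_eq_zero, Set.mem_compl_iff]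
      intro h
      exact absurd (fun i _ => hz _ (Set.mem_univ _)) h
    · refine Measurable.aemeasurable ?_
      exact (measurable_one.indicator hm.compl).comp (measurable_pi_iff.2 fun i => measurable_pi_apply _)
  · exact (measurable_one.indicator hm.compl).comp (measurable_comp_perm π)
  · exact measurable_pi_iff.2 fun i => measurable_pi_apply _

/-- Cauchy-Schwarz in the traced variables, at the price `volume B ^ k`, replaces the mixed norm by
an `L²` norm for a single finite measure, where linear combinations of rectangles are dense. -/
lemma traceSq_le_diagMeasure {m k : ℕ} {B : Set (Space d)} (hB : MeasurableSet B)
    {F : (n : ℕ) → (Fin n → Space d) → ℝ} (hF : Measurable (F (m + 2 * k)))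
    (hsupp : ∀ y, (∃ i, y i ∉ B) → F (m + 2 * k) y = 0) :
    traceSq F m k ≤ volume B ^ k * eLpNorm (F (m + 2 * k)) 2 (diagMeasure (m + 2 * k) B) ^ 2 := by
  have mF := (measurable_comp_traceTuple hF).enorm
  have hBk : MeasurableSet (Set.univ.pi fun _ : Fin k => B) := MeasurableSet.univ_pi fun _ => hB
  have hidx : ∀ (y : Fin m → Space d) (w : Fin k → Space d) (c : Fin m ⊕ Fin k),
      ∃ i, traceTuple y w i = Sum.elim y w c := by
    intro y w c
    have : ∃ i, traceIdx m k i = c := by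
      rcases c with c | c
      · have := card_traceIdx_inl m k c
        obtain ⟨i, hi⟩ := Finset.card_pos.1 (by omega : 0 < (Finset.univ.filter fun i =>
          traceIdx m k i = Sum.inl c).card)
        exact ⟨i, by simpa using hi⟩
      · have := card_traceIdx_inr m k c
        obtain ⟨i, hi⟩ := Finset.card_pos.1 (by omega : 0 < (Finset.univ.filter fun i =>
          traceIdx m k i = Sum.inr c).card)
        exact ⟨i, by simpa using hi⟩
    obtain ⟨i, hi⟩ := this
    exact ⟨i, by rw [traceTuple_eq]; simp only [hi]⟩
  have h1 : ∀ y : Fin m → Space d, (∫⁻ w : Fin k → Space d, ‖F (m + 2 * k) (traceTuple y w)‖ₑ) ^ 2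
      ≤ volume B ^ k * ∫⁻ w : Fin k → Space d, ‖F (m + 2 * k) (traceTuple y w)‖ₑ ^ 2 := by
    intro y
    have h2 : ∫⁻ w : Fin k → Space d, ‖F (m + 2 * k) (traceTuple y w)‖ₑ
        = ∫⁻ w in Set.univ.pi fun _ : Fin k => B, ‖F (m + 2 * k) (traceTuple y w)‖ₑ := by
      rw [← lintegral_indicator hBk]
      refine lintegral_congr fun w => ?_
      by_cases hw : w ∈ Set.univ.pi fun _ : Fin k => B
      · rw [Set.indicator_of_mem hw]
      · rw [Set.indicator_of_notMem hw]
        have : ∃ c, w c ∉ B := by simpa using hw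
        obtain ⟨c, hc⟩ := this
        obtain ⟨i, hi⟩ := hidx y w (Sum.inr c)
        rw [hsupp _ ⟨i, by rw [hi]; exact hc⟩]; simp
    rw [h2]
    refine (sq_lintegral_le _ (mF.comp (measurable_const.prodMk measurable_id)).aemeasurable).trans ?_
    rw [Measure.restrict_apply_univ, volume_pi_pi, Finset.prod_const, Finset.card_univ,
      Fintype.card_fin]
    exact mul_le_mul_right (setLIntegral_le_lintegral _ _) _
  have hc : Measurable (fun z : Fin m ⊕ Fin k → Space d => fun i => z (traceIdx m k i)) :=
    measurable_pi_iff.2 fun i => measurable_pi_apply _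
  have hmF2 : Measurable fun z : Fin m ⊕ Fin k → Space d =>
      ‖F (m + 2 * k) (fun i => z (traceIdx m k i))‖ₑ ^ 2 :=
    ((hF.comp hc).enorm).pow_const 2
  calc traceSq F m k ≤ ∫⁻ y : Fin m → Space d, volume B ^ k *
        ∫⁻ w : Fin k → Space d, ‖F (m + 2 * k) (traceTuple y w)‖ₑ ^ 2 := lintegral_mono h1
    _ = volume B ^ k * ∫⁻ y : Fin m → Space d,
        ∫⁻ w : Fin k → Space d, ‖F (m + 2 * k) (traceTuple y w)‖ₑ ^ 2 :=
      lintegral_const_mul _ (mF.pow_const 2).lintegral_prod_right'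
    _ = volume B ^ k * ∫⁻ z : Fin m ⊕ Fin k → Space d,
        ‖F (m + 2 * k) (fun i => z (traceIdx m k i))‖ₑ ^ 2 := by
      rw [lintegral_sumElim hmF2]
      simp only [traceTuple_eq]
    _ ≤ _ := by
      refine mul_le_mul_right ?_ _
      rw [eLpNorm_two_sq, lintegral_diagMeasure _ _ (hF.enorm.pow_const 2)]
      refine le_trans ?_ (Finset.single_le_sum (f := fun π : Equiv.Perm (Fin (m + 2 * k)) =>
        ∑ q ∈ chaosPairs (m + 2 * k), ∫⁻ y, ‖F (m + 2 * k) (fun i => y (π i))‖ₑ ^ 2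
          ∂(traceMeasure (m + 2 * k) q B)) (fun _ _ => zero_le) (Finset.mem_univ 1))
      refine le_trans ?_ (Finset.single_le_sum (f := fun q : ℕ × ℕ => ∫⁻ y,
        ‖F (m + 2 * k) (fun i => y ((1 : Equiv.Perm (Fin (m + 2 * k))) i))‖ₑ ^ 2
          ∂(traceMeasure (m + 2 * k) q B)) (fun _ _ => zero_le)
          (mem_chaosPairs (q := (m, k)).2 rfl))
      simp only [traceMeasure, dif_pos, Equiv.Perm.coe_one, id_eq, Fin.cast_eq_self]
      rw [lintegral_map (hF.enorm.pow_const 2) hc,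
        ← lintegral_indicator (MeasurableSet.univ_pi fun _ => hB)]
      refine lintegral_mono fun z => ?_
      by_cases hz : z ∈ Set.univ.pi fun _ : Fin m ⊕ Fin k => B
      · rw [Set.indicator_of_mem hz]
      · have : ∃ c, z c ∉ B := by
          by_contra! hcon
          exact hz fun c _ => hcon c
        obtain ⟨c, hc⟩ := this
        obtain ⟨i, hi⟩ := hidx (z ∘ Sum.inl) (z ∘ Sum.inr) c
        have hzz : z = Sum.elim (z ∘ Sum.inl) (z ∘ Sum.inr) := by simp
        have hi2 : z (traceIdx m k i) = z c := by
          rw [traceTuple_eq] at hi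
          simpa using hi
        rw [hsupp _ ⟨i, by rw [hi2]; exact hc⟩]; simp

lemma exists_rectangles_eLpNorm_lt {n : ℕ} (ν : Measure (Fin n → Space d)) [IsFiniteMeasure ν]
    {B : Set (Space d)} (hB : MeasurableSet B) (hν : ∀ᵐ y ∂ν, y ∈ Set.univ.pi fun _ => B)
    {f : (Fin n → Space d) → ℝ} (hf : MemLp f 2 ν) {ε : ℝ≥0∞} (hε : 0 < ε) :
    ∃ (N : ℕ) (c : Fin N → ℝ) (A : Fin N → Fin n → Set (Space d)),
      (∀ r i, MeasurableSet (A r i) ∧ A r i ⊆ B) ∧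
      eLpNorm (fun y => f y - ∑ r, c r * ∏ i, (A r i).indicator 1 (y i)) 2 ν < ε := by
  have hrm : ∀ A : Fin n → Set (Space d), (∀ i, MeasurableSet (A i)) →
      MeasurableSet (Set.univ.pi A) := fun A hA => MeasurableSet.univ_pi hA
  set K : Submodule ℝ (Lp ℝ 2 ν) := Submodule.span ℝ
    {z | ∃ (A : Fin n → Set (Space d)) (hA : ∀ i, MeasurableSet (A i) ∧ A i ⊆ B),
      indicatorConstLp 2 (hrm A fun i => (hA i).1) (measure_ne_top ν _) (1 : ℝ) = z} with hK
  have hdense : K.topologicalClosure = ⊤ := by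
    rw [Submodule.topologicalClosure_eq_top_iff, Submodule.eq_bot_iff]
    intro g hg
    have h0 := ae_eq_zero_of_setIntegral_pi_eq_zero (ν := ν) (B := fun _ => B) (fun _ => hB) (g := g)
      ((Lp.memLp g).integrable (by norm_num)).integrableOn ?_
    · have hr : ν.restrict (Set.univ.pi fun _ => B) = ν := by
        rw [Measure.restrict_eq_self_of_ae_mem hν]
      rw [hr] at h0
      exact Lp.ext (h0.trans (Lp.coeFn_zero _ _ _).symm)
    · intro A hA hAB
      have h1 := (Submodule.mem_orthogonal _ g).1 hg
        (indicatorConstLp 2 (hrm A hA) (measure_ne_top ν _) (1 : ℝ))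
        (Submodule.subset_span ⟨A, fun i => ⟨hA i, hAB i⟩, rfl⟩)
      rw [MeasureTheory.L2.inner_indicatorConstLp_one] at h1
      exact h1
  have hfK : hf.toLp ∈ K.topologicalClosure := by rw [hdense]; trivial
  rcases eq_or_ne ε ∞ with rfl | hε'
  · obtain ⟨z, hz, hzd⟩ := Metric.mem_closure_iff.1 hfK 1 one_pos
    refine ⟨0, Fin.elim0, Fin.elim0, fun r => r.elim0, ?_⟩
    simpa using hf.2
  obtain ⟨z, hz, hzd⟩ := Metric.mem_closure_iff.1 hfK ε.toReal (ENNReal.toReal_pos hε.ne' hε')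
  obtain ⟨N, c, s, rfl⟩ := Submodule.mem_span_set'.1 hz
  choose A hA hA' using fun r => (s r).2
  refine ⟨N, c, A, hA, ?_⟩
  have hae : (fun y => f y - ∑ r, c r * ∏ i, (A r i).indicator 1 (y i)) =ᵐ[ν]
      (hf.toLp - ∑ r, c r • (s r : Lp ℝ 2 ν) : Lp ℝ 2 ν) := by
    have h1 : ∀ᵐ y ∂ν, ∀ r, (s r : Lp ℝ 2 ν) y = (Set.univ.pi (A r)).indicator (fun _ => 1) y := by
      rw [ae_all_iff]; intro r
      rw [← hA' r]; exact indicatorConstLp_coeFn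
    filter_upwards [h1, hf.coeFn_toLp, coeFn_finset_sum_smul Finset.univ c
      (fun r => (s r : Lp ℝ 2 ν)), Lp.coeFn_sub hf.toLp (∑ r, c r • (s r : Lp ℝ 2 ν))]
      with y k1 k2 k3 k4
    rw [k4, Pi.sub_apply, k2, k3]
    simp only [k1]
    congr 1
    refine Finset.sum_congr rfl fun r _ => ?_
    congr 1
    by_cases hy : y ∈ Set.univ.pi (A r)
    · have : ∀ i, y i ∈ A r i := fun i => hy i (Set.mem_univ i)
      simp [hy, this]
    · have : ∃ i, y i ∉ A r i := by simpa using hy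
      obtain ⟨i, hi⟩ := this
      rw [Finset.prod_eq_zero (Finset.mem_univ i) (by simp [hi])]
      simp [hy]
  rw [eLpNorm_congr_ae hae]
  rw [dist_eq_norm, Lp.norm_def] at hzd
  exact (ENNReal.toReal_lt_toReal (Lp.eLpNorm_ne_top _) hε').1 hzd

end Trace

end StratonovichSPDE

namespace StratonovichSPDE

/-! ### Approximation of symmetric functions by sums of powers -/

section PowerSums

variable {d : ℕ}

/-- The family of functions `∑ⱼ bⱼ hⱼ^{⊗n}`. -/
noncomputable def powerSum {J : Type*} [Fintype J] (b : J → ℝ) (h : J → Space d → ℝ) (n : ℕ)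
    (y : Fin n → Space d) : ℝ :=
  ∑ j, b j * ∏ i, h j (y i)

lemma measurable_powerSum {J : Type*} [Fintype J] (b : J → ℝ) {h : J → Space d → ℝ}
    (hh : ∀ j, Measurable (h j)) (n : ℕ) : Measurable (powerSum b h n) := by
  unfold powerSum
  exact Finset.measurable_sum _ fun j _ => (Finset.measurable_prod _ fun i _ =>
    (hh j).comp (measurable_pi_apply i)).const_mul _

lemma powerSum_comp_perm {J : Type*} [Fintype J] (b : J → ℝ) (h : J → Space d → ℝ) {n : ℕ}
    (π : Equiv.Perm (Fin n)) (y : Fin n → Space d) :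
    powerSum b h n (fun i => y (π i)) = powerSum b h n y := by
  unfold powerSum
  refine Finset.sum_congr rfl fun j _ => ?_
  rw [Equiv.prod_comp π fun i => h j (y i)]

lemma truncFamily_comp_perm {F : (n : ℕ) → (Fin n → Space d) → ℝ} {n : ℕ}
    (hsymm : ∀ (π : Equiv.Perm (Fin n)) y, F n (fun i => y (π i)) = F n y) (M : ℕ)
    (π : Equiv.Perm (Fin n)) (y : Fin n → Space d) :
    truncFamily F M n (fun i => y (π i)) = truncFamily F M n y := by
  have hmem : ((fun i => y (π i)) ∈ {y : Fin n → Space d | |F n y| ≤ M ∧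
      ∀ i, y i ∈ Metric.closedBall (0 : Space d) M}) ↔ (y ∈ {y : Fin n → Space d | |F n y| ≤ M ∧
      ∀ i, y i ∈ Metric.closedBall (0 : Space d) M}) := by
    simp only [Set.mem_ofPred_eq, hsymm]
    refine and_congr_right fun _ => ?_
    exact π.forall_congr_left.trans (by simp)
  unfold truncFamily
  by_cases hy : y ∈ {y : Fin n → Space d | |F n y| ≤ M ∧
      ∀ i, y i ∈ Metric.closedBall (0 : Space d) M}
  · rw [Set.indicator_of_mem hy, Set.indicator_of_mem (hmem.2 hy), hsymm]
  · rw [Set.indicator_of_notMem hy, Set.indicator_of_notMem (fun h => hy (hmem.1 h))]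

/-- The symmetrization of a sum of rectangle indicators is a sum of powers. -/
lemma symmetrization_eq_powerSum {n N : ℕ} (c : Fin N → ℝ) (f : Fin N → Fin n → Space d → ℝ)
    (y : Fin n → Space d) :
    (n ! : ℝ)⁻¹ * ∑ π : Equiv.Perm (Fin n), ∑ r, c r * ∏ i, f r i (y (π i)) =
      powerSum (fun p : Fin N × Finset (Fin n) => c p.1 * polSign p.2)
        (fun p x => ∑ i ∈ p.2, f p.1 i x) n y := by
  unfold powerSum
  rw [Fintype.sum_prod_type, Finset.sum_comm, Finset.mul_sum]
  refine Finset.sum_congr rfl fun r _ => ?_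
  have h := altSum_prod_eq_sum_perm (fun j i => f r i (y j))
  rw [← Finset.mul_sum]
  have h2 : ∑ π : Equiv.Perm (Fin n), ∏ i, f r i (y (π i)) =
      ∑ π : Equiv.Perm (Fin n), ∏ j, f r (π j) (y j) := by
    rw [← Equiv.sum_comp (Equiv.inv (Equiv.Perm (Fin n)))]
    refine Finset.sum_congr rfl fun π _ => ?_
    rw [← Equiv.prod_comp π]
    simp
  rw [h2, ← h, altSum, Finset.mul_sum, Finset.mul_sum]
  refine Finset.sum_congr rfl fun A _ => ?_
  simp only [polSign]
  ring

/-- A null set of one-variable values stays invisible on the diagonals of trace type, so powers may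
be formed from arbitrary representatives of `L²` classes. -/
lemma ae_ae_traceTuple {p : Space d → Prop} (hp : ∀ᵐ x, p x) (m k : ℕ) :
    ∀ᵐ y : Fin m → Space d, ∀ᵐ w : Fin k → Space d, ∀ i, p (traceTuple y w i) := by
  have h : ∀ l : ℕ, ∀ᵐ y : Fin l → Space d, ∀ i, p (y i) := fun l => by
    rw [ae_all_iff]; exact fun i => ae_comp_eval hp i
  filter_upwards [h m] with y hy
  filter_upwards [h k] with w hw i
  rw [traceTuple_eq]
  change p (Sum.elim y w (traceIdx m k i))
  rcases traceIdx m k i with c | c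
  · exact hy c
  · exact hw c

lemma traceSq_congr {F F' : (n : ℕ) → (Fin n → Space d) → ℝ} {m k : ℕ}
    (h : ∀ᵐ y : Fin m → Space d, ∀ᵐ w : Fin k → Space d,
      F (m + 2 * k) (traceTuple y w) = F' (m + 2 * k) (traceTuple y w)) :
    traceSq F m k = traceSq F' m k := by
  unfold traceSq
  refine lintegral_congr_ae ?_
  filter_upwards [h] with y hy
  congr 1
  refine lintegral_congr_ae ?_
  filter_upwards [hy] with w hw
  rw [hw]

/-- Because `f` and the measure are invariant under permutations, all permuted copies of `g` are
equally far from `f`, and averaging them does not increase the distance. -/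
lemma eLpNorm_sub_symmetrization_le {n : ℕ} {B : Set (Space d)} {f g : (Fin n → Space d) → ℝ}
    (hf : Measurable f) (hsymm : ∀ (π : Equiv.Perm (Fin n)) y, f (fun i => y (π i)) = f y)
    (hg : Measurable g) :
    eLpNorm (fun y => f y - (n ! : ℝ)⁻¹ * ∑ π : Equiv.Perm (Fin n), g (fun i => y (π i))) 2
      (diagMeasure n B) ≤ eLpNorm (fun y => f y - g y) 2 (diagMeasure n B) := by
  have hm : ∀ π : Equiv.Perm (Fin n), AEStronglyMeasurable
      (fun y : Fin n → Space d => f (fun i => y (π i)) - g (fun i => y (π i))) (diagMeasure n B) :=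
    fun π => ((hf.sub hg).comp (measurable_comp_perm π)).aestronglyMeasurable
  have e1 : (fun y => f y - (n ! : ℝ)⁻¹ * ∑ π : Equiv.Perm (Fin n), g (fun i => y (π i))) =
      (n ! : ℝ)⁻¹ • ∑ π : Equiv.Perm (Fin n),
        fun y : Fin n → Space d => f (fun i => y (π i)) - g (fun i => y (π i)) := by
    ext y
    rw [Pi.smul_apply, Finset.sum_apply]
    simp only [smul_eq_mul, Finset.sum_sub_distrib, hsymm,
      Finset.sum_const, Finset.card_univ, Fintype.card_perm, Fintype.card_fin, nsmul_eq_mul]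
    have : (n ! : ℝ) ≠ 0 := by positivity
    field_simp
  rw [e1]
  have e2 : ∀ π : Equiv.Perm (Fin n),
      eLpNorm (fun y : Fin n → Space d => f (fun i => y (π i)) - g (fun i => y (π i))) 2
        (diagMeasure n B) = eLpNorm (fun y => f y - g y) 2 (diagMeasure n B) := fun π =>
    eLpNorm_comp_measurePreserving (g := fun y => f y - g y) (hf.sub hg).aestronglyMeasurable
      (measurePreserving_diagMeasure n B π)
  refine eLpNorm_const_smul_le.trans ?_
  refine (mul_le_mul_right (eLpNorm_sum_le (fun π _ => hm π) (by norm_num)) _).trans ?_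
  simp only [e2, Finset.sum_const, Finset.card_univ, Fintype.card_perm, Fintype.card_fin,
    nsmul_eq_mul]
  have e3 : ‖(n ! : ℝ)⁻¹‖ₑ * (n ! : ℝ≥0∞) = 1 := by
    rw [← ofReal_norm, norm_inv, Real.norm_natCast, ENNReal.ofReal_inv_of_pos (by positivity),
      ENNReal.ofReal_natCast]
    exact ENNReal.inv_mul_cancel (by simp [Nat.factorial_ne_zero]) (by simp)
  rw [← mul_assoc, e3, one_mul]

/-- Symmetric functions with finite traces are approximated by sums of powers. -/
lemma exists_powerSum_traceSq_le {n : ℕ} {F : (n : ℕ) → (Fin n → Space d) → ℝ}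
    (hF : Measurable (F n)) (hsymm : ∀ (π : Equiv.Perm (Fin n)) y, F n (fun i => y (π i)) = F n y)
    (hfin : ∀ q ∈ chaosPairs n, traceSq F q.1 q.2 ≠ ∞) {ε : ℝ≥0∞} (hε : 0 < ε) (hε' : ε ≠ ∞) :
    ∃ (N : ℕ) (b : Fin N → ℝ) (h : Fin N → L2Space d), ∀ q ∈ chaosPairs n,
      traceSq (fun n y => F n y - powerSum b (fun j => h j) n y) q.1 q.2 ≤ ε := by
  have hε4 : 0 < ε / 4 := ENNReal.div_pos hε.ne' (by norm_num)
  have hε4' : ε / 4 ≠ ∞ := (ENNReal.div_lt_top hε' (by norm_num)).ne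
  -- truncation
  have h1 : ∀ᶠ M in atTop, ∀ q ∈ chaosPairs n,
      traceSq (fun n y => F n y - truncFamily F M n y) q.1 q.2 < ε / 4 := by
    rw [eventually_all_finset]
    intro q hq
    have hq' := mem_chaosPairs.1 hq
    exact (tendsto_traceSq_truncFamily (by rw [hq']; exact hF) (hfin q hq)).eventually_lt_const hε4
  obtain ⟨M, hM⟩ := h1.exists
  set B := Metric.closedBall (0 : Space d) M with hBdef
  have hB : MeasurableSet B := measurableSet_closedBall
  have hBv : volume B ≠ ∞ := measure_closedBall_lt_top.ne
  have := isFiniteMeasure_diagMeasure n hBv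
  set f := truncFamily F M n with hf
  have hfm : Measurable f := measurable_truncFamily hF M
  have hfL : MemLp f 2 (diagMeasure n B) := by
    refine MemLp.of_bound hfm.aestronglyMeasurable M (ae_of_all _ fun y => ?_)
    simp only [hf, truncFamily, Set.indicator]
    split_ifs with h
    · exact h.1
    · simp
  set C : ℝ≥0∞ := ∑ q ∈ chaosPairs n, volume B ^ q.2 + 1 with hC
  have hC0 : C ≠ 0 := by simp [hC]
  have hCt : C ≠ ∞ := by
    rw [hC]
    refine ENNReal.add_ne_top.2 ⟨?_, ENNReal.one_ne_top⟩
    exact (ENNReal.sum_lt_top.2 fun q _ => ENNReal.pow_lt_top hBv.lt_top).ne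
  -- The target is `C δ² ≤ ε / 4`: the cap at `1` gives `δ² ≤ δ`, and the summand `1` in `C` makes
  -- the division legitimate.
  set δ := min 1 (ε / 4 / C) with hδ
  have hδ0 : 0 < δ := lt_min one_pos (ENNReal.div_pos hε4.ne' hCt)
  obtain ⟨N, c, A, hA, hlt⟩ := exists_rectangles_eLpNorm_lt (diagMeasure n B) hB
    (diagMeasure_compl n hB) hfL hδ0
  set ind : Fin N → Fin n → Space d → ℝ := fun r i => (A r i).indicator 1 with hind
  have hindm : ∀ r i, Measurable (ind r i) := fun r i => measurable_one.indicator (hA r i).1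
  set J := Fin N × Finset (Fin n)
  set b : J → ℝ := fun p => c p.1 * polSign p.2 with hb
  set k0 : J → Space d → ℝ := fun p x => ∑ i ∈ p.2, ind p.1 i x with hk0
  have hk0m : ∀ p, Measurable (k0 p) := fun p => Finset.measurable_sum _ fun i _ => hindm _ _
  have hk0L : ∀ p, MemLp (k0 p) 2 volume := fun p => memLp_finsetSum _ fun i _ =>
    memLp_indicator_const 2 (hA p.1 i).1 1 (Or.inr (measure_ne_top_of_subset (hA p.1 i).2 hBv))
  -- symmetrization
  have hsym : eLpNorm (fun y => f y - powerSum b k0 n y) 2 (diagMeasure n B) ≤ δ := by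
    have h := eLpNorm_sub_symmetrization_le (B := B) hfm (truncFamily_comp_perm hsymm M)
      (g := fun y => ∑ r, c r * ∏ i, ind r i (y i))
      (Finset.measurable_sum _ fun r _ => (Finset.measurable_prod _ fun i _ =>
        (hindm r i).comp (measurable_pi_apply i)).const_mul _)
    simp only [symmetrization_eq_powerSum c ind] at h
    exact h.trans hlt.le
  -- conclusion
  let e := Fintype.equivFin J
  let hL : J → L2Space d := fun j => (hk0L j).toLp
  refine ⟨Fintype.card J, fun j => b (e.symm j), fun j => hL (e.symm j), ?_⟩
  intro q hq
  have hq' := mem_chaosPairs.1 hq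
  have hae : ∀ᵐ x : Space d, ∀ j, hL j x = k0 j x := by
    rw [ae_all_iff]; exact fun j => (hk0L j).coeFn_toLp
  have e4 : ∀ (n : ℕ) (y : Fin n → Space d), (∀ i j, hL j (y i) = k0 j (y i)) →
      powerSum (fun j => b (e.symm j)) (fun j => hL (e.symm j)) n y = powerSum b k0 n y := by
    intro n y hy
    unfold powerSum
    rw [Equiv.sum_comp e.symm fun j => b j * ∏ i, hL j (y i)]
    simp only [hy]
  rw [traceSq_congr (F' := fun n y => F n y - powerSum b k0 n y)]
  swap
  · filter_upwards [ae_ae_traceTuple hae q.1 q.2] with y hy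
    filter_upwards [hy] with w hw
    rw [e4 _ _ hw]
  have hFq : Measurable (F (q.1 + 2 * q.2)) := by rw [hq']; exact hF
  refine (traceSq_add_le (F := fun n y => F n y - truncFamily F M n y)
    (G := fun n y => truncFamily F M n y - powerSum b k0 n y)
    (hFq.sub (measurable_truncFamily hFq M))
    ((measurable_truncFamily hFq M).sub (measurable_powerSum b hk0m _)) ?_).trans ?_
  · intro y
    refine le_trans (le_of_eq ?_) (enorm_add_le _ _)
    congr 1; ring
  have h2 : traceSq (fun n y => truncFamily F M n y - powerSum b k0 n y) q.1 q.2 ≤ ε / 4 := by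
    refine (traceSq_le_diagMeasure hB ((measurable_truncFamily hFq M).sub
      (measurable_powerSum b hk0m _)) ?_).trans ?_
    · rintro y ⟨i, hi⟩
      have h3 : truncFamily F M (q.1 + 2 * q.2) y = 0 :=
        Set.indicator_of_notMem (fun h => hi (h.2 i)) _
      have h4 : powerSum b k0 (q.1 + 2 * q.2) y = 0 := by
        refine Finset.sum_eq_zero fun p _ => ?_
        rw [Finset.prod_eq_zero (Finset.mem_univ i), mul_zero]
        refine Finset.sum_eq_zero fun l _ => ?_
        exact Set.indicator_of_notMem (fun h => hi ((hA p.1 l).2 h)) _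
      simp [h3, h4]
    · rw [hq']
      have h5 : volume B ^ q.2 ≤ C := by
        refine le_trans ?_ le_self_add
        exact Finset.single_le_sum (f := fun q : ℕ × ℕ => volume B ^ q.2)
          (fun _ _ => zero_le) hq
      calc volume B ^ q.2 * eLpNorm (fun y => f y - powerSum b k0 n y) 2 (diagMeasure n B) ^ 2
          ≤ C * δ ^ 2 := by gcongr
        _ ≤ C * δ := by
          gcongr
          calc δ ^ 2 = δ * δ := sq δ
            _ ≤ 1 * δ := by gcongr; exact min_le_left _ _
            _ = δ := one_mul δ
        _ ≤ C * (ε / 4 / C) := by gcongr; exact min_le_right _ _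
        _ = ε / 4 := ENNReal.mul_div_cancel hC0 hCt
  calc _ ≤ 2 * (ε / 4) + 2 * (ε / 4) := by gcongr; exact (hM q hq).le
    _ = 4 * (ε / 4) := by rw [← add_mul]; norm_num
    _ = ε := ENNReal.mul_div_cancel (by norm_num) (by norm_num)

end PowerSums

end StratonovichSPDE

namespace StratonovichSPDE

/-! ### The Hu-Meyer formula -/

section HuMeyer

variable {d : ℕ}

lemma huMeyerCoef_pos (m k : ℕ) : 0 < huMeyerCoef m k := by
  unfold huMeyerCoef; positivity

/-- The contribution of the `(m+2k)`-fold Stratonovich integral to the `m`-th chaos. -/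
noncomputable def traceInt (F : (n : ℕ) → (Fin n → Space d) → ℝ) (m k : ℕ)
    (y : Fin m → Space d) : ℝ :=
  huMeyerCoef m k * ∫ z : Fin k → Space d, F (m + 2 * k) (traceTuple y z)

variable {F : (n : ℕ) → (Fin n → Space d) → ℝ} {m k : ℕ}

lemma measurable_traceInt (hF : Measurable (F (m + 2 * k))) : Measurable (traceInt F m k) :=
  ((measurable_comp_traceTuple hF).stronglyMeasurable.integral_prod_right').measurable.const_mul _

lemma enorm_traceInt_le (y : Fin m → Space d) : ‖traceInt F m k y‖ₑ ≤
    ENNReal.ofReal (huMeyerCoef m k) *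
      ∫⁻ z : Fin k → Space d, ‖F (m + 2 * k) (traceTuple y z)‖ₑ := by
  rw [traceInt, enorm_mul, Real.enorm_of_nonneg (huMeyerCoef_pos m k).le]
  exact mul_le_mul_right (enorm_integral_le_lintegral_enorm _) _

lemma eLpNorm_traceInt_sq_le :
    eLpNorm (traceInt F m k) 2 volume ^ 2 ≤ ENNReal.ofReal (huMeyerCoef m k) ^ 2 * traceSq F m k := by
  rw [eLpNorm_two_sq, traceSq, ← lintegral_const_mul' _ _ (by simp)]
  refine lintegral_mono fun y => ?_
  simp only
  rw [← mul_pow]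
  exact pow_le_pow_left₀ zero_le (enorm_traceInt_le y) 2

lemma memLp_traceInt (hF : Measurable (F (m + 2 * k))) (hfin : traceSq F m k ≠ ∞) :
    MemLp (traceInt F m k) 2 := by
  refine ⟨(measurable_traceInt hF).aestronglyMeasurable, ?_⟩
  have h : eLpNorm (traceInt F m k) 2 volume ^ 2 < ∞ :=
    eLpNorm_traceInt_sq_le.trans_lt (ENNReal.mul_lt_top (by simp) hfin.lt_top)
  by_contra hcon
  rw [not_lt, top_le_iff] at hcon
  simp [hcon] at h

open Classical in
/-- `traceInt` as an element of `L²`, when it is one. -/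
noncomputable def traceLp (F : (n : ℕ) → (Fin n → Space d) → ℝ) (m k : ℕ) :
    Lp ℝ 2 (volume : Measure (Fin m → Space d)) :=
  if h : MemLp (traceInt F m k) 2 then h.toLp else 0

lemma traceLp_eq (h : MemLp (traceInt F m k) 2) : traceLp F m k = h.toLp := dif_pos h

lemma norm_traceLp_sq_le (hF : Measurable (F (m + 2 * k))) (hfin : traceSq F m k ≠ ∞) :
    ENNReal.ofReal (‖traceLp F m k‖ ^ 2) ≤
      ENNReal.ofReal (huMeyerCoef m k) ^ 2 * traceSq F m k := by
  have h := memLp_traceInt hF hfin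
  rw [traceLp_eq h, Lp.norm_toLp, ENNReal.ofReal_pow ENNReal.toReal_nonneg,
    ENNReal.ofReal_toReal h.2.ne]
  exact eLpNorm_traceInt_sq_le

lemma ae_integrable_of_traceSq_ne_top (hF : Measurable (F (m + 2 * k))) (hfin : traceSq F m k ≠ ∞) :
    ∀ᵐ y : Fin m → Space d, Integrable fun w : Fin k → Space d => F (m + 2 * k) (traceTuple y w) := by
  have mF := (measurable_comp_traceTuple hF).enorm
  filter_upwards [ae_lt_top (mF.lintegral_prod_right'.pow_const 2) hfin] with y hy
  refine ⟨(hF.comp (measurable_traceTuple.comp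
    (measurable_const.prodMk measurable_id))).aestronglyMeasurable, ?_⟩
  by_contra hcon
  rw [HasFiniteIntegral, not_lt, top_le_iff] at hcon
  simp [hcon] at hy

lemma traceInt_sub_ae {F' : (n : ℕ) → (Fin n → Space d) → ℝ} (hF : Measurable (F (m + 2 * k)))
    (hfin : traceSq F m k ≠ ∞) (hF' : Measurable (F' (m + 2 * k))) (hfin' : traceSq F' m k ≠ ∞) :
    ∀ᵐ y : Fin m → Space d,
      traceInt (fun n y => F n y - F' n y) m k y = traceInt F m k y - traceInt F' m k y := by
  filter_upwards [ae_integrable_of_traceSq_ne_top hF hfin,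
    ae_integrable_of_traceSq_ne_top hF' hfin'] with y h1 h2
  rw [traceInt, traceInt, traceInt, integral_sub h1 h2, mul_sub]

lemma norm_traceLp_sub_sq_le {F' : (n : ℕ) → (Fin n → Space d) → ℝ}
    (hF : Measurable (F (m + 2 * k))) (hfin : traceSq F m k ≠ ∞)
    (hF' : Measurable (F' (m + 2 * k))) (hfin' : traceSq F' m k ≠ ∞) :
    ENNReal.ofReal (‖traceLp F m k - traceLp F' m k‖ ^ 2) ≤
      ENNReal.ofReal (huMeyerCoef m k) ^ 2 * traceSq (fun n y => F n y - F' n y) m k := by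
  have h := memLp_traceInt hF hfin
  have h' := memLp_traceInt hF' hfin'
  rw [traceLp_eq h, traceLp_eq h', ← MemLp.toLp_sub, Lp.norm_toLp,
    ENNReal.ofReal_pow ENNReal.toReal_nonneg, ENNReal.ofReal_toReal (h.sub h').2.ne]
  rw [← eLpNorm_congr_ae (f := traceInt (fun n y => F n y - F' n y) m k)]
  · exact eLpNorm_traceInt_sq_le
  · exact traceInt_sub_ae hF hfin hF' hfin'

/-! ### Powers -/

/-- Each `y`-coordinate occurs once and each `z`-coordinate twice; hence the trace of a power
`h^{⊗(m+2k)}` is `h^{⊗m}` times `‖h‖^{2k}`. -/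
lemma prod_traceTuple (f : Space d → ℝ) (y : Fin m → Space d) (z : Fin k → Space d) :
    ∏ i, f (traceTuple y z i) = (∏ i, f (y i)) * ∏ l, f (z l) ^ 2 := by
  classical
  rw [traceTuple_eq]
  have h1 := Finset.prod_comp (s := Finset.univ) (fun c => f (Sum.elim y z c)) (traceIdx m k)
  simp only at h1 ⊢
  rw [h1]
  have h2 : ∏ b ∈ Finset.univ.image (traceIdx m k),
      f (Sum.elim y z b) ^ (Finset.univ.filter fun a => traceIdx m k a = b).card =
      ∏ b, f (Sum.elim y z b) ^ (Finset.univ.filter fun a => traceIdx m k a = b).card := by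
    refine Finset.prod_subset (Finset.subset_univ _) fun b _ hb => ?_
    rw [Finset.card_eq_zero.2, pow_zero]
    ext a
    simp only [Finset.mem_filter, Finset.mem_univ, true_and, Finset.notMem_empty, iff_false]
    rintro rfl
    exact hb (Finset.mem_image_of_mem _ (Finset.mem_univ _))
  rw [h2, Fintype.prod_sum_type]
  simp only [card_traceIdx_inl, card_traceIdx_inr, Sum.elim_inl, Sum.elim_inr, pow_one]

lemma integral_sq_L2Space (h : L2Space d) : ∫ x, h x ^ 2 = ‖h‖ ^ 2 := by
  rw [← real_inner_self_eq_norm_sq, MeasureTheory.L2.inner_def]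
  refine integral_congr_ae (ae_of_all _ fun x => ?_)
  simp [sq]

lemma traceInt_powerSum {N : ℕ} (b : Fin N → ℝ) (h : Fin N → L2Space d) (m k : ℕ)
    (y : Fin m → Space d) : traceInt (powerSum b fun j => h j) m k y =
      ∑ j, (b j * (huMeyerCoef m k * (‖h j‖ ^ 2) ^ k)) * tensor (fun _ : Fin m => h j) y := by
  unfold traceInt powerSum
  simp only [prod_traceTuple]
  have hi : ∀ j, Integrable fun z : Fin k → Space d => ∏ l, h j (z l) ^ 2 := fun j =>
    Integrable.fintype_prod (f := fun _ x => h j x ^ 2) fun _ => (Lp.memLp (h j)).integrable_sq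
  rw [integral_finsetSum _ fun j _ => ((hi j).const_mul _).const_mul _, Finset.mul_sum]
  refine Finset.sum_congr rfl fun j _ => ?_
  rw [integral_const_mul, integral_const_mul,
    integral_fintype_prod_volume_eq_pow (fun x => h j x ^ 2), integral_sq_L2Space, Fintype.card_fin,
    tensor]
  ring

lemma traceLp_powerSum {N : ℕ} (b : Fin N → ℝ) (h : Fin N → L2Space d) (m k : ℕ) :
    traceLp (powerSum b fun j => h j) m k =
      ∑ j, (b j * (huMeyerCoef m k * (‖h j‖ ^ 2) ^ k)) • tensorLp (fun _ : Fin m => h j) := by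
  have he : traceInt (powerSum b fun j => h j) m k = fun y =>
      ∑ j, (b j * (huMeyerCoef m k * (‖h j‖ ^ 2) ^ k)) * tensor (fun _ : Fin m => h j) y :=
    funext fun y => traceInt_powerSum b h m k y
  have hL : MemLp (traceInt (powerSum b fun j => h j) m k) 2 := by
    rw [he]
    exact memLp_finsetSum _ fun j _ => (memLp_tensor _).const_mul _
  rw [traceLp_eq hL]
  refine Lp.ext ?_
  have h1 : ∀ᵐ y : Fin m → Space d, ∀ j, tensorLp (fun _ : Fin m => h j) y
      = tensor (fun _ : Fin m => h j) y := by
    rw [ae_all_iff]; exact fun j => coeFn_tensorLp _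
  filter_upwards [hL.coeFn_toLp, h1, coeFn_finset_sum_smul Finset.univ
    (fun j => b j * (huMeyerCoef m k * (‖h j‖ ^ 2) ^ k))
    (fun j => tensorLp (fun _ : Fin m => h j))] with y k1 k2 k3
  rw [k1, k3, traceInt_powerSum]
  simp only [k2]

lemma pow_eq_sum_chaosPairs (c x : ℝ) (n : ℕ) : x ^ n = ∑ q ∈ chaosPairs n,
    huMeyerCoef q.1 q.2 * c ^ q.2 * (hermiteVar c q.1).eval x := by
  have h := congrArg (Polynomial.eval x) (X_pow_eq_sum_hermiteVar c n)
  rw [Polynomial.eval_pow, Polynomial.eval_X, Polynomial.eval_finsetSum] at h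
  rw [h]
  have h2 : ∀ k ∈ Finset.range (n + 1), (if 2 * k ≤ n then
      Polynomial.C (huMeyerCoef (n - 2 * k) k * c ^ k) * hermiteVar c (n - 2 * k) else 0).eval x =
      if 2 * k ≤ n then huMeyerCoef (n - 2 * k) k * c ^ k * (hermiteVar c (n - 2 * k)).eval x
        else 0 := by
    intro k _
    split_ifs <;> simp
  rw [Finset.sum_congr rfl h2, ← Finset.sum_filter]
  symm
  refine Finset.sum_bij' (fun q _ => q.2) (fun k _ => (n - 2 * k, k)) ?_ ?_ ?_ ?_ ?_
  · intro q hq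
    have := mem_chaosPairs.1 hq
    simp only [Finset.mem_filter, Finset.mem_range]; omega
  · intro k hk
    simp only [Finset.mem_filter, Finset.mem_range] at hk
    exact mem_chaosPairs.2 (by simp only; omega)
  · intro q hq
    have := mem_chaosPairs.1 hq
    ext
    · simp only; omega
    · rfl
  · intro k _; rfl
  · intro q hq
    have := mem_chaosPairs.1 hq
    rw [show n - 2 * q.2 = q.1 by omega]

variable {Ω : Type*} [MeasurableSpace Ω] {P : Measure Ω} [IsProbabilityMeasure P]

/-- The Hu-Meyer formula for sums of powers. -/
lemma eval_powerSum_ae (hd : 1 ≤ d) (W : WhiteNoise d P) {N : ℕ} (b : Fin N → ℝ)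
    (h : Fin N → L2Space d) (n : ℕ) :
    (∑ q ∈ chaosPairs n, wienerIto hd W q.1 (traceLp (powerSum b fun j => h j) q.1 q.2) : L2Omega P)
      =ᵐ[P] (⟨N, b, fun j _ => h j⟩ : Elementary d n).eval W := by
  have e1 : (∑ q ∈ chaosPairs n, wienerIto hd W q.1 (traceLp (powerSum b fun j => h j) q.1 q.2) :
      L2Omega P) = ∑ p ∈ chaosPairs n ×ˢ (Finset.univ : Finset (Fin N)),
        (b p.2 * (huMeyerCoef p.1.1 p.1.2 * (‖h p.2‖ ^ 2) ^ p.1.2)) • hermiteLp W p.1.1 (h p.2) := by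
    rw [Finset.sum_product]
    refine Finset.sum_congr rfl fun q _ => ?_
    rw [traceLp_powerSum, map_sum]
    simp only [map_smul, wienerIto_tensorLp_const]
  rw [e1]
  have h1 : ∀ᵐ ω ∂P, ∀ (m : ℕ) (j : Fin N), hermiteLp W m (h j) ω =
      (hermiteVar (‖h j‖ ^ 2) m).eval (W.int (h j) ω) := by
    rw [ae_all_iff]; intro m
    rw [ae_all_iff]; intro j
    exact coeFn_hermiteLp W m (h j)
  filter_upwards [h1, coeFn_finset_sum_smul (chaosPairs n ×ˢ (Finset.univ : Finset (Fin N)))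
    (fun p => b p.2 * (huMeyerCoef p.1.1 p.1.2 * (‖h p.2‖ ^ 2) ^ p.1.2))
    (fun p => hermiteLp W p.1.1 (h p.2))] with ω k1 k2
  rw [k2, Finset.sum_product, Finset.sum_comm, Elementary.eval]
  refine Finset.sum_congr rfl fun j _ => ?_
  simp only [k1, Finset.prod_const, Finset.card_univ, Fintype.card_fin]
  rw [pow_eq_sum_chaosPairs (‖h j‖ ^ 2) (W.int (h j) ω), Finset.mul_sum]
  exact Finset.sum_congr rfl fun q _ => by ring

/-- The Hu-Meyer formula. -/
lemma isStratonovich_sum_wienerIto (hd : 1 ≤ d) (W : WhiteNoise d P) {n : ℕ}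
    (hF : Measurable (F n)) (hsymm : ∀ (π : Equiv.Perm (Fin n)) y, F n (fun i => y (π i)) = F n y)
    (hfin : ∀ q ∈ chaosPairs n, traceSq F q.1 q.2 ≠ ∞) :
    IsStratonovich W n (F n)
      (∑ q ∈ chaosPairs n, wienerIto hd W q.1 (traceLp F q.1 q.2)) := by
  have hstrat : ∀ F' : (n : ℕ) → (Fin n → Space d) → ℝ, Measurable (F' n) →
      (∀ (π : Equiv.Perm (Fin n)) y, F' n (fun i => y (π i)) = F' n y) →
      stratNormSq n (F' n) ≤ Fintype.card (Pairing (n + n)) * ∑ q ∈ chaosPairs n, traceSq F' q.1 q.2 :=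
    fun F' h1 h2 => stratNormSq_le F' h1 h2
  -- One sequence of power sums converges in all trace norms at once. It therefore converges for
  -- `‖·‖ₙ`, and each `traceLp` converges in `L²`, so continuity of the Wiener-Itô integrals
  -- transfers the formula from powers to `F`.
  have hε : ∀ K : ℕ, ∃ (N : ℕ) (b : Fin N → ℝ) (h : Fin N → L2Space d), ∀ q ∈ chaosPairs n,
      traceSq (fun n y => F n y - powerSum b (fun j => h j) n y) q.1 q.2 ≤ ((K : ℝ≥0∞) + 1)⁻¹ :=
    fun K => exists_powerSum_traceSq_le hF hsymm hfin (by simp) (by simp)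
  choose N b h hle using hε
  have hP : ∀ K n, Measurable (powerSum (b K) (fun j => h K j) n) := fun K n =>
    measurable_powerSum _ (fun j => (Lp.stronglyMeasurable _).measurable) n
  have hto : ∀ q ∈ chaosPairs n, Tendsto (fun K => traceSq
      (fun n y => F n y - powerSum (b K) (fun j => h K j) n y) q.1 q.2) atTop (𝓝 0) := by
    intro q hq
    refine tendsto_of_tendsto_of_tendsto_of_le_of_le tendsto_const_nhds ?_ (fun _ => zero_le)
      (fun K => hle K q hq)
    have := (tendsto_add_atTop_iff_nat 1).2 ENNReal.tendsto_inv_nat_nhds_zero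
    simpa using this
  refine ⟨hF, (hstrat F hF hsymm).trans_lt ?_, fun K => ⟨N K, b K, fun j _ => h K j⟩, ?_, ?_⟩
  · exact ENNReal.mul_lt_top (by simp) (ENNReal.sum_lt_top.2 fun q hq => (hfin q hq).lt_top)
  · have h0 : Tendsto (fun K => (Fintype.card (Pairing (n + n)) : ℝ≥0∞) * ∑ q ∈ chaosPairs n, traceSq
        (fun n y => F n y - powerSum (b K) (fun j => h K j) n y) q.1 q.2) atTop (𝓝 0) := by
      have h1 := tendsto_finsetSum (chaosPairs n) hto
      rw [Finset.sum_const_zero] at h1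
      have h2 := ENNReal.Tendsto.const_mul (a := (Fintype.card (Pairing (n + n)) : ℝ≥0∞)) h1
        (Or.inr (by simp))
      simpa using h2
    refine tendsto_of_tendsto_of_tendsto_of_le_of_le tendsto_const_nhds h0 (fun _ => zero_le)
      (fun K => ?_)
    refine hstrat (fun n y => F n y - powerSum (b K) (fun j => h K j) n y) (hF.sub (hP K n)) ?_
    intro π y
    simp only [hsymm, powerSum_comp_perm]
  · rw [tendsto_eLpNorm_sub_iff (fun K => eval_powerSum_ae hd W (b K) (h K) n)
      (EventuallyEq.refl _ _)]
    refine tendsto_finsetSum _ fun q hq => ?_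
    refine ((wienerIto hd W q.1).continuous.tendsto _).comp ?_
    rw [tendsto_iff_norm_sub_tendsto_zero]
    have hq' := mem_chaosPairs.1 hq
    have hFq : Measurable (F (q.1 + 2 * q.2)) := by rw [hq']; exact hF
    have hfinP : ∀ K, traceSq (powerSum (b K) fun j => h K j) q.1 q.2 ≠ ∞ := by
      intro K
      refine ((traceSq_add_le (F := F)
        (G := fun n y => F n y - powerSum (b K) (fun j => h K j) n y) hFq
        (hFq.sub (hP K _)) fun y => ?_).trans_lt ?_).ne
      · refine le_trans (le_of_eq ?_) enorm_sub_le
        congr 1; ring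
      · refine ENNReal.add_lt_top.2 ⟨ENNReal.mul_lt_top (by simp) (hfin q hq).lt_top,
          ENNReal.mul_lt_top (by simp) ((hle K q hq).trans_lt (by simp))⟩
    have h3 : Tendsto (fun K => ENNReal.ofReal (‖traceLp (powerSum (b K) fun j => h K j) q.1 q.2 -
        traceLp F q.1 q.2‖ ^ 2)) atTop (𝓝 0) := by
      have h4 := ENNReal.Tendsto.const_mul (a := ENNReal.ofReal (huMeyerCoef q.1 q.2) ^ 2) (hto q hq)
        (Or.inr (by simp))
      rw [mul_zero] at h4
      refine tendsto_of_tendsto_of_tendsto_of_le_of_le tendsto_const_nhds h4 (fun _ => zero_le)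
        (fun K => ?_)
      rw [norm_sub_rev]
      exact norm_traceLp_sub_sq_le hFq (hfin q hq) (hP K _) (hfinP K)
    have h5 := (ENNReal.tendsto_toReal ENNReal.zero_ne_top).comp h3
    simp only [Function.comp_def, ENNReal.toReal_zero,
      ENNReal.toReal_ofReal (sq_nonneg _)] at h5
    have h6 := h5.sqrt
    simpa using h6

end HuMeyer

end StratonovichSPDE

namespace StratonovichSPDE

/-! ### Majorants: iterated integrals with a nonnegative kernel -/

section AbsDuhamel

variable {d : ℕ}

/-- The symmetrized integral operator with nonnegative kernel `K`. -/
noncomputable def absOp (K : ℝ → Space d → Space d → ℝ≥0∞) (n : ℕ)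
    (Φ : ℝ → Space d → (Fin n → Space d) → ℝ≥0∞) (t : ℝ) (x : Space d)
    (y : Fin (n + 1) → Space d) : ℝ≥0∞ :=
  ((n + 1)! : ℝ≥0∞)⁻¹ * ∑ π : Equiv.Perm (Fin (n + 1)),
    ∫⁻ s, K (t - s) x (y (π 0)) * Φ s (y (π 0)) (fun i => y (π i.succ))

/-- The terms of the Duhamel series with nonnegative kernel `K` and initial term `w`. -/
noncomputable def absDuhamel (K : ℝ → Space d → Space d → ℝ≥0∞) (w : ℝ → Space d → ℝ≥0∞) :
    (n : ℕ) → ℝ → Space d → (Fin n → Space d) → ℝ≥0∞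
  | 0, t, x, _ => w t x
  | n + 1, t, x, y => absOp K n (absDuhamel K w n) t x y

/-- Uniform bounds for a kernel. -/
structure KernelBound (K : ℝ → Space d → Space d → ℝ≥0∞) (k₁ k₂ : ℝ → ℝ≥0∞) : Prop where
  meas : Measurable fun q : ℝ × Space d × Space d => K q.1 q.2.1 q.2.2
  meas₁ : Measurable k₁
  meas₂ : Measurable k₂
  left : ∀ t y, ∫⁻ x, K t x y ≤ k₁ t
  right : ∀ t x, ∫⁻ y, K t x y ≤ k₁ t
  sup : ∀ t x y, K t x y ≤ k₂ t

lemma average_perm_le {N : ℕ} {f : Equiv.Perm (Fin N) → ℝ≥0∞} {M : ℝ≥0∞} (h : ∀ π, f π ≤ M) :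
    (N ! : ℝ≥0∞)⁻¹ * ∑ π, f π ≤ M := by
  calc (N ! : ℝ≥0∞)⁻¹ * ∑ π, f π ≤ (N ! : ℝ≥0∞)⁻¹ * ∑ _π : Equiv.Perm (Fin N), M := by
        gcongr; exact h _
    _ = M := by
      rw [Finset.sum_const, Finset.card_univ, Fintype.card_perm, Fintype.card_fin, nsmul_eq_mul,
        ← mul_assoc, ENNReal.inv_mul_cancel (by simp [Nat.factorial_ne_zero]) (by simp), one_mul]

variable {K : ℝ → Space d → Space d → ℝ≥0∞} {k₁ k₂ : ℝ → ℝ≥0∞} {w : ℝ → Space d → ℝ≥0∞}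

lemma measurable_absOp_integrand {n : ℕ}
    (hK : Measurable fun q : ℝ × Space d × Space d => K q.1 q.2.1 q.2.2)
    {Φ : ℝ → Space d → (Fin n → Space d) → ℝ≥0∞}
    (hΦ : Measurable fun q : ℝ × Space d × (Fin n → Space d) => Φ q.1 q.2.1 q.2.2)
    {A : Type*} [MeasurableSpace A] {r s : A → ℝ} {x v : A → Space d} {y : A → Fin n → Space d}
    (hr : Measurable r) (hs : Measurable s) (hx : Measurable x) (hv : Measurable v)
    (hy : Measurable y) : Measurable fun a => K (r a) (x a) (v a) * Φ (s a) (v a) (y a) :=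
  (hK.comp (hr.prodMk (hx.prodMk hv))).mul (hΦ.comp (hs.prodMk (hv.prodMk hy)))

lemma measurable_absOp {n : ℕ} (hK : Measurable fun q : ℝ × Space d × Space d => K q.1 q.2.1 q.2.2)
    {Φ : ℝ → Space d → (Fin n → Space d) → ℝ≥0∞}
    (hΦ : Measurable fun q : ℝ × Space d × (Fin n → Space d) => Φ q.1 q.2.1 q.2.2) :
    Measurable fun q : ℝ × Space d × (Fin (n + 1) → Space d) => absOp K n Φ q.1 q.2.1 q.2.2 := by
  unfold absOp
  refine (Finset.measurable_sum _ fun π _ => ?_).const_mul _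
  refine Measurable.lintegral_prod_right' (f := fun p : (ℝ × Space d × (Fin (n + 1) → Space d)) × ℝ =>
    K (p.1.1 - p.2) p.1.2.1 (p.1.2.2 (π 0)) * Φ p.2 (p.1.2.2 (π 0)) (fun i => p.1.2.2 (π i.succ))) ?_
  have hc : ∀ i, Measurable fun p : (ℝ × Space d × (Fin (n + 1) → Space d)) × ℝ => p.1.2.2 i :=
    fun i => (measurable_pi_apply i).comp (measurable_snd.comp (measurable_snd.comp measurable_fst))
  exact measurable_absOp_integrand hK hΦ ((measurable_fst.comp measurable_fst).sub measurable_snd)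
    measurable_snd (measurable_fst.comp (measurable_snd.comp measurable_fst)) (hc _)
    (measurable_pi_iff.2 fun i => hc _)

lemma measurable_absDuhamel (hK : Measurable fun q : ℝ × Space d × Space d => K q.1 q.2.1 q.2.2)
    (hw : Measurable fun q : ℝ × Space d => w q.1 q.2) (n : ℕ) :
    Measurable fun q : ℝ × Space d × (Fin n → Space d) => absDuhamel K w n q.1 q.2.1 q.2.2 := by
  induction n with
  | zero => exact hw.comp (measurable_fst.prodMk (measurable_fst.comp measurable_snd))
  | succ n ih => exact measurable_absOp hK ih

section Marginal

variable {V : Type} [DecidableEq V]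

lemma lmarginal_const_mul (c : ℝ≥0∞) {s : Finset V} {f : (V → Space d) → ℝ≥0∞} (hf : Measurable f)
    (z : V → Space d) :
    lmarginal (fun _ => volume) s (fun z => c * f z) z = c * lmarginal (fun _ => volume) s f z :=
  lintegral_const_mul _ (hf.comp measurable_updateFinset)

lemma lmarginal_average_lintegral {N : ℕ} {g : Equiv.Perm (Fin N) → ℝ → (V → Space d) → ℝ≥0∞}
    (hg : ∀ π, Measurable fun q : ℝ × (V → Space d) => g π q.1 q.2) (c : ℝ≥0∞) (S : Finset V)
    (z : V → Space d) :
    lmarginal (fun _ => volume) S (fun z => c * ∑ π, ∫⁻ r, g π r z) z =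
      c * ∑ π, ∫⁻ r, lmarginal (fun _ => volume) S (g π r) z := by
  have hm : ∀ π, Measurable fun z => ∫⁻ r, g π r z := fun π =>
    Measurable.lintegral_prod_right' (f := fun p : (V → Space d) × ℝ => g π p.2 p.1)
      ((hg π).comp measurable_swap)
  rw [lmarginal_const_mul _ (Finset.measurable_sum _ fun π _ => hm π)]
  congr 1
  unfold lmarginal
  have hm' : ∀ π, Measurable fun y : (i : S) → Space d =>
      ∫⁻ r, g π r (Function.updateFinset z S y) := fun π => (hm π).comp measurable_updateFinset
  rw [lintegral_finsetSum _ fun π _ => hm' π]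
  refine Finset.sum_congr rfl fun π _ => ?_
  rw [lintegral_lintegral_swap]
  exact ((hg π).comp (measurable_snd.prodMk (measurable_updateFinset.comp measurable_fst))).aemeasurable

variable (hK : KernelBound K k₁ k₂) (hw : Measurable fun q : ℝ × Space d => w q.1 q.2)
  {E : ℝ → ℝ≥0∞} (hE : Measurable E) {a b : ℝ≥0∞}
  (ha : ∀ t, ∫⁻ s, k₁ (t - s) * E s ≤ a * E t) (hb : ∀ t, ∫⁻ s, k₂ (t - s) * E s ≤ b * E t)

include hE in
-- The function `E` is reproduced by convolution up to a constant, so nested time integrals cost one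
-- constant per step and no integral over a time simplex has to be computed.
lemma lintegral_conv_mul_le {k : ℝ → ℝ≥0∞} (hk : Measurable k) {a : ℝ≥0∞}
    (ha : ∀ t, ∫⁻ s, k (t - s) * E s ≤ a * E t) (c : ℝ≥0∞) (t : ℝ) :
    ∫⁻ s, k (t - s) * (E s * c) ≤ E t * (a * c) := by
  have hm : Measurable fun s => k (t - s) * E s :=
    (hk.comp (measurable_const.sub measurable_id)).mul hE
  simp only [← mul_assoc]
  rw [lintegral_mul_const _ hm]
  calc _ ≤ a * E t * c := by gcongr; exact ha t
    _ = _ := by ring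

include hK hw hE ha hb in
/-- Bound for integrals over some of the variables, uniformly in the others. -/
lemma lmarginal_absDuhamel_le (hwE : ∀ t x, w t x ≤ E t) (n : ℕ) (κ : Fin n → V) (S : Finset V)
    (hS : S ⊆ Finset.univ.image κ) (t : ℝ) (x : Space d) (z : V → Space d) :
    lmarginal (fun _ => volume) S (fun z => absDuhamel K w n t x (fun i => z (κ i))) z ≤
      E t * (a ^ S.card * b ^ (n - S.card)) := by
  induction n generalizing S t x z with
  | zero =>
    have : S = ∅ := by simpa using hS
    subst this
    simpa [absDuhamel] using hwE t x
  | succ n ih =>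
    have hmD := measurable_absDuhamel hK.meas hw n
    have hcoord : ∀ v : V, Measurable fun z : V → Space d => z v := fun v => measurable_pi_apply v
    have hint : ∀ π : Equiv.Perm (Fin (n + 1)), Measurable fun q : ℝ × (V → Space d) =>
        K (t - q.1) x (q.2 (κ (π 0))) *
          absDuhamel K w n q.1 (q.2 (κ (π 0))) (fun i => q.2 (κ (π i.succ))) := fun π =>
      measurable_absOp_integrand hK.meas hmD (measurable_const.sub measurable_fst) measurable_fst
        measurable_const ((hcoord _).comp measurable_snd)
        (measurable_pi_iff.2 fun i => (hcoord _).comp measurable_snd)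
    have h1 := lmarginal_average_lintegral (g := fun π r (z : V → Space d) =>
      K (t - r) x (z (κ (π 0))) * absDuhamel K w n r (z (κ (π 0))) (fun i => z (κ (π i.succ))))
      hint (((n + 1)! : ℝ≥0∞)⁻¹) S z
    have hint' : ∀ π : Equiv.Perm (Fin (n + 1)), ∀ r, Measurable fun z : V → Space d =>
        K (t - r) x (z (κ (π 0))) * absDuhamel K w n r (z (κ (π 0)))
          (fun i => z (κ (π i.succ))) := fun π r =>
      (hint π).comp (measurable_const.prodMk measurable_id)
    simp only [absDuhamel, absOp]
    rw [h1]
    refine average_perm_le fun π => ?_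
    have himg : Finset.univ.image κ = insert (κ (π 0))
        (Finset.univ.image fun i : Fin n => κ (π i.succ)) := by
      ext v
      simp only [Finset.mem_image, Finset.mem_univ, true_and, Finset.mem_insert]
      rw [← π.exists_congr_right (q := fun i => κ i = v), Fin.exists_fin_succ]
      tauto
    rw [himg] at hS
    have hcard : (Finset.univ.image fun i : Fin n => κ (π i.succ)).card ≤ n :=
      Finset.card_image_le.trans (by simp)
    by_cases hv : κ (π 0) ∈ S
    · have hS' : S.erase (κ (π 0)) ⊆ Finset.univ.image fun i : Fin n => κ (π i.succ) := by
        intro u hu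
        rw [Finset.mem_erase] at hu
        exact (Finset.mem_insert.1 (hS hu.2)).resolve_left hu.1
      have hcS : (S.erase (κ (π 0))).card + 1 = S.card := Finset.card_erase_add_one hv
      refine (lintegral_mono (g := fun s => k₁ (t - s) * (E s * (a ^ (S.erase (κ (π 0))).card *
        b ^ (n - (S.erase (κ (π 0))).card)))) fun s => ?_).trans ?_
      · simp only
        rw [lmarginal_erase _ (hint' π s) hv]
        calc _ ≤ ∫⁻ v, K (t - s) x v * (E s * (a ^ (S.erase (κ (π 0))).card *
              b ^ (n - (S.erase (κ (π 0))).card))) := by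
              refine lintegral_mono fun v => ?_
              refine le_trans (le_of_eq ?_) (mul_le_mul_right
                (ih (fun i => κ (π i.succ)) _ hS' s v (Function.update z (κ (π 0)) v)) _)
              rw [← lmarginal_const_mul]
              · unfold lmarginal
                refine lintegral_congr fun y => ?_
                have : Function.updateFinset (Function.update z (κ (π 0)) v) (S.erase (κ (π 0))) y
                    (κ (π 0)) = v := by
                  simp [Function.updateFinset]
                simp only [this]
              · exact hmD.comp (measurable_const.prodMk (measurable_const.prodMk
                  (measurable_pi_iff.2 fun i => hcoord _)))
          _ = (∫⁻ v, K (t - s) x v) * _ := lintegral_mul_const _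
              (hK.meas.comp (measurable_const.prodMk (measurable_const.prodMk measurable_id)))
          _ ≤ _ := by gcongr; exact hK.right _ _
      · refine (lintegral_conv_mul_le hE hK.meas₁ ha _ t).trans (le_of_eq ?_)
        rw [← hcS, pow_succ', show n + 1 - ((S.erase (κ (π 0))).card + 1) =
          n - (S.erase (κ (π 0))).card by omega, mul_assoc]
    · have hS' : S ⊆ Finset.univ.image fun i : Fin n => κ (π i.succ) := fun u hu =>
        (Finset.mem_insert.1 (hS hu)).resolve_left fun h => hv (h ▸ hu)
      have hSn : S.card ≤ n := (Finset.card_le_card hS').trans hcard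
      refine (lintegral_mono (g := fun s => k₂ (t - s) * (E s * (a ^ S.card *
        b ^ (n - S.card)))) fun s => ?_).trans ?_
      · simp only
        refine le_trans ?_ (mul_le_mul_right
          (ih (fun i => κ (π i.succ)) _ hS' s (z (κ (π 0))) z) _)
        rw [← lmarginal_const_mul]
        · unfold lmarginal
          refine lintegral_mono fun y => ?_
          have : Function.updateFinset z S y (κ (π 0)) = z (κ (π 0)) := by
            simp [Function.updateFinset, hv]
          simp only [this]
          gcongr
          exact hK.sup _ _ _
        · exact hmD.comp (measurable_const.prodMk (measurable_const.prodMk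
            (measurable_pi_iff.2 fun i => hcoord _)))
      · refine (lintegral_conv_mul_le hE hK.meas₂ hb _ t).trans (le_of_eq ?_)
        rw [show n + 1 - S.card = (n - S.card) + 1 by omega, pow_succ']
        ring

include hK hw hE ha hb in
/-- Bound for the integral over all variables, the space variable included. -/
lemma lmarginal_image_absDuhamel_le {A : ℝ≥0∞} (hwA : ∀ t, ∫⁻ x, w t x ≤ E t * A) (n : ℕ)
    (κ : Fin (n + 1) → V) (t : ℝ) (z : V → Space d) :
    lmarginal (fun _ => volume) (Finset.univ.image κ)
      (fun z => absDuhamel K w n t (z (κ 0)) (fun i => z (κ i.succ))) z ≤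
      E t * (A * (a ^ ((Finset.univ.image κ).card - 1) * b ^ (n + 1 - (Finset.univ.image κ).card))) := by
  induction n generalizing t z with
  | zero =>
    have : Finset.univ.image κ = {κ 0} := by
      ext v; simp
    rw [this, lmarginal_singleton]
    simpa [absDuhamel] using hwA t
  | succ n ih =>
    have hmD := measurable_absDuhamel hK.meas hw n
    have hcoord : ∀ v : V, Measurable fun z : V → Space d => z v := fun v => measurable_pi_apply v
    have hint : ∀ π : Equiv.Perm (Fin (n + 1)), Measurable fun q : ℝ × (V → Space d) =>
        K (t - q.1) (q.2 (κ 0)) (q.2 (κ (π 0).succ)) *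
          absDuhamel K w n q.1 (q.2 (κ (π 0).succ)) (fun i => q.2 (κ (π i.succ).succ)) := fun π =>
      measurable_absOp_integrand hK.meas hmD (measurable_const.sub measurable_fst) measurable_fst
        ((hcoord _).comp measurable_snd) ((hcoord _).comp measurable_snd)
        (measurable_pi_iff.2 fun i => (hcoord _).comp measurable_snd)
    have h1 := lmarginal_average_lintegral (g := fun π r (z : V → Space d) =>
      K (t - r) (z (κ 0)) (z (κ (π 0).succ)) * absDuhamel K w n r (z (κ (π 0).succ))
        (fun i => z (κ (π i.succ).succ))) hint (((n + 1)! : ℝ≥0∞)⁻¹) (Finset.univ.image κ) z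
    have hint' : ∀ π : Equiv.Perm (Fin (n + 1)), ∀ r, Measurable fun z : V → Space d =>
        K (t - r) (z (κ 0)) (z (κ (π 0).succ)) * absDuhamel K w n r (z (κ (π 0).succ))
          (fun i => z (κ (π i.succ).succ)) := fun π r =>
      (hint π).comp (measurable_const.prodMk measurable_id)
    simp only [absDuhamel, absOp]
    rw [h1]
    refine average_perm_le fun π => ?_
    set κ' : Fin (n + 1) → V := fun i => κ (π i).succ with hκ'
    have himg : Finset.univ.image κ = insert (κ 0) (Finset.univ.image κ') := by
      ext v
      simp only [Finset.mem_image, Finset.mem_univ, true_and, Finset.mem_insert, hκ']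
      rw [Fin.exists_fin_succ, ← π.exists_congr_right (q := fun i => κ i.succ = v)]
      tauto
    have hcard : (Finset.univ.image κ').card ≤ n + 1 := Finset.card_image_le.trans (by simp)
    have hcard1 : 1 ≤ (Finset.univ.image κ').card :=
      Finset.card_pos.2 ⟨κ' 0, Finset.mem_image_of_mem _ (Finset.mem_univ _)⟩
    have hmD' : ∀ s, Measurable fun z : V → Space d =>
        absDuhamel K w n s (z (κ' 0)) (fun i => z (κ' i.succ)) := fun s =>
      hmD.comp (measurable_const.prodMk ((hcoord _).prodMk (measurable_pi_iff.2 fun i => hcoord _)))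
    -- If the space variable recurs among the other coordinates, it must be kept for the inner term
    -- and the kernel is bounded by its supremum. Otherwise only the kernel depends on it, and it is
    -- integrated out first, in the left argument of the kernel.
    by_cases hv : κ 0 ∈ Finset.univ.image κ'
    · rw [himg, Finset.insert_eq_of_mem hv]
      refine (lintegral_mono (g := fun s => k₂ (t - s) * (E s * (A *
        (a ^ ((Finset.univ.image κ').card - 1) * b ^ (n + 1 - (Finset.univ.image κ').card)))))
        fun s => ?_).trans ?_
      · simp only
        refine le_trans ?_ (mul_le_mul_right (ih κ' s z) _)
        rw [← lmarginal_const_mul _ (hmD' s)]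
        exact lmarginal_mono (fun z => mul_le_mul_left (hK.sup _ _ _) _) z
      · refine (lintegral_conv_mul_le hE hK.meas₂ hb _ t).trans (le_of_eq ?_)
        rw [show n + 1 + 1 - (Finset.univ.image κ').card =
          (n + 1 - (Finset.univ.image κ').card) + 1 by omega, pow_succ']
        ring
    · rw [himg, Finset.card_insert_of_notMem hv]
      refine (lintegral_mono (g := fun s => k₁ (t - s) * (E s * (A *
        (a ^ ((Finset.univ.image κ').card - 1) * b ^ (n + 1 - (Finset.univ.image κ').card)))))
        fun s => ?_).trans ?_
      · simp only
        refine le_trans ?_ (mul_le_mul_right (ih κ' s z) _)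
        rw [← lmarginal_const_mul _ (hmD' s),
          lmarginal_insert' _ (hint' π s) hv]
        refine lmarginal_mono (fun z => ?_) z
        have hne : ∀ i, κ' i ≠ κ 0 := fun i h =>
          hv (h ▸ Finset.mem_image_of_mem _ (Finset.mem_univ _))
        have hne0 : κ (π 0).succ ≠ κ 0 := hne 0
        have hnes : ∀ i : Fin n, κ (π i.succ).succ ≠ κ 0 := fun i => hne i.succ
        simp only [Function.update_self, Function.update_of_ne hne0, Function.update_of_ne (hnes _)]
        have hKm : Measurable fun ξ => K (t - s) ξ (z (κ (π 0).succ)) :=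
          hK.meas.comp (measurable_const.prodMk (measurable_id.prodMk measurable_const))
        rw [lintegral_mul_const _ hKm]
        exact mul_le_mul_left (hK.left _ _) _
      · refine (lintegral_conv_mul_le hE hK.meas₁ ha _ t).trans (le_of_eq ?_)
        rw [show n + 1 + 1 - ((Finset.univ.image κ').card + 1) =
          n + 1 - (Finset.univ.image κ').card by omega,
          show (Finset.univ.image κ').card + 1 - 1 = ((Finset.univ.image κ').card - 1) + 1 by omega,
          pow_succ']
        ring

end Marginal

end AbsDuhamel

end StratonovichSPDE

namespace StratonovichSPDE

/-! ### Cauchy-Schwarz for iterated integrals -/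

section CauchySchwarz

lemma sq_lintegral_le_of_sq_le {α : Type*} [MeasurableSpace α] {μ : Measure α} {f g h : α → ℝ≥0∞}
    (hg : AEMeasurable g μ) (hh : AEMeasurable h μ) (hfgh : ∀ x, f x ^ 2 ≤ g x * h x) :
    (∫⁻ x, f x ∂μ) ^ 2 ≤ (∫⁻ x, g x ∂μ) * ∫⁻ x, h x ∂μ := by
  have hsq : ∀ a : ℝ≥0∞, (a ^ (1 / 2 : ℝ)) ^ 2 = a := fun a => by
    rw [← ENNReal.rpow_natCast, ← ENNReal.rpow_mul]; norm_num
  have hle : ∀ x, f x ≤ g x ^ (1 / 2 : ℝ) * h x ^ (1 / 2 : ℝ) := by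
    intro x
    rw [← ENNReal.mul_rpow_of_nonneg _ _ (by norm_num)]
    have h2 : f x = (f x ^ 2) ^ (1 / 2 : ℝ) := by
      rw [← ENNReal.rpow_natCast, ← ENNReal.rpow_mul]; norm_num
    rw [h2]
    exact ENNReal.rpow_le_rpow (hfgh x) (by norm_num)
  calc (∫⁻ x, f x ∂μ) ^ 2 ≤ (∫⁻ x, g x ^ (1 / 2 : ℝ) * h x ^ (1 / 2 : ℝ) ∂μ) ^ 2 :=
        pow_le_pow_left₀ zero_le (lintegral_mono hle) 2
    _ ≤ (∫⁻ x, (g x ^ (1 / 2 : ℝ)) ^ 2 ∂μ) * ∫⁻ x, (h x ^ (1 / 2 : ℝ)) ^ 2 ∂μ :=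
        sq_lintegral_mul_le μ (hg.pow_const _) (hh.pow_const _)
    _ = _ := by simp only [hsq]

lemma sq_tsum_le_of_sq_le {ι : Type*} {f g h : ι → ℝ≥0∞} (hfgh : ∀ i, f i ^ 2 ≤ g i * h i) :
    (∑' i, f i) ^ 2 ≤ (∑' i, g i) * ∑' i, h i := by
  let _ : MeasurableSpace ι := ⊤
  have := sq_lintegral_le_of_sq_le (μ := Measure.count) (f := f) (g := g) (h := h)
    measurable_from_top.aemeasurable measurable_from_top.aemeasurable hfgh
  simpa only [lintegral_count] using this

variable {d : ℕ} {K : ℝ → Space d → Space d → ℝ≥0∞}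

/-- The iterated integral is linear in its initial term with nonnegative weights, so Cauchy-Schwarz
passes through every time integral and every average over permutations. This allows the two factors
to be estimated in different norms. -/
lemma sq_absDuhamel_le (hK : Measurable fun q : ℝ × Space d × Space d => K q.1 q.2.1 q.2.2)
    {w w₁ w₂ : ℝ → Space d → ℝ≥0∞} (hw₁ : Measurable fun q : ℝ × Space d => w₁ q.1 q.2)
    (hw₂ : Measurable fun q : ℝ × Space d => w₂ q.1 q.2)
    (hle : ∀ t x, w t x ^ 2 ≤ w₁ t x * w₂ t x) (n : ℕ) (t : ℝ) (x : Space d)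
    (y : Fin n → Space d) :
    absDuhamel K w n t x y ^ 2 ≤ absDuhamel K w₁ n t x y * absDuhamel K w₂ n t x y := by
  induction n generalizing t x with
  | zero => exact hle t x
  | succ n ih =>
    have hm : ∀ {w' : ℝ → Space d → ℝ≥0∞}, Measurable (fun q : ℝ × Space d => w' q.1 q.2) →
        ∀ π : Equiv.Perm (Fin (n + 1)), Measurable fun s => K (t - s) x (y (π 0)) *
          absDuhamel K w' n s (y (π 0)) (fun i => y (π i.succ)) := fun hw' π =>
      measurable_absOp_integrand hK (measurable_absDuhamel hK hw' n)
        (measurable_const.sub measurable_id) measurable_id measurable_const measurable_const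
        measurable_const
    simp only [absDuhamel, absOp]
    rw [mul_pow, mul_mul_mul_comm, ← sq]
    gcongr
    simp only [← tsum_fintype (L := .unconditional _)]
    refine sq_tsum_le_of_sq_le fun π => ?_
    refine sq_lintegral_le_of_sq_le (hm hw₁ π).aemeasurable (hm hw₂ π).aemeasurable fun s => ?_
    rw [mul_pow, mul_mul_mul_comm, ← sq]
    gcongr
    exact ih s _ _

end CauchySchwarz

/-! ### Bounds for the traces of the majorants -/

section TraceBound

variable {d : ℕ} {K : ℝ → Space d → Space d → ℝ≥0∞} {k₁ k₂ : ℝ → ℝ≥0∞} {w : ℝ → Space d → ℝ≥0∞}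
  (hK : KernelBound K k₁ k₂) (hw : Measurable fun q : ℝ × Space d => w q.1 q.2)
  {E : ℝ → ℝ≥0∞} (hE : Measurable E) {a b : ℝ≥0∞}
  (ha : ∀ t, ∫⁻ s, k₁ (t - s) * E s ≤ a * E t) (hb : ∀ t, ∫⁻ s, k₂ (t - s) * E s ≤ b * E t)

lemma lmarginal_image_inr {m k : ℕ} (f : (Fin m ⊕ Fin k → Space d) → ℝ≥0∞)
    (z : Fin m ⊕ Fin k → Space d) :
    lmarginal (fun _ => volume) (Finset.univ.image Sum.inr) f z =
      ∫⁻ v : Fin k → Space d, f (Sum.elim (z ∘ Sum.inl) v) := by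
  let e : Fin k ≃ (Finset.univ.image (Sum.inr : Fin k → Fin m ⊕ Fin k) : Finset _) :=
    Equiv.ofBijective (fun i => ⟨Sum.inr i, by simp⟩) ⟨fun i j h => by simpa using h, by
      rintro ⟨v, hv⟩
      obtain ⟨i, -, rfl⟩ := Finset.mem_image.1 hv
      exact ⟨i, rfl⟩⟩
  unfold lmarginal
  rw [← lintegral_comp_equiv e]
  refine lintegral_congr fun y => ?_
  congr 1
  ext1 v
  rcases v with v | v
  · simp [Function.updateFinset]
  · have h : (Sum.inr v : Fin m ⊕ Fin k) ∈ Finset.univ.image (Sum.inr : Fin k → Fin m ⊕ Fin k) := by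
      simp
    simp only [Function.updateFinset, dif_pos h, Sum.elim_inr]
    rfl

include hK hw hE ha hb in
-- Of the `m + 2k` kernels, one is integrated for each of the `k` traced variables and the others
-- are bounded by their suprema.
lemma lintegral_absDuhamel_traceTuple_le (hwE : ∀ t x, w t x ≤ E t) (m k : ℕ) (t : ℝ) (x : Space d)
    (y : Fin m → Space d) :
    ∫⁻ z : Fin k → Space d, absDuhamel K w (m + 2 * k) t x (traceTuple y z) ≤
      E t * (a ^ k * b ^ (m + k)) := by
  have h := lmarginal_absDuhamel_le hK hw hE ha hb hwE (m + 2 * k) (traceIdx m k)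
    (Finset.univ.image Sum.inr) (fun v hv => by
      obtain ⟨i, -, rfl⟩ := Finset.mem_image.1 hv
      have := card_traceIdx_inr m k i
      obtain ⟨j, hj⟩ := Finset.card_pos.1 (by omega : 0 < (Finset.univ.filter fun j =>
        traceIdx m k j = Sum.inr i).card)
      exact Finset.mem_image.2 ⟨j, Finset.mem_univ _, by simpa using hj⟩) t x
    (Sum.elim y (fun _ => 0))
  rw [lmarginal_image_inr, Finset.card_image_of_injective _ Sum.inr_injective, Finset.card_univ,
    Fintype.card_fin, show m + 2 * k - k = m + k by omega] at h
  simpa only [traceTuple_eq, Sum.elim_comp_inl] using h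

include hK hw hE ha hb in
-- Now all `m + k + 1` variables are integrated: one is absorbed by the initial term, giving `A`,
-- and `m + k` by kernels. The exponents of `a` and `b` complement those of the uniform bound, so
-- the product of the two estimates contains `(a * b) ^ (m + 2 * k)`.
lemma lintegral_lintegral_absDuhamel_traceTuple_le {A : ℝ≥0∞} (hwA : ∀ t, ∫⁻ x, w t x ≤ E t * A)
    (m k : ℕ) (t : ℝ) :
    ∫⁻ x, ∫⁻ y : Fin m → Space d, ∫⁻ z : Fin k → Space d,
      absDuhamel K w (m + 2 * k) t x (traceTuple y z) ≤ E t * (A * (a ^ (m + k) * b ^ k)) := by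
  let κ : Fin (m + 2 * k + 1) → Fin 1 ⊕ (Fin m ⊕ Fin k) :=
    Fin.cons (Sum.inl 0) (fun i => Sum.inr (traceIdx m k i))
  have hκ : Finset.univ.image κ = Finset.univ := by
    rw [Finset.eq_univ_iff_forall]
    rintro (v | v | v)
    · exact Finset.mem_image.2 ⟨0, Finset.mem_univ _, by simp [κ, Subsingleton.elim v 0]⟩
    · have := card_traceIdx_inl m k v
      obtain ⟨j, hj⟩ := Finset.card_pos.1 (by omega : 0 < (Finset.univ.filter fun j =>
        traceIdx m k j = Sum.inl v).card)
      exact Finset.mem_image.2 ⟨j.succ, Finset.mem_univ _, by simpa [κ] using hj⟩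
    · have := card_traceIdx_inr m k v
      obtain ⟨j, hj⟩ := Finset.card_pos.1 (by omega : 0 < (Finset.univ.filter fun j =>
        traceIdx m k j = Sum.inr v).card)
      exact Finset.mem_image.2 ⟨j.succ, Finset.mem_univ _, by simpa [κ] using hj⟩
  have h := lmarginal_image_absDuhamel_le hK hw hE ha hb hwA (m + 2 * k) κ t (fun _ => 0)
  rw [hκ, lmarginal_univ, Finset.card_univ, Fintype.card_sum, Fintype.card_sum, Fintype.card_fin,
    Fintype.card_fin, Fintype.card_fin, show 1 + (m + k) - 1 = m + k by omega,
    show m + 2 * k + 1 - (1 + (m + k)) = k by omega] at h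
  refine le_trans (le_of_eq ?_) h
  have hmD := measurable_absDuhamel hK.meas hw (m + 2 * k)
  have hcoord : ∀ v, Measurable fun z : Fin 1 ⊕ (Fin m ⊕ Fin k) → Space d => z v :=
    fun v => measurable_pi_apply v
  have hcoord' : ∀ v, Measurable fun z : Fin m ⊕ Fin k → Space d => z v :=
    fun v => measurable_pi_apply v
  have hm1 : Measurable fun z : Fin 1 ⊕ (Fin m ⊕ Fin k) → Space d =>
      absDuhamel K w (m + 2 * k) t (z (κ 0)) (fun i => z (κ i.succ)) :=
    hmD.comp (measurable_const.prodMk ((hcoord _).prodMk (measurable_pi_iff.2 fun i => hcoord _)))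
  have hm2 : ∀ x, Measurable fun z : Fin m ⊕ Fin k → Space d =>
      absDuhamel K w (m + 2 * k) t x (fun i => z (traceIdx m k i)) := fun x =>
    hmD.comp (measurable_const.prodMk (measurable_const.prodMk
      (measurable_pi_iff.2 fun i => hcoord' _)))
  rw [← volume_pi, lintegral_sumElim hm1]
  have h1 := (volume_preserving_funUnique (Fin 1) (Space d)).lintegral_comp_emb
    (MeasurableEquiv.measurableEmbedding _) (fun x => ∫⁻ z : Fin m ⊕ Fin k → Space d,
      absDuhamel K w (m + 2 * k) t x (fun i => z (traceIdx m k i)))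
  simp only [κ, Fin.cons_zero, Fin.cons_succ, Sum.elim_inl, Sum.elim_inr]
  refine Eq.trans ?_ h1.symm
  refine lintegral_congr fun x => ?_
  rw [lintegral_sumElim (hm2 x)]
  simp only [traceTuple_eq]

/-- The main estimate for the traces of a series dominated by `absDuhamel`. -/
lemma lintegral_traceSq_le (hK : KernelBound K k₁ k₂) {h w₁ : ℝ → Space d → ℝ≥0∞}
    (hh : Measurable fun q : ℝ × Space d => h q.1 q.2)
    (hw₁ : Measurable fun q : ℝ × Space d => w₁ q.1 q.2)
    (hE : Measurable E) (ha : ∀ t, ∫⁻ s, k₁ (t - s) * E s ≤ a * E t)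
    (hb : ∀ t, ∫⁻ s, k₂ (t - s) * E s ≤ b * E t) {A : ℝ≥0∞}
    (hhA : ∀ t, ∫⁻ x, h t x ^ 2 ≤ E t * A) (hw₁E : ∀ t x, w₁ t x ≤ E t)
    (hhw : ∀ t x, h t x ^ 2 ≤ h t x ^ 2 * w₁ t x)
    {t : ℝ} {F : Space d → (n : ℕ) → (Fin n → Space d) → ℝ} {τ : ℝ≥0∞} {m k : ℕ}
    (hF : ∀ x y, ‖F x (m + 2 * k) y‖ₑ ≤ τ * absDuhamel K h (m + 2 * k) t x y) :
    ∫⁻ x, traceSq (F x) m k ≤ τ ^ 2 * (E t ^ 2 * A * (a * b) ^ (m + 2 * k)) := by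
  have hh2 : Measurable fun q : ℝ × Space d => h q.1 q.2 ^ 2 := hh.pow_const 2
  have hmD := measurable_absDuhamel (w := fun t x => h t x ^ 2) hK.meas hh2 (m + 2 * k)
  have hmD' : Measurable fun q : Space d × (Fin m → Space d) × (Fin k → Space d) =>
      absDuhamel K (fun t x => h t x ^ 2) (m + 2 * k) t q.1 (traceTuple q.2.1 q.2.2) :=
    hmD.comp (measurable_const.prodMk (measurable_fst.prodMk
      (measurable_traceTuple.comp measurable_snd)))
  have hm0 := measurable_absDuhamel hK.meas hh (m + 2 * k)
  have hm1 := measurable_absDuhamel hK.meas hw₁ (m + 2 * k)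
  -- Cauchy-Schwarz in the traced variables, with initial terms `h²` and `w₁`. The factor with `w₁`
  -- is bounded uniformly in `(x,y)`; the one with `h²` is kept for the integration over all
  -- variables.
  have h1 : ∀ x (y : Fin m → Space d), (∫⁻ z : Fin k → Space d,
      ‖F x (m + 2 * k) (traceTuple y z)‖ₑ) ^ 2 ≤ τ ^ 2 * (E t * (a ^ k * b ^ (m + k))) *
        ∫⁻ z : Fin k → Space d,
          absDuhamel K (fun t x => h t x ^ 2) (m + 2 * k) t x (traceTuple y z) := by
    intro x y
    have hc : ∀ {w' : ℝ → Space d → ℝ≥0∞}, (Measurable fun q : ℝ × Space d × (Fin (m + 2 * k) → Space d)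
        => absDuhamel K w' (m + 2 * k) q.1 q.2.1 q.2.2) → Measurable fun z : Fin k → Space d =>
        absDuhamel K w' (m + 2 * k) t x (traceTuple y z) := fun hm =>
      hm.comp (measurable_const.prodMk (measurable_const.prodMk
        (measurable_traceTuple.comp (measurable_const.prodMk measurable_id))))
    calc _ ≤ (∫⁻ z : Fin k → Space d, τ * absDuhamel K h (m + 2 * k) t x (traceTuple y z)) ^ 2 :=
          pow_le_pow_left₀ zero_le (lintegral_mono fun z => hF x _) 2
      _ = τ ^ 2 * (∫⁻ z : Fin k → Space d, absDuhamel K h (m + 2 * k) t x (traceTuple y z)) ^ 2 := by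
          rw [lintegral_const_mul _ (hc hm0), mul_pow]
      _ ≤ τ ^ 2 * ((∫⁻ z : Fin k → Space d,
            absDuhamel K (fun t x => h t x ^ 2) (m + 2 * k) t x (traceTuple y z)) *
            ∫⁻ z : Fin k → Space d, absDuhamel K w₁ (m + 2 * k) t x (traceTuple y z)) := by
          gcongr
          exact sq_lintegral_le_of_sq_le (hc hmD).aemeasurable (hc hm1).aemeasurable fun z =>
            sq_absDuhamel_le hK.meas hh2 hw₁ hhw _ _ _ _
      _ ≤ τ ^ 2 * ((∫⁻ z : Fin k → Space d,
            absDuhamel K (fun t x => h t x ^ 2) (m + 2 * k) t x (traceTuple y z)) *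
            (E t * (a ^ k * b ^ (m + k)))) := by
          gcongr
          exact lintegral_absDuhamel_traceTuple_le hK hw₁ hE ha hb hw₁E m k t x y
      _ = _ := by ring
  have hm2 : Measurable fun q : Space d × (Fin m → Space d) => ∫⁻ z : Fin k → Space d,
      absDuhamel K (fun t x => h t x ^ 2) (m + 2 * k) t q.1 (traceTuple q.2 z) :=
    Measurable.lintegral_prod_right' (f := fun p : (Space d × (Fin m → Space d)) × (Fin k → Space d) =>
      absDuhamel K (fun t x => h t x ^ 2) (m + 2 * k) t p.1.1 (traceTuple p.1.2 p.2))
      (hmD'.comp ((measurable_fst.comp measurable_fst).prodMk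
        ((measurable_snd.comp measurable_fst).prodMk measurable_snd)))
  have hm3 : ∀ x, Measurable fun y : Fin m → Space d => ∫⁻ z : Fin k → Space d,
      absDuhamel K (fun t x => h t x ^ 2) (m + 2 * k) t x (traceTuple y z) := fun x =>
    hm2.comp (measurable_const.prodMk measurable_id)
  calc ∫⁻ x, traceSq (F x) m k ≤ ∫⁻ x, τ ^ 2 * (E t * (a ^ k * b ^ (m + k))) *
        ∫⁻ y : Fin m → Space d, ∫⁻ z : Fin k → Space d,
          absDuhamel K (fun t x => h t x ^ 2) (m + 2 * k) t x (traceTuple y z) := by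
        refine lintegral_mono fun x => ?_
        rw [← lintegral_const_mul _ (hm3 x)]
        exact lintegral_mono fun y => h1 x y
    _ = τ ^ 2 * (E t * (a ^ k * b ^ (m + k))) * ∫⁻ x,
        ∫⁻ y : Fin m → Space d, ∫⁻ z : Fin k → Space d,
          absDuhamel K (fun t x => h t x ^ 2) (m + 2 * k) t x (traceTuple y z) :=
      lintegral_const_mul _ hm2.lintegral_prod_right'
    _ ≤ τ ^ 2 * (E t * (a ^ k * b ^ (m + k))) * (E t * (A * (a ^ (m + k) * b ^ k))) := by
        gcongr
        exact lintegral_lintegral_absDuhamel_traceTuple_le hK hh2 hE ha hb hhA m k t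
    _ = _ := by ring

end TraceBound

end StratonovichSPDE

namespace StratonovichSPDE

lemma measurable_of_forall_eq {A B : Type*} [MeasurableSpace A] [MeasurableSpace B] {f g : A → B}
    (hf : Measurable f) (h : ∀ a, f a = g a) : Measurable g :=
  funext h ▸ hf

/-! ### Formal series and the operator 𝓗 on the time interval -/

section Series

variable {d : ℕ} {σ T 𝔪 : ℝ} {G : ℝ → Space d → Space d → ℝ} {f : StratSeries d}

/-- The Green's function, extended by zero outside `(0,T)`. -/
noncomputable def cutGreen (T : ℝ) (G : ℝ → Space d → Space d → ℝ) (t : ℝ) (x y : Space d) : ℝ :=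
  (Set.Ioo 0 T).indicator (fun t => G t x y) t

/-- The coefficients of a series, extended by zero outside `(0,T)`. -/
noncomputable def cutSeries (T : ℝ) (f : StratSeries d) : StratSeries d :=
  fun n t x y => (Set.Ioo 0 T).indicator (fun t => f n t x y) t

lemma cutGreen_of_mem {t : ℝ} (ht : t ∈ Set.Ioo 0 T) (x y : Space d) :
    cutGreen T G t x y = G t x y := Set.indicator_of_mem ht _

lemma cutGreen_of_notMem {t : ℝ} (ht : t ∉ Set.Ioo 0 T) (x y : Space d) :
    cutGreen T G t x y = 0 := Set.indicator_of_notMem ht _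

lemma cutSeries_of_mem {t : ℝ} (ht : t ∈ Set.Ioo 0 T) (n : ℕ) (x : Space d) (y : Fin n → Space d) :
    cutSeries T f n t x y = f n t x y := Set.indicator_of_mem ht _

lemma cutSeries_of_notMem {t : ℝ} (ht : t ∉ Set.Ioo 0 T) (n : ℕ) (x : Space d)
    (y : Fin n → Space d) : cutSeries T f n t x y = 0 := Set.indicator_of_notMem ht _

/-- Joint measurability of the coefficients on `(0,T)`. -/
def MeasurableSeries (T : ℝ) (f : StratSeries d) : Prop :=
  ∀ n, Measurable fun q : ℝ × Space d × (Fin n → Space d) => cutSeries T f n q.1 q.2.1 q.2.2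

lemma measurableSeries_iff : MeasurableSeries T f ↔ ∀ n, Measurable
    (fun q : Set.Ioo (0 : ℝ) T × Space d × (Fin n → Space d) => f n q.1 q.2.1 q.2.2) := by
  refine forall_congr' fun n => ⟨fun h => ?_, fun h => ?_⟩
  · have h2 : Measurable fun q : Set.Ioo (0 : ℝ) T × Space d × (Fin n → Space d) =>
        ((q.1 : ℝ), q.2.1, q.2.2) := by fun_prop
    have h3 := h.comp h2
    refine measurable_of_forall_eq h3 fun q => ?_
    exact cutSeries_of_mem q.1.2 _ _ _
  · have hs : MeasurableSet (Set.Ioo 0 T ×ˢ (Set.univ : Set (Space d × (Fin n → Space d)))) :=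
      measurableSet_Ioo.prod MeasurableSet.univ
    refine measurable_of_restrict_of_restrict_compl hs ?_ ?_
    · have h2 : Measurable fun q : (Set.Ioo 0 T ×ˢ (Set.univ : Set (Space d × (Fin n → Space d))) :
          Set _) => ((⟨q.1.1, q.2.1⟩ : Set.Ioo (0 : ℝ) T), q.1.2.1, q.1.2.2) := by
        refine Measurable.prodMk ?_ ?_
        · exact Measurable.subtype_mk (measurable_fst.comp measurable_subtype_coe)
        · exact measurable_snd.comp measurable_subtype_coe
      refine measurable_of_forall_eq ((h.comp h2)) fun q => ?_
      exact (cutSeries_of_mem q.2.1 _ _ _).symm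
    · refine measurable_of_forall_eq ((measurable_const (a := (0 : ℝ)))) fun q => ?_
      exact (cutSeries_of_notMem (fun h => q.2 ⟨h, Set.mem_univ _⟩) _ _ _).symm

lemma measurable_cutGreen (hG : IsGreen 𝔪 T G) :
    Measurable fun q : ℝ × Space d × Space d => cutGreen T G q.1 q.2.1 q.2.2 := by
  classical
  have h := hG.cont.measurable_piecewise (g := fun _ => (0 : ℝ)) continuousOn_const
    (measurableSet_Ioo.prod MeasurableSet.univ)
  refine measurable_of_forall_eq h fun q => ?_
  by_cases hq : q.1 ∈ Set.Ioo 0 T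
  · rw [Set.piecewise_eq_of_mem _ _ _ (show q ∈ Set.Ioo 0 T ×ˢ Set.univ from ⟨hq, Set.mem_univ _⟩), cutGreen_of_mem hq]
  · rw [Set.piecewise_eq_of_notMem _ _ _
      (show q ∉ Set.Ioo 0 T ×ˢ Set.univ from fun h => hq h.1), cutGreen_of_notMem hq]

/-- The time integrals in the definition of `opH` are integrals over the real line. -/
lemma intervalIntegral_eq_integral_cut {t : ℝ} (ht : t ∈ Set.Ioo 0 T) (n : ℕ) (x v : Space d)
    (y : Fin n → Space d) : ∫ s in (0 : ℝ)..t, G (t - s) x v * f n s v y =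
      ∫ s, cutGreen T G (t - s) x v * cutSeries T f n s v y := by
  rw [intervalIntegral.integral_of_le ht.1.le, integral_Ioc_eq_integral_Ioo,
    ← integral_indicator measurableSet_Ioo]
  refine integral_congr_ae (ae_of_all _ fun s => ?_)
  simp only
  by_cases hs : s ∈ Set.Ioo 0 t
  · rw [Set.indicator_of_mem hs, cutGreen_of_mem ⟨by linarith [hs.2], by linarith [hs.1, ht.2]⟩,
      cutSeries_of_mem ⟨hs.1, hs.2.trans ht.2⟩]
  · rw [Set.indicator_of_notMem hs]
    by_cases h0 : 0 < s
    · rw [cutGreen_of_notMem, zero_mul]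
      intro h
      exact hs ⟨h0, by linarith [h.1]⟩
    · rw [cutSeries_of_notMem (fun h => h0 h.1), mul_zero]

lemma opH_succ {t : ℝ} (ht : t ∈ Set.Ioo 0 T) (n : ℕ) (x : Space d) (y : Fin (n + 1) → Space d) :
    opH σ G f (n + 1) t x y = σ * (((n + 1)! : ℝ)⁻¹ * ∑ π : Equiv.Perm (Fin (n + 1)),
      ∫ s, cutGreen T G (t - s) x (y (π 0)) * cutSeries T f n s (y (π 0)) (fun i => y (π i.succ))) := by
  simp only [opH, intervalIntegral_eq_integral_cut ht]

lemma opH_congr {f g : StratSeries d} {n : ℕ} (h : f n = g n) :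
    opH σ G f (n + 1) = opH σ G g (n + 1) := by
  funext t x y
  simp only [opH, h]

lemma measurable_integral_cut (hG : IsGreen 𝔪 T G) {n : ℕ} {A : Type*} [MeasurableSpace A]
    (hf : Measurable fun q : ℝ × Space d × (Fin n → Space d) => cutSeries T f n q.1 q.2.1 q.2.2)
    {t : A → ℝ} {x v : A → Space d} {y : A → Fin n → Space d} (ht : Measurable t)
    (hx : Measurable x) (hv : Measurable v) (hy : Measurable y) :
    Measurable fun a => ∫ s, cutGreen T G (t a - s) (x a) (v a) * cutSeries T f n s (v a) (y a) := by
  have hm : Measurable fun p : A × ℝ => cutGreen T G (t p.1 - p.2) (x p.1) (v p.1) *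
      cutSeries T f n p.2 (v p.1) (y p.1) :=
    ((measurable_cutGreen hG).comp (((ht.comp measurable_fst).sub measurable_snd).prodMk
      ((hx.comp measurable_fst).prodMk (hv.comp measurable_fst)))).mul
      (hf.comp (measurable_snd.prodMk ((hv.comp measurable_fst).prodMk (hy.comp measurable_fst))))
  exact hm.stronglyMeasurable.integral_prod_right'.measurable

lemma MeasurableSeries.opH (hG : IsGreen 𝔪 T G) (hf : MeasurableSeries T f) (σ : ℝ) :
    MeasurableSeries T (opH σ G f) := by
  intro n
  cases n with
  | zero =>
    refine measurable_of_forall_eq ((measurable_const (a := (0 : ℝ)))) fun q => ?_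
    simp [cutSeries, StratonovichSPDE.opH, Set.indicator]
  | succ n =>
    have hS : MeasurableSet {q : ℝ × Space d × (Fin (n + 1) → Space d) | q.1 ∈ Set.Ioo 0 T} :=
      measurable_fst measurableSet_Ioo
    have hm : Measurable fun q : ℝ × Space d × (Fin (n + 1) → Space d) =>
        σ * (((n + 1)! : ℝ)⁻¹ * ∑ π : Equiv.Perm (Fin (n + 1)),
          ∫ s, cutGreen T G (q.1 - s) q.2.1 (q.2.2 (π 0)) *
            cutSeries T f n s (q.2.2 (π 0)) (fun i => q.2.2 (π i.succ))) := by
      have hc : ∀ i, Measurable fun q : ℝ × Space d × (Fin (n + 1) → Space d) => q.2.2 i := fun i =>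
        (measurable_pi_apply i).comp (measurable_snd.comp measurable_snd)
      exact ((Finset.measurable_sum _ fun π _ => measurable_integral_cut hG (hf n) measurable_fst
        (measurable_fst.comp measurable_snd) (hc _) (measurable_pi_iff.2 fun i => hc _)).const_mul
        _).const_mul _
    refine measurable_of_forall_eq ((hm.indicator hS)) fun q => ?_
    by_cases hq : q.1 ∈ Set.Ioo 0 T
    · rw [Set.indicator_of_mem (by exact hq), cutSeries_of_mem hq, opH_succ hq]
    · rw [Set.indicator_of_notMem (by exact hq), cutSeries_of_notMem hq]

lemma MeasurableSeries.iterate_opH (hG : IsGreen 𝔪 T G) (hf : MeasurableSeries T f) (σ : ℝ) (p : ℕ) :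
    MeasurableSeries T ((StratonovichSPDE.opH σ G)^[p] f) := by
  induction p with
  | zero => exact hf
  | succ p ih => rw [Function.iterate_succ_apply']; exact ih.opH hG σ

lemma MeasurableSeries.measurable_slice (hf : MeasurableSeries T f) (n : ℕ) {t : ℝ}
    (ht : t ∈ Set.Ioo 0 T) : Measurable fun q : Space d × (Fin n → Space d) => f n t q.1 q.2 := by
  have hm : Measurable fun q : Space d × (Fin n → Space d) => cutSeries T f n t q.1 q.2 :=
    (hf n).comp (measurable_const.prodMk measurable_id)
  refine measurable_of_forall_eq hm fun q => ?_
  exact cutSeries_of_mem ht _ _ _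

lemma opH_comp_perm (n : ℕ) (t : ℝ) (x : Space d) (y : Fin n → Space d) (ρ : Equiv.Perm (Fin n)) :
    opH σ G f n t x (fun i => y (ρ i)) = opH σ G f n t x y := by
  cases n with
  | zero => rfl
  | succ n =>
    simp only [opH]
    congr 2
    exact Equiv.sum_comp (Equiv.mulLeft ρ) (fun π : Equiv.Perm (Fin (n + 1)) =>
      ∫ s in (0 : ℝ)..t, G (t - s) x (y (π 0)) * f n s (y (π 0)) (fun i => y (π i.succ)))

lemma enorm_opH_le {t : ℝ} (ht : t ∈ Set.Ioo 0 T) (n : ℕ) (x : Space d)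
    (y : Fin (n + 1) → Space d) : ‖opH σ G f (n + 1) t x y‖ₑ ≤
      ‖σ‖ₑ * absOp (fun t x y => ‖cutGreen T G t x y‖ₑ) n
        (fun s v y => ‖cutSeries T f n s v y‖ₑ) t x y := by
  rw [opH_succ ht, enorm_mul, enorm_mul, absOp]
  gcongr
  · rw [← ofReal_norm, norm_inv, Real.norm_natCast, ENNReal.ofReal_inv_of_pos (by positivity),
      ENNReal.ofReal_natCast]
  · refine (enorm_sum_le _ _).trans (Finset.sum_le_sum fun π _ => ?_)
    refine (enorm_integral_le_lintegral_enorm _).trans (le_of_eq ?_)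
    simp only [enorm_mul]

/-! ### The Duhamel series -/

/-- The output of `𝓗` in degree `n + 1` depends only on the input in degree `n`, so passing from the
`n`th iterate to the whole series changes nothing there. -/
lemma duhamelSeries_succ (u₀ : Space d → ℝ) (n : ℕ) :
    duhamelSeries σ G u₀ (n + 1) = opH σ G (duhamelSeries σ G u₀) (n + 1) := by
  change (opH σ G)^[n + 1] (freeSeries G u₀) (n + 1) = _
  rw [Function.iterate_succ_apply']
  exact opH_congr rfl

lemma duhamelSeries_eq_add (u₀ : Space d → ℝ) : duhamelSeries σ G u₀ =
    fun n t x y => freeSeries G u₀ n t x y + opH σ G (duhamelSeries σ G u₀) n t x y := by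
  funext n t x y
  cases n with
  | zero => simp [duhamelSeries, opH]
  | succ n => rw [← duhamelSeries_succ]; simp [freeSeries]

/-- On the Duhamel series `𝓗^p` is truncation to degrees at least `p`; decay in the degree thereby
becomes decay in `p`. -/
lemma iterate_opH_duhamelSeries (u₀ : Space d → ℝ) (p n : ℕ) :
    (opH σ G)^[p] (duhamelSeries σ G u₀) n =
      if p ≤ n then duhamelSeries σ G u₀ n else fun _ _ _ => 0 := by
  induction p generalizing n with
  | zero => simp
  | succ p ih =>
    rw [Function.iterate_succ_apply']
    cases n with
    | zero => funext t x y; simp [opH]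
    | succ n =>
      by_cases hpn : p ≤ n
      · rw [if_pos (by omega), duhamelSeries_succ]
        exact opH_congr (by rw [ih, if_pos hpn])
      · rw [if_neg (by omega)]
        funext t x y
        simp only [opH, ih, if_neg hpn]
        simp

lemma measurableSeries_freeSeries (hG : IsGreen 𝔪 T G) {u₀ : Space d → ℝ} (hu : Measurable u₀) :
    MeasurableSeries T (freeSeries G u₀) := by
  intro n
  cases n with
  | zero =>
    have hm : Measurable fun q : ℝ × Space d × (Fin 0 → Space d) =>
        ∫ ξ, cutGreen T G q.1 q.2.1 ξ * u₀ ξ := by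
      have hm' : Measurable fun p : (ℝ × Space d × (Fin 0 → Space d)) × Space d =>
          cutGreen T G p.1.1 p.1.2.1 p.2 * u₀ p.2 :=
        ((measurable_cutGreen hG).comp ((measurable_fst.comp measurable_fst).prodMk
          ((measurable_fst.comp (measurable_snd.comp measurable_fst)).prodMk measurable_snd))).mul
          (hu.comp measurable_snd)
      exact hm'.stronglyMeasurable.integral_prod_right'.measurable
    refine measurable_of_forall_eq hm fun q => ?_
    by_cases hq : q.1 ∈ Set.Ioo 0 T
    · simp only [cutSeries_of_mem hq, cutGreen_of_mem hq, freeSeries]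
    · simp [cutSeries_of_notMem hq, cutGreen_of_notMem hq]
  | succ n =>
    refine measurable_of_forall_eq ((measurable_const (a := (0 : ℝ)))) fun q => ?_
    simp [cutSeries, freeSeries, Set.indicator]

lemma measurableSeries_duhamelSeries (hG : IsGreen 𝔪 T G) {u₀ : Space d → ℝ} (hu : Measurable u₀) :
    MeasurableSeries T (duhamelSeries σ G u₀) := by
  intro n
  exact (measurableSeries_freeSeries hG hu).iterate_opH hG σ n n

lemma duhamelSeries_comp_perm (u₀ : Space d → ℝ) (n : ℕ) (t : ℝ) (x : Space d)
    (y : Fin n → Space d) (ρ : Equiv.Perm (Fin n)) :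
    duhamelSeries σ G u₀ n t x (fun i => y (ρ i)) = duhamelSeries σ G u₀ n t x y := by
  cases n with
  | zero => rfl
  | succ n => rw [duhamelSeries_succ]; exact opH_comp_perm _ _ _ _ _

/-- The initial term with absolute values. -/
noncomputable def absFree (T : ℝ) (G : ℝ → Space d → Space d → ℝ) (u₀ : Space d → ℝ) (t : ℝ)
    (x : Space d) : ℝ≥0∞ :=
  ∫⁻ ξ, ‖cutGreen T G t x ξ‖ₑ * ‖u₀ ξ‖ₑ

lemma measurable_absFree (hG : IsGreen 𝔪 T G) {u₀ : Space d → ℝ} (hu : Measurable u₀) :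
    Measurable fun q : ℝ × Space d => absFree T G u₀ q.1 q.2 := by
  have hm : Measurable fun p : (ℝ × Space d) × Space d =>
      ‖cutGreen T G p.1.1 p.1.2 p.2‖ₑ * ‖u₀ p.2‖ₑ :=
    ((measurable_cutGreen hG).comp ((measurable_fst.comp measurable_fst).prodMk
      ((measurable_snd.comp measurable_fst).prodMk measurable_snd))).enorm.mul
      (hu.comp measurable_snd).enorm
  exact hm.lintegral_prod_right'

lemma enorm_cutSeries_duhamelSeries_le (u₀ : Space d → ℝ) (n : ℕ) (t : ℝ) (x : Space d)
    (y : Fin n → Space d) : ‖cutSeries T (duhamelSeries σ G u₀) n t x y‖ₑ ≤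
      ‖σ‖ₑ ^ n * absDuhamel (fun t x y => ‖cutGreen T G t x y‖ₑ) (absFree T G u₀) n t x y := by
  by_cases ht : t ∈ Set.Ioo 0 T
  swap
  · rw [cutSeries_of_notMem ht]; simp
  induction n generalizing t x with
  | zero =>
    rw [cutSeries_of_mem ht, pow_zero, one_mul]
    refine (enorm_integral_le_lintegral_enorm _).trans (le_of_eq ?_)
    simp only [absDuhamel, absFree, enorm_mul, cutGreen_of_mem ht]
  | succ n ih =>
    rw [cutSeries_of_mem ht, duhamelSeries_succ]
    refine (enorm_opH_le ht n x y).trans ?_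
    rw [pow_succ', mul_assoc]
    gcongr
    simp only [absDuhamel, absOp]
    rw [mul_left_comm]
    gcongr
    rw [Finset.mul_sum]
    refine Finset.sum_le_sum fun π _ => ?_
    rw [← lintegral_const_mul' _ _ (by simp)]
    refine lintegral_mono fun s => ?_
    simp only
    rw [mul_left_comm]
    gcongr
    by_cases hs : s ∈ Set.Ioo 0 T
    · exact ih _ _ _ hs
    · rw [cutSeries_of_notMem hs]; simp

end Series

end StratonovichSPDE

namespace StratonovichSPDE

/-! ### Numerical bounds -/

section Constants

/-- With `n = m + 2k` the left side equals `n!` times the binomial coefficient `n` over `m` times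
the central binomial coefficient of `k` divided by `4^k`. The first coefficient is at most `2ⁿ`, and
the quotient at most `1`. -/
lemma factorial_mul_huMeyerCoef_sq_le (m k : ℕ) :
    (m ! : ℝ) * huMeyerCoef m k ^ 2 ≤ 2 ^ (m + 2 * k) * ((m + 2 * k)! : ℝ) := by
  have h1 : ((m + 2 * k)! : ℝ) = ((m + 2 * k).choose m : ℝ) * m ! * (2 * k)! := by
    have := Nat.add_choose_mul_factorial_mul_factorial m (2 * k)
    rw [Nat.choose_symm_add] at *
    exact_mod_cast this.symm
  have h2 : ((2 * k)! : ℝ) = (k.centralBinom : ℝ) * (k ! : ℝ) ^ 2 := by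
    have := Nat.add_choose_mul_factorial_mul_factorial k k
    rw [Nat.centralBinom, two_mul, sq, ← mul_assoc]
    exact_mod_cast this.symm
  have h3 : ((m + 2 * k).choose m : ℝ) ≤ 2 ^ (m + 2 * k) := by
    exact_mod_cast Nat.choose_le_two_pow _ _
  have h4 : (k.centralBinom : ℝ) ≤ 4 ^ k := by
    have : k.centralBinom ≤ 2 ^ (2 * k) := Nat.choose_le_two_pow _ _
    rw [pow_mul] at this
    exact_mod_cast this
  have hm : (0 : ℝ) < m ! := by positivity
  have hk : (0 : ℝ) < k ! := by positivity
  have h5 : (m ! : ℝ) * huMeyerCoef m k ^ 2 = ((m + 2 * k).choose m : ℝ) *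
      ((k.centralBinom : ℝ) / 4 ^ k) * ((m + 2 * k)! : ℝ) := by
    have h6 : huMeyerCoef m k ^ 2 = ((m + 2 * k)! : ℝ) * ((m + 2 * k)! : ℝ) /
        ((m ! : ℝ) ^ 2 * (k ! : ℝ) ^ 2 * 4 ^ k) := by
      rw [huMeyerCoef, div_pow, mul_pow, mul_pow, ← pow_mul, mul_comm k 2, pow_mul, sq]
      norm_num
    rw [h6]
    nth_rw 1 [h1]
    rw [h2]
    field_simp
  rw [h5]
  gcongr
  calc ((m + 2 * k).choose m : ℝ) * ((k.centralBinom : ℝ) / 4 ^ k) ≤ 2 ^ (m + 2 * k) * 1 := by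
        gcongr
        rw [div_le_one (by positivity)]; exact h4
    _ = _ := mul_one _

lemma exists_pow_self_le {x : ℕ → ℝ} (hx : ∀ n, 0 ≤ x n) (hlim : Tendsto x atTop (𝓝 0)) :
    ∃ R : ℝ, 0 ≤ R ∧ ∀ n, x n ^ n ≤ R := by
  obtain ⟨N, hN⟩ := eventually_atTop.1 (hlim.eventually_le_const zero_lt_one)
  refine ⟨1 + ∑ n ∈ Finset.range N, x n ^ n, ?_, fun n => ?_⟩
  · have : 0 ≤ ∑ n ∈ Finset.range N, x n ^ n := Finset.sum_nonneg fun n _ => pow_nonneg (hx n) n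
    linarith
  · by_cases hn : n < N
    · have := Finset.single_le_sum (f := fun n => x n ^ n) (fun n _ => pow_nonneg (hx n) n)
        (Finset.mem_range.2 hn)
      linarith
    · have h1 : x n ^ n ≤ 1 := pow_le_one₀ (hx n) (hN n (by omega))
      have : 0 ≤ ∑ n ∈ Finset.range N, x n ^ n := Finset.sum_nonneg fun n _ => pow_nonneg (hx n) n
      linarith

/-- One factor `(n+1)^{-n}` absorbs `n!`. The remaining `(n+1)^{-βn}` is the `n`th power of a null
sequence and so dominates all geometric factors, with `16ⁿ` to spare. -/
lemma exists_bound_factorial_mul_pow (c Γ T C β : ℝ) (hΓ : 0 ≤ Γ)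
    (hβ : 0 < β) : ∃ R : ℝ, 0 ≤ R ∧ ∀ n : ℕ, 2 ^ n * (n ! : ℝ) * (c ^ n) ^ 2 *
      Real.exp ((n + 1) * T) ^ 2 * C ^ 2 *
        (C * (1 / (n + 1)) * (C * ((1 / (n + 1)) ^ β * Γ))) ^ n ≤ R * (1 / 16) ^ n := by
  obtain ⟨R, hR0, hR⟩ := exists_pow_self_le
    (x := fun n : ℕ => 16 * (2 * c ^ 2 * Real.exp T ^ 2 * C ^ 2 * Γ) * (1 / ((n : ℝ) + 1)) ^ β)
    (fun n => by positivity) (by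
      have h1 : Tendsto (fun n : ℕ => (1 / ((n : ℝ) + 1)) ^ β) atTop (𝓝 0) := by
        have := tendsto_one_div_add_atTop_nhds_zero_nat.rpow_const (p := β) (Or.inr hβ.le)
        rwa [Real.zero_rpow hβ.ne'] at this
      simpa using h1.const_mul (16 * (2 * c ^ 2 * Real.exp T ^ 2 * C ^ 2 * Γ)))
  refine ⟨Real.exp T ^ 2 * C ^ 2 * R, by positivity, fun n => ?_⟩
  have h1 : (n ! : ℝ) * (1 / ((n : ℝ) + 1)) ^ n ≤ 1 := by
    have : (n ! : ℝ) ≤ ((n : ℝ) + 1) ^ n := by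
      have h : n ! ≤ (n + 1) ^ n :=
        (Nat.factorial_le_pow n).trans (Nat.pow_le_pow_left (Nat.le_succ n) n)
      exact_mod_cast h
    rw [one_div, inv_pow, ← div_eq_mul_inv, div_le_one (by positivity)]
    exact this
  have h2 : Real.exp ((n + 1) * T) ^ 2 = Real.exp T ^ 2 * (Real.exp T ^ 2) ^ n := by
    rw [show ((n : ℝ) + 1) * T = T + n * T by ring, Real.exp_add, Real.exp_nat_mul]
    ring
  have h3 := hR n
  rw [h2]
  calc _ = Real.exp T ^ 2 * C ^ 2 * ((n ! : ℝ) * (1 / ((n : ℝ) + 1)) ^ n) *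
        ((16 * (2 * c ^ 2 * Real.exp T ^ 2 * C ^ 2 * Γ) * (1 / ((n : ℝ) + 1)) ^ β) ^ n) *
          (1 / 16) ^ n := by
        simp only [mul_pow, one_div, inv_pow]
        have h16 : (16 : ℝ) ^ n ≠ 0 := by positivity
        field_simp
        ring
    _ ≤ Real.exp T ^ 2 * C ^ 2 * 1 * R * (1 / 16) ^ n := by gcongr
    _ = _ := by ring

end Constants

/-! ### Consequences of the bounds on the Green's function -/

section GreenBounds

variable {d : ℕ} {T 𝔪 : ℝ} {G : ℝ → Space d → Space d → ℝ}

lemma measurable_cutPow (C : ℝ≥0) (α T : ℝ) : Measurable fun t : ℝ =>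
    (Set.Ioo 0 T).indicator (fun t => ENNReal.ofReal (C * t ^ (-α))) t := by
  refine Measurable.indicator ?_ measurableSet_Ioo
  fun_prop

lemma IsGreen.exists_kernelBound (hG : IsGreen 𝔪 T G) : ∃ C : ℝ≥0,
    KernelBound (fun t x y => ‖cutGreen T G t x y‖ₑ)
      (fun t => (Set.Ioo 0 T).indicator (fun _ => (C : ℝ≥0∞)) t)
      (fun t => (Set.Ioo 0 T).indicator
        (fun t => ENNReal.ofReal (C * t ^ (-((d : ℝ) / 𝔪)))) t) := by
  obtain ⟨C, hC⟩ := hG.bounds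
  refine ⟨C, (measurable_cutGreen hG).enorm, measurable_const.indicator measurableSet_Ioo,
    measurable_cutPow _ _ _, ?_, ?_, ?_⟩
  · intro t y
    by_cases ht : t ∈ Set.Ioo 0 T
    · simpa only [cutGreen_of_mem ht, Set.indicator_of_mem ht] using (hC t ht y).1
    · simp [cutGreen_of_notMem ht]
  · intro t x
    by_cases ht : t ∈ Set.Ioo 0 T
    · simpa only [cutGreen_of_mem ht, Set.indicator_of_mem ht, hG.symm t ht x] using (hC t ht x).1
    · simp [cutGreen_of_notMem ht]
  · intro t x y
    by_cases ht : t ∈ Set.Ioo 0 T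
    · simp only [cutGreen_of_mem ht, Set.indicator_of_mem ht]
      rw [← ofReal_norm]
      refine ENNReal.ofReal_le_ofReal ?_
      have h := (hC t ht y).2.2 x
      have hp : 0 < t ^ ((d : ℝ) / 𝔪) := Real.rpow_pos_of_pos ht.1 _
      rw [Real.rpow_neg ht.1.le, ← div_eq_mul_inv, le_div_iff₀ hp, mul_comm]
      exact h
    · simp [cutGreen_of_notMem ht]

lemma lintegral_rpow_mul_exp {α lam : ℝ} (hα : α < 1) (hlam : 0 < lam) :
    ∫⁻ r in Set.Ioi (0 : ℝ), ENNReal.ofReal (r ^ (-α) * Real.exp (-(lam * r))) =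
      ENNReal.ofReal ((1 / lam) ^ (1 - α) * Real.Gamma (1 - α)) := by
  have h := Real.integral_rpow_mul_exp_neg_mul_Ioi (a := 1 - α) (r := lam) (by linarith) hlam
  rw [show 1 - α - 1 = -α by ring] at h
  have hpos : 0 < (1 / lam) ^ (1 - α) * Real.Gamma (1 - α) :=
    mul_pos (Real.rpow_pos_of_pos (by positivity) _) (Real.Gamma_pos_of_pos (by linarith))
  rw [← h, ofReal_integral_eq_lintegral_ofReal]
  · by_contra hcon
    rw [integral_undef hcon] at h
    linarith
  · filter_upwards [ae_restrict_mem measurableSet_Ioi] with r hr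
    have := Real.rpow_nonneg (le_of_lt hr) (-α)
    positivity

/-- After substituting `r = t - s`, the integral is at most `e^{λt}` times the Laplace transform of
`C r^{-α}` at `λ`, which is small for large `λ`. -/
lemma lintegral_cutPow_conv_exp_le (C : ℝ≥0) {α lam : ℝ} (T : ℝ) (hα : α < 1) (hlam : 0 < lam)
    (t : ℝ) :
    ∫⁻ s, (Set.Ioo 0 T).indicator (fun t => ENNReal.ofReal (C * t ^ (-α))) (t - s) *
      ENNReal.ofReal (Real.exp (lam * s)) ≤
      ENNReal.ofReal (C * ((1 / lam) ^ (1 - α) * Real.Gamma (1 - α))) *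
        ENNReal.ofReal (Real.exp (lam * t)) := by
  have h1 := lintegral_sub_left_eq_self (μ := (volume : Measure ℝ)) (fun r =>
    (Set.Ioo 0 T).indicator (fun t => ENNReal.ofReal (C * t ^ (-α))) r *
      ENNReal.ofReal (Real.exp (lam * (t - r)))) t
  simp only [sub_sub_cancel] at h1
  rw [h1]
  calc _ ≤ ∫⁻ r, (Set.Ioi (0 : ℝ)).indicator (fun r => ENNReal.ofReal (C * Real.exp (lam * t)) *
        ENNReal.ofReal (r ^ (-α) * Real.exp (-(lam * r)))) r := by
        refine lintegral_mono fun r => ?_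
        simp only
        by_cases hr : r ∈ Set.Ioo 0 T
        · rw [Set.indicator_of_mem hr, Set.indicator_of_mem (show r ∈ Set.Ioi 0 from hr.1),
            ← ENNReal.ofReal_mul (by have := Real.rpow_nonneg hr.1.le (-α); positivity),
            ← ENNReal.ofReal_mul (by positivity),
            show lam * (t - r) = lam * t + -(lam * r) by ring, Real.exp_add]
          exact le_of_eq (by congr 1; ring)
        · rw [Set.indicator_of_notMem hr, zero_mul]; exact zero_le
    _ = ENNReal.ofReal (C * Real.exp (lam * t)) *
          ENNReal.ofReal ((1 / lam) ^ (1 - α) * Real.Gamma (1 - α)) := by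
        rw [lintegral_indicator measurableSet_Ioi, lintegral_const_mul' _ _ ENNReal.ofReal_ne_top,
          lintegral_rpow_mul_exp hα hlam]
    _ = _ := by
        have hpos : 0 < (1 / lam) ^ (1 - α) * Real.Gamma (1 - α) :=
          mul_pos (Real.rpow_pos_of_pos (by positivity) _) (Real.Gamma_pos_of_pos (by linarith))
        rw [← ENNReal.ofReal_mul (by positivity), ← ENNReal.ofReal_mul (by positivity)]
        congr 1; ring

lemma lintegral_cutConst_conv_exp_le (C : ℝ≥0) {lam : ℝ} (T : ℝ) (hlam : 0 < lam) (t : ℝ) :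
    ∫⁻ s, (Set.Ioo 0 T).indicator (fun _ => (C : ℝ≥0∞)) (t - s) *
      ENNReal.ofReal (Real.exp (lam * s)) ≤
      ENNReal.ofReal (C * (1 / lam)) * ENNReal.ofReal (Real.exp (lam * t)) := by
  have h := lintegral_cutPow_conv_exp_le C (α := 0) T zero_lt_one hlam t
  simpa using h

/-- Schur test: Cauchy-Schwarz with respect to the kernel uses one marginal bound, Fubini the other.
-/
lemma lintegral_absFree_sq_le {C : ℝ≥0} {k₂ : ℝ → ℝ≥0∞}
    (hK : KernelBound (fun t x y => ‖cutGreen T G t x y‖ₑ)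
      (fun t => (Set.Ioo 0 T).indicator (fun _ => (C : ℝ≥0∞)) t) k₂)
    {u₀ : Space d → ℝ} (hu : Measurable u₀) (t : ℝ) :
    ∫⁻ x, absFree T G u₀ t x ^ 2 ≤ (Set.Ioo 0 T).indicator (fun _ =>
      (C : ℝ≥0∞) ^ 2 * eLpNorm u₀ 2 volume ^ 2) t := by
  by_cases ht : t ∈ Set.Ioo 0 T
  swap
  · simp [absFree, cutGreen_of_notMem ht]
  rw [Set.indicator_of_mem ht]
  have hm : Measurable fun p : Space d × Space d => ‖cutGreen T G t p.1 p.2‖ₑ :=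
    hK.meas.comp (measurable_const.prodMk measurable_id)
  have hmx : ∀ x, Measurable fun ξ => ‖cutGreen T G t x ξ‖ₑ := fun x =>
    hm.comp (measurable_const.prodMk measurable_id)
  have hmξ : ∀ ξ, Measurable fun x => ‖cutGreen T G t x ξ‖ₑ := fun x =>
    hm.comp (measurable_id.prodMk measurable_const)
  have h1 : ∀ x, absFree T G u₀ t x ^ 2 ≤ C * ∫⁻ ξ, ‖cutGreen T G t x ξ‖ₑ * ‖u₀ ξ‖ₑ ^ 2 := by
    intro x
    have hr := hK.right t x
    rw [Set.indicator_of_mem ht] at hr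
    refine le_trans ?_ (mul_le_mul_left hr _)
    refine sq_lintegral_le_of_sq_le (hmx x).aemeasurable
      ((hmx x).mul (hu.enorm.pow_const 2)).aemeasurable fun ξ => le_of_eq (by ring)
  calc ∫⁻ x, absFree T G u₀ t x ^ 2 ≤ ∫⁻ x, C * ∫⁻ ξ, ‖cutGreen T G t x ξ‖ₑ * ‖u₀ ξ‖ₑ ^ 2 :=
        lintegral_mono h1
    _ = C * ∫⁻ x, ∫⁻ ξ, ‖cutGreen T G t x ξ‖ₑ * ‖u₀ ξ‖ₑ ^ 2 :=
        lintegral_const_mul' _ _ ENNReal.coe_ne_top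
    _ = C * ∫⁻ ξ, ∫⁻ x, ‖cutGreen T G t x ξ‖ₑ * ‖u₀ ξ‖ₑ ^ 2 := by
        rw [lintegral_lintegral_swap]
        exact (hm.mul ((hu.comp measurable_snd).enorm.pow_const 2)).aemeasurable
    _ ≤ C * ∫⁻ ξ, C * ‖u₀ ξ‖ₑ ^ 2 := by
        gcongr with ξ
        rw [lintegral_mul_const _ (hmξ ξ)]
        have hl := hK.left t ξ
        rw [Set.indicator_of_mem ht] at hl
        gcongr
    _ = _ := by
        rw [lintegral_const_mul' _ _ ENNReal.coe_ne_top, eLpNorm_two_sq]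
        ring

/-- The basic estimate: the traces of the Duhamel coefficients decay geometrically. -/
lemma IsGreen.exists_trace_bound (hG : IsGreen 𝔪 T G) (hd : (d : ℝ) / 𝔪 < 1) (σ : ℝ) :
    ∃ R : ℝ≥0, ∀ u₀ : Space d → ℝ, Measurable u₀ → ∀ m k : ℕ, ∀ t ∈ Set.Ioo 0 T,
      (m ! : ℝ≥0∞) * ENNReal.ofReal (huMeyerCoef m k) ^ 2 *
        ∫⁻ x, traceSq (fun n => duhamelSeries σ G u₀ n t x) m k ≤
        R * eLpNorm u₀ 2 volume ^ 2 * (1 / 16) ^ (m + 2 * k) := by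
  obtain ⟨C, hK⟩ := hG.exists_kernelBound
  set α := (d : ℝ) / 𝔪
  have hΓ : 0 < Real.Gamma (1 - α) := Real.Gamma_pos_of_pos (by linarith)
  obtain ⟨R, hR0, hR⟩ := exists_bound_factorial_mul_pow |σ| (Real.Gamma (1 - α)) T C (1 - α)
    hΓ.le (by linarith)
  refine ⟨R.toNNReal, fun u₀ hu m k t ht => ?_⟩
  set n := m + 2 * k with hn
  -- The rate grows with the order: `a * b` becomes of order `(n+1)^{-(2-α)}`, while the price
  -- `e^{2λT}` is only geometric in `n`. The shift by one keeps the rate positive for `n = 0`.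
  set lam : ℝ := n + 1 with hlamdef
  have hlam : 0 < lam := by positivity
  set E : ℝ → ℝ≥0∞ := fun t => ENNReal.ofReal (Real.exp (lam * t)) with hE
  have hEm : Measurable E := by fun_prop
  have hE1 : ∀ t ∈ Set.Ioo 0 T, 1 ≤ E t := by
    intro t ht
    rw [hE]
    simp only
    rw [ENNReal.one_le_ofReal]
    exact Real.one_le_exp (mul_nonneg hlam.le ht.1.le)
  -- The auxiliary weight `w₁` is the indicator of `(0,T)`: the initial term vanishes outside, so
  -- `h² ≤ h² w₁`, and `w₁ ≤ E` because the exponential is at least `1` there.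
  have hb := lintegral_traceSq_le (E := E) (a := ENNReal.ofReal (C * (1 / lam)))
    (b := ENNReal.ofReal (C * ((1 / lam) ^ (1 - α) * Real.Gamma (1 - α))))
    (w₁ := fun t _ => (Set.Ioo 0 T).indicator 1 t) (A := (C : ℝ≥0∞) ^ 2 * eLpNorm u₀ 2 volume ^ 2)
    hK (measurable_absFree hG hu)
    ((measurable_one.indicator measurableSet_Ioo).comp measurable_fst) hEm
    (fun t => lintegral_cutConst_conv_exp_le C T hlam t)
    (fun t => lintegral_cutPow_conv_exp_le C T hd hlam t)
    (fun s => ?_) (fun s x => ?_) (fun s x => ?_) (t := t)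
    (F := fun x n => duhamelSeries σ G u₀ n t x) (τ := ‖σ‖ₑ ^ n) (m := m) (k := k) (fun x y => ?_)
  · calc (m ! : ℝ≥0∞) * ENNReal.ofReal (huMeyerCoef m k) ^ 2 *
        ∫⁻ x, traceSq (fun n => duhamelSeries σ G u₀ n t x) m k
        ≤ ENNReal.ofReal (2 ^ n * (n ! : ℝ)) * ((‖σ‖ₑ ^ n) ^ 2 *
          (ENNReal.ofReal (Real.exp (lam * T)) ^ 2 *
            ((C : ℝ≥0∞) ^ 2 * eLpNorm u₀ 2 volume ^ 2) * (ENNReal.ofReal (C * (1 / lam)) *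
          ENNReal.ofReal (C * ((1 / lam) ^ (1 - α) * Real.Gamma (1 - α)))) ^ n)) := by
          refine mul_le_mul' ?_ (hb.trans ?_)
          · rw [← ENNReal.ofReal_pow (huMeyerCoef_pos m k).le, ← ENNReal.ofReal_natCast,
              ← ENNReal.ofReal_mul (by positivity)]
            exact ENNReal.ofReal_le_ofReal (factorial_mul_huMeyerCoef_sq_le m k)
          · have : E t ≤ ENNReal.ofReal (Real.exp (lam * T)) :=
              ENNReal.ofReal_le_ofReal (Real.exp_le_exp.2
                (mul_le_mul_of_nonneg_left ht.2.le hlam.le))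
            gcongr
      _ = eLpNorm u₀ 2 volume ^ 2 * ENNReal.ofReal (2 ^ n * (n ! : ℝ) * (|σ| ^ n) ^ 2 *
            Real.exp (lam * T) ^ 2 * C ^ 2 *
            (C * (1 / lam) * (C * ((1 / lam) ^ (1 - α) * Real.Gamma (1 - α)))) ^ n) := by
          have hp : 0 ≤ (1 / lam) ^ (1 - α) := Real.rpow_nonneg (by positivity) _
          rw [← ofReal_norm, Real.norm_eq_abs, ← ENNReal.ofReal_pow (abs_nonneg σ),
            ← ENNReal.ofReal_pow (by positivity), ← ENNReal.ofReal_pow (by positivity),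
            ← ENNReal.ofReal_coe_nnreal, ← ENNReal.ofReal_pow (by positivity),
            ← ENNReal.ofReal_mul (by positivity), ← ENNReal.ofReal_pow (by positivity),
            ENNReal.ofReal_mul (q := (C * (1 / lam) * (C * ((1 / lam) ^ (1 - α) *
              Real.Gamma (1 - α)))) ^ n) (by positivity),
            ENNReal.ofReal_mul (q := (C : ℝ) ^ 2) (by positivity),
            ENNReal.ofReal_mul (q := Real.exp (lam * T) ^ 2) (by positivity),
            ENNReal.ofReal_mul (q := (|σ| ^ n) ^ 2) (by positivity)]
          ring
      _ ≤ eLpNorm u₀ 2 volume ^ 2 * ENNReal.ofReal (R * (1 / 16) ^ n) := by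
          exact mul_le_mul_right (ENNReal.ofReal_le_ofReal (hR n)) _
      _ = _ := by
          rw [ENNReal.ofReal_mul hR0, ENNReal.ofReal_pow (by positivity),
            ENNReal.ofReal_div_of_pos (by norm_num), ENNReal.ofReal_one, ENNReal.ofReal_ofNat,
            ENNReal.ofReal]
          ring
  · refine (lintegral_absFree_sq_le hK hu s).trans ?_
    by_cases hs : s ∈ Set.Ioo 0 T
    · rw [Set.indicator_of_mem hs]
      exact le_mul_of_one_le_left zero_le (hE1 s hs)
    · rw [Set.indicator_of_notMem hs]; exact zero_le
  · by_cases hs : s ∈ Set.Ioo 0 T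
    · rw [Set.indicator_of_mem hs]; exact hE1 s hs
    · rw [Set.indicator_of_notMem hs]; exact zero_le
  · by_cases hs : s ∈ Set.Ioo 0 T
    · rw [Set.indicator_of_mem hs]; simp
    · simp [absFree, cutGreen_of_notMem hs]
  · have := enorm_cutSeries_duhamelSeries_le (σ := σ) (T := T) (G := G) u₀ (m + 2 * k) t x y
    rwa [cutSeries_of_mem ht] at this

/-! ### Pointwise bounds -/

lemma absDuhamel_le_of_conv {K : ℝ → Space d → Space d → ℝ≥0∞} {k₁ k₂ : ℝ → ℝ≥0∞}
    {w : ℝ → Space d → ℝ≥0∞} (hK : KernelBound K k₁ k₂) {E : ℝ → ℝ≥0∞} (hE : Measurable E)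
    {b : ℝ≥0∞} (hb : ∀ t, ∫⁻ s, k₂ (t - s) * E s ≤ b * E t) (hw : ∀ t x, w t x ≤ E t) (n : ℕ)
    (t : ℝ) (x : Space d) (y : Fin n → Space d) : absDuhamel K w n t x y ≤ E t * b ^ n := by
  induction n generalizing t x with
  | zero => simpa [absDuhamel] using hw t x
  | succ n ih =>
    refine average_perm_le fun π => ?_
    rw [pow_succ']
    refine le_trans ?_ (lintegral_conv_mul_le hE hK.meas₂ hb _ t)
    exact lintegral_mono fun s => mul_le_mul' (hK.sup _ _ _) (ih s _ _)

/-- One of `s` and `t - s` is at least `t / 2`; the power of that one is bounded by `(t / 2)^{-α}`.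
-/
lemma rpow_neg_mul_rpow_neg_le {α t s : ℝ} (hα : 0 ≤ α) (hs : s ∈ Set.Ioo 0 t) :
    (t - s) ^ (-α) * s ^ (-α) ≤ (t / 2) ^ (-α) * ((t - s) ^ (-α) + s ^ (-α)) := by
  have ht : 0 < t := hs.1.trans hs.2
  have h1 : 0 ≤ (t - s) ^ (-α) := Real.rpow_nonneg (by linarith [hs.2]) _
  have h2 : 0 ≤ s ^ (-α) := Real.rpow_nonneg hs.1.le _
  have h3 : 0 ≤ (t / 2) ^ (-α) := Real.rpow_nonneg (by linarith) _
  rcases le_total s (t / 2) with h | h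
  · have h4 : (t - s) ^ (-α) ≤ (t / 2) ^ (-α) :=
      Real.rpow_le_rpow_of_nonpos (by linarith) (by linarith) (by linarith)
    nlinarith
  · have h4 : s ^ (-α) ≤ (t / 2) ^ (-α) :=
      Real.rpow_le_rpow_of_nonpos (by linarith) (by linarith) (by linarith)
    nlinarith

/-- Since `t^{-α}` is integrable at the origin, convolution reproduces it up to a constant. It
therefore serves as the weight for pointwise bounds. -/
lemma exists_conv_cutPow_le (C : ℝ≥0) {α T : ℝ} (hα : 0 ≤ α) (hα1 : α < 1) (hT : 0 < T) :
    ∃ b : ℝ≥0, ∀ t ∈ Set.Ioo 0 T,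
      ∫⁻ s, (Set.Ioo 0 T).indicator (fun t => ENNReal.ofReal (C * t ^ (-α))) (t - s) *
        (Set.Ioo 0 T).indicator (fun t => ENNReal.ofReal (t ^ (-α))) s ≤
        b * ENNReal.ofReal (t ^ (-α)) := by
  set g : ℝ → ℝ≥0∞ := fun t => (Set.Ioo 0 T).indicator (fun t => ENNReal.ofReal (t ^ (-α))) t with hg
  have hgm : Measurable g := by
    refine Measurable.indicator ?_ measurableSet_Ioo
    fun_prop
  set M := ∫⁻ s, g s with hM
  have hMt : M ≠ ∞ := by
    have hint : IntegrableOn (fun x : ℝ => x ^ (-α)) (Set.Ioo 0 T) :=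
      (intervalIntegral.integrableOn_Ioo_rpow_iff hT).2 (by linarith)
    rw [hM, hg, lintegral_indicator measurableSet_Ioo]
    exact hint.lintegral_lt_top.ne
  refine ⟨C * ((2 : ℝ) ^ α).toNNReal * (2 * M.toNNReal), fun t ht => ?_⟩
  calc _ ≤ ∫⁻ s, ENNReal.ofReal (C * (t / 2) ^ (-α)) * (g (t - s) + g s) := by
        refine lintegral_mono fun s => ?_
        simp only [hg]
        by_cases hs : s ∈ Set.Ioo 0 t
        · have h1 : t - s ∈ Set.Ioo 0 T := ⟨by linarith [hs.2], by linarith [hs.1, ht.2]⟩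
          have h2 : s ∈ Set.Ioo 0 T := ⟨hs.1, hs.2.trans ht.2⟩
          have p1 : 0 ≤ (t - s) ^ (-α) := Real.rpow_nonneg h1.1.le _
          have p2 : 0 ≤ s ^ (-α) := Real.rpow_nonneg hs.1.le _
          have p3 : 0 ≤ (t / 2) ^ (-α) := Real.rpow_nonneg (by linarith [ht.1]) _
          rw [Set.indicator_of_mem h1, Set.indicator_of_mem h1, Set.indicator_of_mem h2,
            ← ENNReal.ofReal_add p1 p2, ← ENNReal.ofReal_mul (by positivity),
            ← ENNReal.ofReal_mul (by positivity)]
          refine ENNReal.ofReal_le_ofReal ?_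
          rw [mul_assoc, mul_assoc]
          exact mul_le_mul_of_nonneg_left (rpow_neg_mul_rpow_neg_le hα hs) C.2
        · by_cases h0 : 0 < s
          · rw [Set.indicator_of_notMem (fun h : t - s ∈ Set.Ioo 0 T => hs ⟨h0, by linarith [h.1]⟩),
              zero_mul]
            exact zero_le
          · rw [Set.indicator_of_notMem (fun h : s ∈ Set.Ioo 0 T => h0 h.1), mul_zero]
            exact zero_le
    _ = ENNReal.ofReal (C * (t / 2) ^ (-α)) * (2 * M) := by
        have hgm' : Measurable fun s => g (t - s) := hgm.comp (measurable_const.sub measurable_id)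
        rw [lintegral_const_mul' _ _ ENNReal.ofReal_ne_top, lintegral_add_left hgm',
          lintegral_sub_left_eq_self g t, two_mul]
    _ = _ := by
        rw [Real.div_rpow ht.1.le (by norm_num), Real.rpow_neg (by norm_num : (0 : ℝ) ≤ 2),
          div_inv_eq_mul, mul_comm (t ^ (-α)), ← mul_assoc,
          ENNReal.ofReal_mul (by positivity), ENNReal.ofReal_mul (by positivity)]
        simp only [ENNReal.coe_mul, ENNReal.coe_toNNReal hMt, ENNReal.ofReal_coe_nnreal,
          ENNReal.coe_ofNat]
        simp only [ENNReal.ofReal]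
        ring

/-- The Duhamel coefficients are bounded pointwise by a multiple of `t^{-α}`. -/
lemma IsGreen.exists_duhamelSeries_le (hG : IsGreen 𝔪 T G) (hd0 : 0 ≤ (d : ℝ) / 𝔪)
    (hd : (d : ℝ) / 𝔪 < 1) (hT : 0 < T) (σ : ℝ) {u₀ : Space d → ℝ}
    (hu1 : MemLp u₀ 1) (n : ℕ) :
    ∃ B : ℝ≥0, ∀ t x (y : Fin n → Space d), ‖cutSeries T (duhamelSeries σ G u₀) n t x y‖ₑ ≤
      B * (Set.Ioo 0 T).indicator (fun t => ENNReal.ofReal (t ^ (-((d : ℝ) / 𝔪)))) t := by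
  obtain ⟨C, hK⟩ := hG.exists_kernelBound
  set α := (d : ℝ) / 𝔪
  obtain ⟨b, hb⟩ := exists_conv_cutPow_le C hd0 hd hT
  set N : ℝ≥0 := C * (eLpNorm u₀ 1 volume).toNNReal with hN
  set g : ℝ → ℝ≥0∞ := fun t => (Set.Ioo 0 T).indicator (fun t => ENNReal.ofReal (t ^ (-α))) t with hg
  have hgm : Measurable g := by
    refine Measurable.indicator ?_ measurableSet_Ioo
    fun_prop
  -- The value `∞` from time `T` on makes the convolution inequality trivial there, although it is
  -- demanded at all times. The convolution only looks at earlier times, so the values before `T`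
  -- are unaffected.
  set E : ℝ → ℝ≥0∞ := fun t => N * g t + (Set.Ici T).indicator (fun _ => ∞) t with hE
  have hEm : Measurable E :=
    (hgm.const_mul _).add (measurable_const.indicator measurableSet_Ici)
  have hE1 : ∀ t < T, E t = N * g t := by
    intro t ht
    simp only [hE]
    rw [Set.indicator_of_notMem (by simpa using ht), add_zero]
  have hw : ∀ t x, absFree T G u₀ t x ≤ E t := by
    intro t x
    by_cases ht : t ∈ Set.Ioo 0 T
    swap
    · simp [absFree, cutGreen_of_notMem ht]
    rw [hE1 t ht.2]
    calc absFree T G u₀ t x ≤ ∫⁻ ξ, ENNReal.ofReal (C * t ^ (-α)) * ‖u₀ ξ‖ₑ := by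
          refine lintegral_mono fun ξ => mul_le_mul_left ?_ _
          have := hK.sup t x ξ
          rwa [Set.indicator_of_mem ht] at this
      _ = ENNReal.ofReal (C * t ^ (-α)) * eLpNorm u₀ 1 volume := by
          rw [lintegral_const_mul' _ _ ENNReal.ofReal_ne_top, eLpNorm_one_eq_lintegral_enorm]
      _ = N * g t := by
          simp only [hg, hN]
          rw [Set.indicator_of_mem ht, ENNReal.ofReal_mul (NNReal.coe_nonneg C), ENNReal.ofReal_coe_nnreal,
            ENNReal.coe_mul, ENNReal.coe_toNNReal hu1.2.ne]
          ring
  -- The constant `b + 1` is nonzero, so that its product with `∞` is `∞`.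
  have hconv : ∀ t, ∫⁻ s, (Set.Ioo 0 T).indicator (fun t => ENNReal.ofReal (C * t ^ (-α))) (t - s) *
      E s ≤ ((b + 1 : ℝ≥0) : ℝ≥0∞) * E t := by
    intro t
    rcases le_or_gt T t with hTt | hTt
    · have : E t = ∞ := by
        simp only [hE]
        rw [Set.indicator_of_mem (by exact hTt)]
        simp
      rw [this, ENNReal.mul_top (by simp)]
      exact le_top
    have h1 : ∀ s, (Set.Ioo 0 T).indicator (fun t => ENNReal.ofReal (C * t ^ (-α))) (t - s) *
        E s = N * ((Set.Ioo 0 T).indicator (fun t => ENNReal.ofReal (C * t ^ (-α))) (t - s) *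
          g s) := by
      intro s
      by_cases hs : s < T
      · rw [hE1 s hs]; ring
      · rw [Set.indicator_of_notMem (fun h : t - s ∈ Set.Ioo 0 T => by
          have := h.1; push Not at hs; linarith)]
        simp
    simp only [h1]
    rw [lintegral_const_mul' _ _ ENNReal.coe_ne_top, hE1 t hTt]
    by_cases ht : 0 < t
    · have h2 := hb t ⟨ht, hTt⟩
      calc _ ≤ (N : ℝ≥0∞) * (b * ENNReal.ofReal (t ^ (-α))) := by gcongr
        _ = b * (N * g t) := by
          simp only [hg]
          rw [Set.indicator_of_mem (show t ∈ Set.Ioo 0 T from ⟨ht, hTt⟩)]; ring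
        _ ≤ _ := by
          gcongr
          simp
    · have h3 : ∀ s, (Set.Ioo 0 T).indicator (fun t => ENNReal.ofReal (C * t ^ (-α))) (t - s) *
          g s = 0 := by
        intro s
        by_cases hs : 0 < s
        · rw [Set.indicator_of_notMem (fun h : t - s ∈ Set.Ioo 0 T => by
            have := h.1; push Not at ht; linarith), zero_mul]
        · simp only [hg]
          rw [Set.indicator_of_notMem (fun h : s ∈ Set.Ioo 0 T => hs h.1), mul_zero]
      simp only [h3]
      simp
  refine ⟨‖σ‖₊ ^ n * (N * (b + 1) ^ n), fun t x y => ?_⟩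
  by_cases ht : t ∈ Set.Ioo 0 T
  swap
  · rw [cutSeries_of_notMem ht]; simp
  refine (enorm_cutSeries_duhamelSeries_le u₀ n t x y).trans ?_
  have h := absDuhamel_le_of_conv hK hEm hconv hw n t x y
  rw [hE1 t ht.2] at h
  calc _ ≤ ‖σ‖ₑ ^ n * (N * g t * ((b + 1 : ℝ≥0) : ℝ≥0∞) ^ n) := by gcongr
    _ = _ := by
      push_cast
      rw [enorm_eq_nnnorm]
      ring

end GreenBounds

end StratonovichSPDE

namespace StratonovichSPDE

/-! ### Identities almost everywhere on diagonals, and additivity of 𝓗 -/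

section TraceAE

variable {d : ℕ} {σ T 𝔪 : ℝ} {G : ℝ → Space d → Space d → ℝ} {f : StratSeries d}

/-- A property holds almost everywhere for all identifications of at most two coordinates. -/
def TraceAE (N : ℕ) (Q : (Fin N → Space d) → Prop) : Prop :=
  ∀ (V : Type) [Fintype V] [DecidableEq V] (κ : Fin N → V),
    (∀ v, (Finset.univ.filter fun i => κ i = v).card ≤ 2) → ∀ᵐ z : V → Space d, Q (fun i => z (κ i))

lemma DiagonalAE.traceAE {N : ℕ} {Q : (Fin N → Space d) → Prop} (h : DiagonalAE N Q) :
    TraceAE N Q := fun _ _ _ κ hκ => h.ae_comp κ hκ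

lemma card_fibre_comp_le {M N : ℕ} {V : Type} [DecidableEq V] {κ : Fin N → V} {e : Fin M → Fin N}
    (he : Function.Injective e) (hκ : ∀ v, (Finset.univ.filter fun i => κ i = v).card ≤ 2) (v : V) :
    (Finset.univ.filter fun i => κ (e i) = v).card ≤ 2 := by
  refine (Finset.card_le_card_of_injOn e (fun i hi => ?_) he.injOn).trans (hκ v)
  simpa using hi

/-- Additivity of `opH`, almost everywhere on the diagonals. -/
lemma traceAE_opH_add {g a b : StratSeries d} (hg : MeasurableSeries T g)
    (ha : MeasurableSeries T a) (hb : MeasurableSeries T b) {n : ℕ}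
    (h : ∀ s ∈ Set.Ioo 0 T, TraceAE (n + 1) (fun w : Fin (n + 1) → Space d =>
      g n s (w 0) (fun i => w i.succ) = a n s (w 0) (fun i => w i.succ) +
        b n s (w 0) (fun i => w i.succ)))
    {t : ℝ} (ht : t ∈ Set.Ioo 0 T)
    (hai : TraceAE (n + 2) (fun w : Fin (n + 2) → Space d =>
      IntervalIntegrable (fun s => G (t - s) (w 0) (w 1) * a n s (w 1) (fun i => w i.succ.succ))
        volume 0 t))
    (hbi : TraceAE (n + 2) (fun w : Fin (n + 2) → Space d =>
      IntervalIntegrable (fun s => G (t - s) (w 0) (w 1) * b n s (w 1) (fun i => w i.succ.succ))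
        volume 0 t)) :
    TraceAE (n + 2) (fun w : Fin (n + 2) → Space d =>
      opH σ G g (n + 1) t (w 0) (fun i => w i.succ) =
        opH σ G a (n + 1) t (w 0) (fun i => w i.succ) +
          opH σ G b (n + 1) t (w 0) (fun i => w i.succ)) := by
  intro V _ _ κ hκ
  -- Each permutation in the symmetrization only relabels the identified coordinates, so the
  -- hypotheses apply to every summand.
  have hinj : ∀ π : Equiv.Perm (Fin (n + 1)), Function.Injective
      (Fin.cons 0 (fun j => (π j).succ) : Fin (n + 2) → Fin (n + 2)) := by
    intro π
    rw [Fin.cons_injective_iff]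
    refine ⟨fun ⟨j, hj⟩ => Fin.succ_ne_zero _ hj, fun i j hij => ?_⟩
    exact π.injective (Fin.succ_injective _ hij)
  have hinj' : ∀ π : Equiv.Perm (Fin (n + 1)), Function.Injective fun j => (π j).succ := fun π i j hij =>
    π.injective (Fin.succ_injective _ hij)
  -- The hypothesis has an exceptional set of points for each time. Fubini exchanges the
  -- quantifiers: for almost every point the identity holds at almost every time, which suffices
  -- inside the time integral.
  have h1 : ∀ π : Equiv.Perm (Fin (n + 1)), ∀ᵐ z : V → Space d, ∀ᵐ s : ℝ,
      cutSeries T g n s (z (κ (π 0).succ)) (fun i => z (κ (π i.succ).succ)) =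
      cutSeries T a n s (z (κ (π 0).succ)) (fun i => z (κ (π i.succ).succ)) +
      cutSeries T b n s (z (κ (π 0).succ)) (fun i => z (κ (π i.succ).succ)) := by
    intro π
    have hm : ∀ {u : StratSeries d}, MeasurableSeries T u → Measurable fun q : ℝ × (V → Space d) =>
        cutSeries T u n q.1 (q.2 (κ (π 0).succ)) (fun i => q.2 (κ (π i.succ).succ)) := by
      intro u hu
      have hc : ∀ v, Measurable fun q : ℝ × (V → Space d) => q.2 v := fun v =>
        (measurable_pi_apply v).comp measurable_snd
      exact (hu n).comp (measurable_fst.prodMk ((hc _).prodMk (measurable_pi_iff.2 fun i => hc _)))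
    rw [← Measure.ae_ae_comm (p := fun (s : ℝ) (z : V → Space d) =>
      cutSeries T g n s (z (κ (π 0).succ)) (fun i => z (κ (π i.succ).succ)) =
      cutSeries T a n s (z (κ (π 0).succ)) (fun i => z (κ (π i.succ).succ)) +
      cutSeries T b n s (z (κ (π 0).succ)) (fun i => z (κ (π i.succ).succ)))
      (measurableSet_eq_fun (hm hg) ((hm ha).add (hm hb)))]
    refine ae_of_all _ fun s => ?_
    by_cases hs : s ∈ Set.Ioo 0 T
    · simp only [cutSeries_of_mem hs]
      exact h s hs V (fun j => κ (π j).succ) (card_fibre_comp_le (hinj' π) hκ)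
    · exact ae_of_all _ fun z => by simp only [cutSeries_of_notMem hs, add_zero]
  have h2 := fun π : Equiv.Perm (Fin (n + 1)) =>
    hai V (fun i => κ ((Fin.cons 0 (fun j => (π j).succ) : Fin (n + 2) → Fin (n + 2)) i))
      (card_fibre_comp_le (hinj π) hκ)
  have h3 := fun π : Equiv.Perm (Fin (n + 1)) =>
    hbi V (fun i => κ ((Fin.cons 0 (fun j => (π j).succ) : Fin (n + 2) → Fin (n + 2)) i))
      (card_fibre_comp_le (hinj π) hκ)
  filter_upwards [ae_all_iff.2 h1, ae_all_iff.2 h2, ae_all_iff.2 h3] with z k1 k2 k3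
  simp only [opH]
  rw [← mul_add, ← mul_add, ← Finset.sum_add_distrib]
  congr 2
  refine Finset.sum_congr rfl fun π _ => ?_
  have i2 := k2 π
  have i3 := k3 π
  simp only [Fin.cons_zero, Fin.cons_succ, ← Fin.succ_zero_eq_one] at i2 i3
  rw [← intervalIntegral.integral_add i2 i3]
  refine intervalIntegral.integral_congr_ae ?_
  filter_upwards [k1 π] with s hs hst
  rw [Set.uIoc_of_le ht.1.le] at hst
  have hsT : s ∈ Set.Ioo 0 T := ⟨hst.1, hst.2.trans_lt ht.2⟩
  simp only [cutSeries_of_mem hsT] at hs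
  rw [hs, mul_add]

/-- A trace tuple preceded by `x` is one of the allowed identifications: `x` and the `y`-coordinates
occur once, the `z`-coordinates twice. -/
lemma TraceAE.ae_traceTuple {m k : ℕ} {Q : (Fin (m + 2 * k + 1) → Space d) → Prop}
    (hQ : TraceAE (m + 2 * k + 1) Q) : ∀ᵐ q : Space d × (Fin m → Space d), ∀ᵐ z : Fin k → Space d,
      Q (Fin.cons q.1 (traceTuple q.2 z) : Fin (m + 2 * k + 1) → Space d) := by
  let κ : Fin (m + 2 * k + 1) → Fin 1 ⊕ (Fin m ⊕ Fin k) :=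
    Fin.cons (Sum.inl 0) (fun i => Sum.inr (traceIdx m k i))
  have hκ : ∀ v, (Finset.univ.filter fun i => κ i = v).card ≤ 2 := by
    rintro (v | v | v)
    · have : (Finset.univ.filter fun i => κ i = Sum.inl v) ⊆ {0} := by
        intro i hi
        simp only [Finset.mem_filter, Finset.mem_univ, true_and] at hi
        refine Fin.cases (fun _ => by simp) (fun j hj => ?_) i hi
        simp [κ] at hj
      exact (Finset.card_le_card this).trans (by simp)
    · have h := card_traceIdx_inl m k v
      have : (Finset.univ.filter fun i => κ i = Sum.inr (Sum.inl v)) ⊆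
          (Finset.univ.filter fun i => traceIdx m k i = Sum.inl v).image Fin.succ := by
        intro i hi
        simp only [Finset.mem_filter, Finset.mem_univ, true_and] at hi
        refine Fin.cases (fun h => by simp [κ] at h) (fun j hj => ?_) i hi
        simp only [κ, Fin.cons_succ, Sum.inr.injEq] at hj
        simpa using hj
      refine (Finset.card_le_card this).trans (Finset.card_image_le.trans ?_)
      omega
    · have h := card_traceIdx_inr m k v
      have : (Finset.univ.filter fun i => κ i = Sum.inr (Sum.inr v)) ⊆
          (Finset.univ.filter fun i => traceIdx m k i = Sum.inr v).image Fin.succ := by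
        intro i hi
        simp only [Finset.mem_filter, Finset.mem_univ, true_and] at hi
        refine Fin.cases (fun h => by simp [κ] at h) (fun j hj => ?_) i hi
        simp only [κ, Fin.cons_succ, Sum.inr.injEq] at hj
        simpa using hj
      refine (Finset.card_le_card this).trans (Finset.card_image_le.trans ?_)
      omega
  have h1 := volume_measurePreserving_sumPiEquivProdPi_symm (fun _ : Fin m ⊕ Fin k => Space d)
  have h2 := volume_measurePreserving_sumPiEquivProdPi_symm
    (fun _ : Fin 1 ⊕ (Fin m ⊕ Fin k) => Space d)
  have h3 := (volume_preserving_funUnique (Fin 1) (Space d)).symm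
  have h4 : MeasurePreserving (fun q : (Space d × (Fin m → Space d)) × (Fin k → Space d) =>
      (q.1.1, (q.1.2, q.2))) := measurePreserving_prodAssoc volume volume volume
  have h5 := (h2.comp (h3.prod h1)).comp h4
  have h6 := h5.quasiMeasurePreserving.ae (hQ _ κ hκ)
  have h7 := Measure.ae_ae_of_ae_prod h6
  filter_upwards [h7] with q hq
  filter_upwards [hq] with z hz
  refine Eq.mp ?_ hz
  congr 1
  funext i
  refine Fin.cases ?_ (fun j => ?_) i
  · rfl
  · simp only [Fin.cons_succ, traceTuple_eq, κ]
    rcases traceIdx m k j with c | c <;> rfl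

/-! ### Well-definedness of the Duhamel series -/

/-- Kernel and coefficient are bounded by `(t - s)^{-α}` and `s^{-α}` up to constants. The bounds
hold at every point, hence on all diagonals. -/
lemma IsGreen.intervalIntegrable_duhamelSeries (hG : IsGreen 𝔪 T G) (hd0 : 0 ≤ (d : ℝ) / 𝔪)
    (hd : (d : ℝ) / 𝔪 < 1) (σ : ℝ) {u₀ : Space d → ℝ} (hu : Measurable u₀)
    (hu1 : MemLp u₀ 1) (n : ℕ) {t : ℝ} (ht : t ∈ Set.Ioo 0 T) (x v : Space d) (y : Fin n → Space d) :
    IntervalIntegrable (fun s => G (t - s) x v * duhamelSeries σ G u₀ n s v y) volume 0 t := by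
  obtain ⟨C, hK⟩ := hG.exists_kernelBound
  have hT : 0 < T := ht.1.trans ht.2
  obtain ⟨b, hb⟩ := exists_conv_cutPow_le C hd0 hd hT
  obtain ⟨B, hB⟩ := hG.exists_duhamelSeries_le hd0 hd hT σ hu1 n
  rw [intervalIntegrable_iff_integrableOn_Ioo_of_le ht.1.le]
  have hint : Integrable (fun s => cutGreen T G (t - s) x v *
      cutSeries T (duhamelSeries σ G u₀) n s v y) := by
    refine ⟨Measurable.aestronglyMeasurable ?_, ?_⟩
    · have h1 : Measurable fun s => cutGreen T G (t - s) x v :=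
        (measurable_cutGreen hG).comp ((measurable_id.const_sub t).prodMk (measurable_const (a := (x, v))))
      have h2 : Measurable fun s => cutSeries T (duhamelSeries σ G u₀) n s v y :=
        (measurableSeries_duhamelSeries hG hu n).comp
          (measurable_id.prodMk (measurable_const (a := (v, y))))
      exact h1.mul h2
    · rw [HasFiniteIntegral]
      refine lt_of_le_of_lt (b := B * (b * ENNReal.ofReal (t ^ (-((d : ℝ) / 𝔪))))) ?_ ?_
      · refine le_trans ?_ (mul_le_mul_right (hb t ht) _)
        rw [← lintegral_const_mul' _ _ ENNReal.coe_ne_top]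
        refine lintegral_mono fun s => ?_
        simp only
        rw [enorm_mul, mul_left_comm]
        exact mul_le_mul' (hK.sup _ _ _) (hB _ _ _)
      · exact ENNReal.mul_lt_top ENNReal.coe_lt_top
          (ENNReal.mul_lt_top ENNReal.coe_lt_top ENNReal.ofReal_lt_top)
  refine hint.integrableOn.congr_fun (fun s hs => ?_) measurableSet_Ioo
  simp only
  rw [cutGreen_of_mem ⟨by linarith [hs.2], by linarith [hs.1, ht.2]⟩,
    cutSeries_of_mem ⟨hs.1, hs.2.trans ht.2⟩]

lemma iterate_opH_freeSeries (u₀ : Space d → ℝ) (p n : ℕ) :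
    (opH σ G)^[p] (freeSeries G u₀) n =
      if n = p then duhamelSeries σ G u₀ n else fun _ _ _ => 0 := by
  induction p generalizing n with
  | zero =>
    cases n with
    | zero => rfl
    | succ n => rfl
  | succ p ih =>
    rw [Function.iterate_succ_apply']
    cases n with
    | zero => funext t x y; simp [opH]
    | succ n =>
      by_cases hpn : n = p
      · rw [if_pos (by omega), duhamelSeries_succ]
        exact opH_congr (by rw [ih, if_pos hpn])
      · rw [if_neg (by omega)]
        funext t x y
        simp only [opH, ih, if_neg hpn]
        simp

/-- The action of the powers of `opH` on a perturbed series. -/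
lemma traceAE_iterate_opH_add (hG : IsGreen 𝔪 T G) (hd0 : 0 ≤ (d : ℝ) / 𝔪)
    (hd : (d : ℝ) / 𝔪 < 1) {u₀ : Space d → ℝ} (hu : Measurable u₀) (hu1 : MemLp u₀ 1)
    (hf : MeasurableSeries T f)
    (hfw : ∀ p n, ∀ t ∈ Set.Ioo 0 T, DiagonalAE (n + 2) (fun w : Fin (n + 2) → Space d =>
      IntervalIntegrable (fun s => G (t - s) (w 0) (w 1) *
        ((opH σ G)^[p] f) n s (w 1) (fun i => w i.succ.succ)) volume 0 t)) (p n : ℕ) {t : ℝ}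
    (ht : t ∈ Set.Ioo 0 T) : TraceAE (n + 1) (fun w : Fin (n + 1) → Space d =>
      ((opH σ G)^[p] (fun n t x y => freeSeries G u₀ n t x y + opH σ G f n t x y)) n t (w 0)
        (fun i => w i.succ) = ((opH σ G)^[p] (freeSeries G u₀)) n t (w 0) (fun i => w i.succ) +
        ((opH σ G)^[p + 1] f) n t (w 0) (fun i => w i.succ)) := by
  have hfree := measurableSeries_freeSeries (T := T) hG hu
  have hadd : MeasurableSeries T (fun n t x y => freeSeries G u₀ n t x y + opH σ G f n t x y) := by
    intro n
    refine measurable_of_forall_eq ((hfree n).add (hf.opH hG σ n)) fun q => ?_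
    by_cases hq : q.1 ∈ Set.Ioo 0 T
    · simp only [Pi.add_apply, cutSeries_of_mem hq]
    · simp only [Pi.add_apply, cutSeries_of_notMem hq, add_zero]
  induction p generalizing n t with
  | zero => exact fun V _ _ κ _ => ae_of_all _ fun z => rfl
  | succ p ih =>
    rw [Function.iterate_succ_apply', Function.iterate_succ_apply', Function.iterate_succ_apply']
    cases n with
    | zero => exact fun V _ _ κ _ => ae_of_all _ fun z => by simp [opH]
    | succ n =>
      refine traceAE_opH_add (hadd.iterate_opH hG σ p) (hfree.iterate_opH hG σ p)
        (hf.iterate_opH hG σ (p + 1)) (fun s hs => ih n hs) ht ?_ (hfw (p + 1) n t ht).traceAE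
      intro V _ _ κ _
      refine ae_of_all _ fun z => ?_
      rw [iterate_opH_freeSeries]
      split_ifs
      · exact hG.intervalIntegrable_duhamelSeries hd0 hd σ hu hu1 n ht _ _ _
      · simp

end TraceAE

end StratonovichSPDE

namespace StratonovichSPDE

/-! ### Chaos coefficients, and membership of the Duhamel series in 𝔐(T) -/

section ChaosBounds

variable {d : ℕ} {σ T 𝔪 : ℝ} {G : ℝ → Space d → Space d → ℝ} {f : StratSeries d}

lemma MeasurableSeries.measurable_trace (hf : MeasurableSeries T f) (m k : ℕ) {t : ℝ}
    (ht : t ∈ Set.Ioo 0 T) : Measurable fun q : (Space d × (Fin m → Space d)) × (Fin k → Space d) =>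
      f (m + 2 * k) t q.1.1 (traceTuple q.1.2 q.2) :=
  (hf.measurable_slice (m + 2 * k) ht).comp ((measurable_fst.comp measurable_fst).prodMk
    (measurable_traceTuple.comp ((measurable_snd.comp measurable_fst).prodMk measurable_snd)))

lemma MeasurableSeries.measurable_lintegral_trace (hf : MeasurableSeries T f) (m k : ℕ) {t : ℝ}
    (ht : t ∈ Set.Ioo 0 T) : Measurable fun q : Space d × (Fin m → Space d) =>
      ∫⁻ z : Fin k → Space d, ‖f (m + 2 * k) t q.1 (traceTuple q.2 z)‖ₑ :=
  (hf.measurable_trace m k ht).enorm.lintegral_prod_right'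

lemma MeasurableSeries.measurable_absChaosCoef (hf : MeasurableSeries T f) (m : ℕ) {t : ℝ}
    (ht : t ∈ Set.Ioo 0 T) : Measurable fun q : Space d × (Fin m → Space d) =>
      absChaosCoef f m t q.1 q.2 :=
  Measurable.tsum fun k => (hf.measurable_lintegral_trace m k ht).const_mul _

lemma MeasurableSeries.measurable_traceInt (hf : MeasurableSeries T f) (m k : ℕ) {t : ℝ}
    (ht : t ∈ Set.Ioo 0 T) : Measurable fun q : Space d × (Fin m → Space d) =>
      traceInt (fun n => f n t q.1) m k q.2 :=
  ((hf.measurable_trace m k ht).stronglyMeasurable.integral_prod_right').measurable.const_mul _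

lemma MeasurableSeries.measurable_traceSq (hf : MeasurableSeries T f) (m k : ℕ) {t : ℝ}
    (ht : t ∈ Set.Ioo 0 T) : Measurable fun x : Space d => traceSq (fun n => f n t x) m k :=
  ((hf.measurable_lintegral_trace m k ht).pow_const 2).lintegral_prod_right'

lemma enorm_chaosCoef_le (f : StratSeries d) (m : ℕ) (t : ℝ) (x : Space d) (y : Fin m → Space d) :
    ‖chaosCoef f m t x y‖ₑ ≤ absChaosCoef f m t x y := by
  have h : ∀ k, ‖traceInt (fun n => f n t x) m k y‖ₑ ≤ ENNReal.ofReal (huMeyerCoef m k) *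
      ∫⁻ z : Fin k → Space d, ‖f (m + 2 * k) t x (traceTuple y z)‖ₑ := fun k => enorm_traceInt_le y
  by_cases hfin : absChaosCoef f m t x y = ∞
  · rw [hfin]; exact le_top
  have hs : Summable fun k => ‖traceInt (fun n => f n t x) m k y‖ := by
    have h1 : ∑' k, ‖traceInt (fun n => f n t x) m k y‖ₑ ≠ ∞ :=
      ((ENNReal.tsum_le_tsum h).trans_lt (lt_top_iff_ne_top.2 hfin)).ne
    simp only [enorm_eq_nnnorm] at h1
    exact NNReal.summable_coe.2 (ENNReal.tsum_coe_ne_top_iff_summable.1 h1)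
  calc ‖chaosCoef f m t x y‖ₑ ≤ ∑' k, ‖traceInt (fun n => f n t x) m k y‖ₑ := by
        have h2 := norm_tsum_le_tsum_norm hs
        rw [← ofReal_norm]
        refine (ENNReal.ofReal_le_ofReal h2).trans ?_
        rw [ENNReal.ofReal_tsum_of_nonneg (fun _ => norm_nonneg _) hs]
        simp only [ofReal_norm, le_refl]
    _ ≤ _ := ENNReal.tsum_le_tsum h

lemma tsum_half_pow : ∑' k : ℕ, (1 / 2 : ℝ≥0∞) ^ k = 2 := by
  simp only [one_div]
  rw [ENNReal.tsum_geometric, ENNReal.one_sub_inv_two, inv_inv]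

/-- Cauchy-Schwarz with weights `2^{-k}` and `2^k`: the square of a series is bounded by a series of
squares, at a geometric loss that the trace bound can afford. -/
lemma sq_tsum_le_two_mul_tsum (a : ℕ → ℝ≥0∞) :
    (∑' k, a k) ^ 2 ≤ 2 * ∑' k, 2 ^ k * a k ^ 2 := by
  rw [← tsum_half_pow]
  refine sq_tsum_le_of_sq_le fun k => le_of_eq ?_
  rw [← mul_assoc, ← mul_pow]
  simp [ENNReal.inv_mul_cancel]

lemma lintegral_absChaosCoef_sq_le (hf : MeasurableSeries T f) (m : ℕ) {t : ℝ}
    (ht : t ∈ Set.Ioo 0 T) : ∫⁻ x, ∫⁻ y, absChaosCoef f m t x y ^ 2 ≤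
      2 * ∑' k, 2 ^ k * (ENNReal.ofReal (huMeyerCoef m k) ^ 2 *
        ∫⁻ x, traceSq (fun n => f n t x) m k) := by
  have hm := fun k => (hf.measurable_lintegral_trace m k ht).pow_const 2
  have hmx : ∀ k x, Measurable fun y : Fin m → Space d =>
      (∫⁻ z : Fin k → Space d, ‖f (m + 2 * k) t x (traceTuple y z)‖ₑ) ^ 2 := fun k x =>
    (hm k).comp (measurable_const.prodMk measurable_id)
  have h1 : ∀ x, ∫⁻ y, absChaosCoef f m t x y ^ 2 ≤ 2 * ∑' k, 2 ^ k *
      (ENNReal.ofReal (huMeyerCoef m k) ^ 2 * traceSq (fun n => f n t x) m k) := by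
    intro x
    calc ∫⁻ y, absChaosCoef f m t x y ^ 2 ≤ ∫⁻ y : Fin m → Space d, 2 * ∑' k, 2 ^ k *
          (ENNReal.ofReal (huMeyerCoef m k) ^ 2 *
            (∫⁻ z : Fin k → Space d, ‖f (m + 2 * k) t x (traceTuple y z)‖ₑ) ^ 2) := by
          refine lintegral_mono fun y => ?_
          refine (sq_tsum_le_two_mul_tsum _).trans (le_of_eq ?_)
          simp only [mul_pow]
      _ = _ := by
          rw [lintegral_const_mul _ (Measurable.tsum fun k =>
            ((hmx k x).const_mul _).const_mul _),
            lintegral_tsum fun k => (((hmx k x).const_mul _).const_mul _).aemeasurable]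
          congr 1
          refine tsum_congr fun k => ?_
          rw [lintegral_const_mul _ ((hmx k x).const_mul _), lintegral_const_mul _ (hmx k x), traceSq]
  have hm2 := fun k => hf.measurable_traceSq m k ht
  refine (lintegral_mono h1).trans (le_of_eq ?_)
  rw [lintegral_const_mul _ (Measurable.tsum fun k =>
    ((hm2 k).const_mul _).const_mul _),
    lintegral_tsum fun k => (((hm2 k).const_mul _).const_mul _).aemeasurable]
  congr 1
  refine tsum_congr fun k => ?_
  rw [lintegral_const_mul _ ((hm2 k).const_mul _), lintegral_const_mul _ (hm2 k)]

/-- Of the four factors `1/2` in `1/16`, one pays for the weight `2^p`, one for the loss `2^k`, and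
the rest leaves a convergent series in `k`. -/
lemma two_pow_mul_le (p m k : ℕ) (h : p ≤ m + 2 * k) :
    (2 : ℝ≥0∞) ^ p * (2 ^ k * (1 / 16) ^ (m + 2 * k)) ≤ (1 / 2) ^ k := by
  have h1 : (2 : ℝ≥0∞) ^ p ≤ 2 ^ (m + 2 * k) := pow_le_pow_right₀ (by norm_num) h
  have h2 : (2 : ℝ≥0∞) ^ k ≤ 2 ^ (m + 2 * k) := pow_le_pow_right₀ (by norm_num) (by omega)
  have h3 : (1 / 16 : ℝ≥0∞) = 1 / 2 * (1 / 2 * (1 / 2 * (1 / 2))) := by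
    simp only [one_div]
    rw [← ENNReal.mul_inv (by simp) (by simp), ← ENNReal.mul_inv (by simp) (by simp),
      ← ENNReal.mul_inv (by simp) (by simp)]
    norm_num
  have h4 : (2 : ℝ≥0∞) * (1 / 2) = 1 := by
    rw [one_div]; exact ENNReal.mul_inv_cancel (by simp) (by simp)
  have h5 : (1 / 2 : ℝ≥0∞) ≤ 1 := by simp
  calc (2 : ℝ≥0∞) ^ p * (2 ^ k * (1 / 16) ^ (m + 2 * k))
      ≤ 2 ^ (m + 2 * k) * (2 ^ (m + 2 * k) * (1 / 16) ^ (m + 2 * k)) := by gcongr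
    _ = (1 / 2 * (1 / 2)) ^ (m + 2 * k) := by
        rw [← mul_pow, ← mul_pow]
        congr 1
        rw [h3, ← mul_assoc 2 (1 / 2), h4, one_mul, ← mul_assoc 2 (1 / 2), h4, one_mul]
    _ ≤ (1 / 2 * 1) ^ (m + 2 * k) := by gcongr
    _ = (1 / 2) ^ (m + 2 * k) := by rw [mul_one]
    _ ≤ (1 / 2) ^ k := pow_le_pow_right_of_le_one' h5 (by omega)

lemma isWeight_two_pow : IsWeight fun p => (2 : ℝ) ^ p :=
  ⟨fun p => by positivity, fun _ _ h => pow_le_pow_right₀ (by norm_num) h,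
    tendsto_pow_atTop_atTop_of_one_lt (by norm_num)⟩

/-- The Duhamel series belongs to the space with weights `2^p`. -/
lemma IsGreen.inM_duhamelSeries (hG : IsGreen 𝔪 T G) (hd0 : 0 ≤ (d : ℝ) / 𝔪)
    (hd : (d : ℝ) / 𝔪 < 1) (σ : ℝ) {u₀ : Space d → ℝ} (hu : Measurable u₀)
    (hu1 : MemLp u₀ 1) (hu2 : MemLp u₀ 2) :
    InM σ G T (fun p => 2 ^ p) (duhamelSeries σ G u₀) where
  measurable := measurableSeries_iff.1 (measurableSeries_duhamelSeries hG hu)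
  symm := fun n t _ x y π => duhamelSeries_comp_perm u₀ n t x y π
  wellDefined := by
    intro p n t ht l hl
    refine ae_of_all _ fun z => ?_
    rw [iterate_opH_duhamelSeries]
    split_ifs
    · exact hG.intervalIntegrable_duhamelSeries hd0 hd σ hu hu1 n ht _ _ _
    · simp
  bound := by
    obtain ⟨R, hR⟩ := hG.exists_trace_bound hd σ
    refine ⟨4 * R * (eLpNorm u₀ 2 volume).toNNReal ^ 2, fun m p t ht => ?_⟩
    have hmeas := (measurableSeries_duhamelSeries (σ := σ) hG hu).iterate_opH hG σ p
    have hk : ∀ k, ENNReal.ofReal (2 ^ p) * (2 ^ k * (ENNReal.ofReal (huMeyerCoef m k) ^ 2 *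
        ∫⁻ x, traceSq (fun n => ((opH σ G)^[p] (duhamelSeries σ G u₀)) n t x) m k)) ≤
        R * eLpNorm u₀ 2 volume ^ 2 * (1 / 2) ^ k := by
      intro k
      -- Degrees below `p` are deleted by `𝓗^p`; in the surviving ones the weight is at most
      -- `2^{m+2k}`.
      by_cases hp : p ≤ m + 2 * k
      · have h1 : ∀ x, traceSq (fun n => ((opH σ G)^[p] (duhamelSeries σ G u₀)) n t x) m k =
            traceSq (fun n => duhamelSeries σ G u₀ n t x) m k := by
          intro x
          simp only [traceSq, iterate_opH_duhamelSeries, if_pos hp]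
        simp only [h1]
        have h2 : (1 : ℝ≥0∞) ≤ (m ! : ℝ≥0∞) := by exact_mod_cast Nat.succ_le_of_lt m.factorial_pos
        have h3 := hR u₀ hu m k t ht
        rw [mul_assoc] at h3
        have h4 := (le_mul_of_one_le_left zero_le h2).trans h3
        calc _ ≤ ENNReal.ofReal (2 ^ p) * (2 ^ k *
              (R * eLpNorm u₀ 2 volume ^ 2 * (1 / 16) ^ (m + 2 * k))) := by gcongr
          _ = R * eLpNorm u₀ 2 volume ^ 2 * ((2 : ℝ≥0∞) ^ p * (2 ^ k * (1 / 16) ^ (m + 2 * k))) := by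
              rw [ENNReal.ofReal_pow (by norm_num), ENNReal.ofReal_ofNat]; ring
          _ ≤ _ := by gcongr; exact two_pow_mul_le p m k hp
      · have h1 : ∀ x, traceSq (fun n => ((opH σ G)^[p] (duhamelSeries σ G u₀)) n t x) m k = 0 := by
          intro x
          simp [traceSq, iterate_opH_duhamelSeries, if_neg hp]
        simp only [h1]
        simp
    calc ENNReal.ofReal (2 ^ p) * ∫⁻ x, ∫⁻ y,
          absChaosCoef ((opH σ G)^[p] (duhamelSeries σ G u₀)) m t x y ^ 2
        ≤ ENNReal.ofReal (2 ^ p) * (2 * ∑' k, 2 ^ k * (ENNReal.ofReal (huMeyerCoef m k) ^ 2 *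
          ∫⁻ x, traceSq (fun n => ((opH σ G)^[p] (duhamelSeries σ G u₀)) n t x) m k)) := by
          gcongr
          exact lintegral_absChaosCoef_sq_le hmeas m ht
      _ = 2 * ∑' k, ENNReal.ofReal (2 ^ p) * (2 ^ k * (ENNReal.ofReal (huMeyerCoef m k) ^ 2 *
          ∫⁻ x, traceSq (fun n => ((opH σ G)^[p] (duhamelSeries σ G u₀)) n t x) m k)) := by
          rw [mul_left_comm, ENNReal.tsum_mul_left]
      _ ≤ 2 * ∑' k, R * eLpNorm u₀ 2 volume ^ 2 * (1 / 2) ^ k := by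
          exact mul_le_mul_right (ENNReal.tsum_le_tsum hk) _
      _ = _ := by
          rw [ENNReal.tsum_mul_left, tsum_half_pow]
          push_cast
          rw [ENNReal.coe_toNNReal hu2.2.ne]
          ring

lemma isMild_duhamelSeries (u₀ : Space d → ℝ) : IsMild σ G T u₀ (duhamelSeries σ G u₀) := by
  intro p m t _
  rw [← duhamelSeries_eq_add]
  exact ae_of_all _ fun q => rfl

/-! ### Uniqueness -/

lemma ae_absChaosCoef_lt_top {c : ℕ → ℝ} (hc : IsWeight c) (hf : InM σ G T c f)
    (hG : IsGreen 𝔪 T G) (p m : ℕ) {t : ℝ} (ht : t ∈ Set.Ioo 0 T) :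
    ∀ᵐ q : Space d × (Fin m → Space d), absChaosCoef ((opH σ G)^[p] f) m t q.1 q.2 < ∞ := by
  obtain ⟨C, hC⟩ := hf.bound
  have hm := ((measurableSeries_iff.2 hf.measurable).iterate_opH hG σ p).measurable_absChaosCoef m ht
  have h1 : ∫⁻ q : Space d × (Fin m → Space d),
      absChaosCoef ((opH σ G)^[p] f) m t q.1 q.2 ^ 2 ≠ ∞ := by
    rw [Measure.volume_eq_prod, lintegral_prod _ (hm.pow_const 2).aemeasurable]
    intro h
    have := hC m p t ht
    rw [h, ENNReal.mul_top (by simpa using hc.pos p)] at this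
    exact absurd this (by simp)
  filter_upwards [ae_lt_top (hm.pow_const 2) h1] with q hq
  by_contra hcon
  rw [not_lt, top_le_iff] at hcon
  simp [hcon] at hq

lemma integrable_trace_of_absChaosCoef_lt_top (hf : MeasurableSeries T f) {m : ℕ} {t : ℝ}
    (ht : t ∈ Set.Ioo 0 T) {x : Space d} {y : Fin m → Space d} (h : absChaosCoef f m t x y < ∞)
    (k : ℕ) : Integrable fun z : Fin k → Space d => f (m + 2 * k) t x (traceTuple y z) := by
  have hm : Measurable fun z : Fin k → Space d => f (m + 2 * k) t x (traceTuple y z) :=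
    (hf.measurable_trace m k ht).comp ((measurable_const (a := (x, y))).prodMk measurable_id)
  refine ⟨hm.aestronglyMeasurable, ?_⟩
  have h1 := (ENNReal.le_tsum (f := fun k => ENNReal.ofReal (huMeyerCoef m k) *
    ∫⁻ z : Fin k → Space d, ‖f (m + 2 * k) t x (traceTuple y z)‖ₑ) k).trans_lt h
  by_contra hcon
  rw [HasFiniteIntegral, not_lt, top_le_iff] at hcon
  rw [hcon, ENNReal.mul_top (by simpa using huMeyerCoef_pos m k)] at h1
  exact absurd h1 (lt_irrefl _)

lemma summable_traceInt_of_absChaosCoef_lt_top {m : ℕ} {t : ℝ} {x : Space d} {y : Fin m → Space d}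
    (h : absChaosCoef f m t x y < ∞) : Summable fun k => traceInt (fun n => f n t x) m k y := by
  refine Summable.of_norm ?_
  have h1 : ∑' k, ‖traceInt (fun n => f n t x) m k y‖ₑ ≠ ∞ :=
    ((ENNReal.tsum_le_tsum fun k => enorm_traceInt_le y).trans_lt h).ne
  simp only [enorm_eq_nnnorm] at h1
  exact NNReal.summable_coe.2 (ENNReal.tsum_coe_ne_top_iff_summable.1 h1)

/-- Additivity of the coefficients on diagonals passes through the trace integrals and the sum over
`k` where both parts have finite absolute chaos coefficients. For the free part only degree `p` is
nonzero, so its sum over `k` is finite; integrability is inherited from the Duhamel series. -/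
lemma chaosCoef_iterate_opH_add (hG : IsGreen 𝔪 T G) (hd0 : 0 ≤ (d : ℝ) / 𝔪)
    (hd : (d : ℝ) / 𝔪 < 1) {u₀ : Space d → ℝ} (hu : Measurable u₀) (hu1 : MemLp u₀ 1)
    (hu2 : MemLp u₀ 2) {c : ℕ → ℝ} (hc : IsWeight c) (hf : InM σ G T c f) (p m : ℕ) {t : ℝ}
    (ht : t ∈ Set.Ioo 0 T) : ∀ᵐ q : Space d × (Fin m → Space d),
      chaosCoef ((opH σ G)^[p] (fun n t x y => freeSeries G u₀ n t x y + opH σ G f n t x y)) m t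
        q.1 q.2 = chaosCoef ((opH σ G)^[p] (freeSeries G u₀)) m t q.1 q.2 +
          chaosCoef ((opH σ G)^[p + 1] f) m t q.1 q.2 := by
  have hfm := measurableSeries_iff.2 hf.measurable
  have hDm := measurableSeries_duhamelSeries (σ := σ) (T := T) hG hu
  have h1 : ∀ᵐ q : Space d × (Fin m → Space d), ∀ k : ℕ, ∀ᵐ z : Fin k → Space d, _ :=
    ae_all_iff.2 fun k => (traceAE_iterate_opH_add hG hd0 hd hu hu1 hfm hf.wellDefined p
      (m + 2 * k) ht).ae_traceTuple
  have h2 := ae_absChaosCoef_lt_top isWeight_two_pow (hG.inM_duhamelSeries hd0 hd σ hu hu1 hu2) hG 0 m ht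
  have h3 := ae_absChaosCoef_lt_top hc hf hG (p + 1) m ht
  filter_upwards [h1, h2, h3] with q k1 k2 k3
  have i2 := integrable_trace_of_absChaosCoef_lt_top hDm ht k2
  have i3 := integrable_trace_of_absChaosCoef_lt_top (hfm.iterate_opH hG σ (p + 1)) ht k3
  have i2' : ∀ k, Integrable fun z : Fin k → Space d =>
      ((opH σ G)^[p] (freeSeries G u₀)) (m + 2 * k) t q.1 (traceTuple q.2 z) := by
    intro k
    rw [iterate_opH_freeSeries]
    split_ifs
    · exact i2 k
    · simp
  have s2 : Summable fun k =>
      traceInt (fun n => ((opH σ G)^[p] (freeSeries G u₀)) n t q.1) m k q.2 := by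
    refine summable_of_ne_finset_zero (s := Finset.range (p + 1)) fun k hk => ?_
    have : m + 2 * k ≠ p := by
      simp only [Finset.mem_range] at hk; omega
    simp [traceInt, iterate_opH_freeSeries, if_neg this]
  have s3 := summable_traceInt_of_absChaosCoef_lt_top k3
  unfold chaosCoef
  refine Eq.trans ?_ (s2.tsum_add s3)
  refine tsum_congr fun k => ?_
  simp only [traceInt]
  rw [← mul_add, ← integral_add (i2' k) (i3 k)]
  congr 1
  refine integral_congr_ae ?_
  filter_upwards [k1 k] with z hz
  simpa only [Fin.cons_zero, Fin.cons_succ] using hz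

/-- Uniqueness of mild solutions. -/
lemma IsMild.fieldEq (hG : IsGreen 𝔪 T G) (hd0 : 0 ≤ (d : ℝ) / 𝔪)
    (hd : (d : ℝ) / 𝔪 < 1) {u₀ : Space d → ℝ} (hu : Measurable u₀) (hu1 : MemLp u₀ 1)
    (hu2 : MemLp u₀ 2) {c c' : ℕ → ℝ} (hc : IsWeight c) (hc' : IsWeight c') {f' : StratSeries d}
    (hf : InM σ G T c f) (hf' : InM σ G T c' f') (hm : IsMild σ G T u₀ f)
    (hm' : IsMild σ G T u₀ f') : FieldEq σ G T f f' := by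
  intro p m t ht
  set δ : ℕ → Space d × (Fin m → Space d) → ℝ := fun p q =>
    chaosCoef ((opH σ G)^[p] f) m t q.1 q.2 - chaosCoef ((opH σ G)^[p] f') m t q.1 q.2 with hδ
  -- Both series satisfy the mild equation with the same free term, which cancels in the difference.
  have hstep : ∀ r, δ r =ᵐ[volume] δ (r + 1) := by
    intro r
    filter_upwards [hm r m t ht, hm' r m t ht,
      chaosCoef_iterate_opH_add hG hd0 hd hu hu1 hu2 hc hf r m ht,
      chaosCoef_iterate_opH_add hG hd0 hd hu hu1 hu2 hc' hf' r m ht] with q k1 k2 k3 k4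
    simp only [hδ]
    rw [k1, k2, k3, k4]
    ring
  have hall : ∀ N, δ p =ᵐ[volume] δ (p + N) := by
    intro N
    induction N with
    | zero => rfl
    | succ N ih => exact ih.trans (hstep (p + N))
  have hbound : ∀ {c : ℕ → ℝ} {f : StratSeries d}, IsWeight c → InM σ G T c f →
      Tendsto (fun r => ∫⁻ q : Space d × (Fin m → Space d),
        absChaosCoef ((opH σ G)^[r] f) m t q.1 q.2 ^ 2) atTop (𝓝 0) := by
    intro c f hc hf
    obtain ⟨C, hC⟩ := hf.bound
    have hlim : Tendsto (fun r => (C : ℝ≥0∞) / ENNReal.ofReal (c r)) atTop (𝓝 0) := by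
      have h1 : Tendsto (fun r => ENNReal.ofReal (c r)) atTop (𝓝 ∞) :=
        ENNReal.tendsto_ofReal_nhds_top.2 hc.tendsto
      have h2 := ENNReal.Tendsto.const_div (a := (C : ℝ≥0∞)) h1 (Or.inr ENNReal.coe_ne_top)
      simpa using h2
    refine tendsto_of_tendsto_of_tendsto_of_le_of_le tendsto_const_nhds hlim (fun _ => zero_le)
      (fun r => ?_)
    have hmeas := ((measurableSeries_iff.2 hf.measurable).iterate_opH hG σ r).measurable_absChaosCoef
      m ht
    simp only
    rw [Measure.volume_eq_prod, lintegral_prod _ (hmeas.pow_const 2).aemeasurable,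
      ENNReal.le_div_iff_mul_le (Or.inl (by simpa using hc.pos r)) (Or.inl (by simp)), mul_comm]
    exact hC m r t ht
  have hle : ∀ r, ∫⁻ q, ‖δ r q‖ₑ ^ 2 ≤
      2 * (∫⁻ q : Space d × (Fin m → Space d), absChaosCoef ((opH σ G)^[r] f) m t q.1 q.2 ^ 2) +
      2 * ∫⁻ q : Space d × (Fin m → Space d), absChaosCoef ((opH σ G)^[r] f') m t q.1 q.2 ^ 2 := by
    intro r
    have hmeas := ((measurableSeries_iff.2 hf.measurable).iterate_opH hG σ r).measurable_absChaosCoef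
      m ht
    rw [← lintegral_const_mul' _ _ (by simp), ← lintegral_const_mul' _ _ (by simp),
      ← lintegral_add_left ((hmeas.pow_const 2).const_mul 2)]
    refine lintegral_mono fun q => ?_
    refine le_trans ?_ (ennreal_add_sq_le _ _)
    exact pow_le_pow_left₀ zero_le (enorm_sub_le.trans (add_le_add (enorm_chaosCoef_le _ _ _ _ _)
      (enorm_chaosCoef_le _ _ _ _ _))) 2
  -- The norm of `δ p` equals that of `δ r` for every `r ≥ p`, and the latter tends to zero like the
  -- reciprocals of the weights at `r`.
  have hzero : ∫⁻ q, ‖δ p q‖ₑ ^ 2 = 0 := by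
    refine le_antisymm ?_ zero_le
    have hlim : Tendsto (fun r => 2 * (∫⁻ q : Space d × (Fin m → Space d),
        absChaosCoef ((opH σ G)^[r] f) m t q.1 q.2 ^ 2) +
        2 * ∫⁻ q : Space d × (Fin m → Space d), absChaosCoef ((opH σ G)^[r] f') m t q.1 q.2 ^ 2)
        atTop (𝓝 0) := by
      have h1 := ENNReal.Tendsto.const_mul (a := 2) (hbound hc hf) (Or.inr (by simp))
      have h2 := ENNReal.Tendsto.const_mul (a := 2) (hbound hc' hf') (Or.inr (by simp))
      simpa using h1.add h2
    refine ge_of_tendsto hlim ?_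
    filter_upwards [eventually_ge_atTop p] with r hr
    obtain ⟨N, rfl⟩ := Nat.exists_eq_add_of_le hr
    refine le_trans (le_of_eq ?_) (hle (p + N))
    refine lintegral_congr_ae ?_
    filter_upwards [hall N] with q hq
    rw [hq]
  have hmeasδ : AEMeasurable (fun q => ‖δ p q‖ₑ ^ 2) volume := by
    have hmc : ∀ {f : StratSeries d}, MeasurableSeries T f → Measurable
        fun q : Space d × (Fin m → Space d) => chaosCoef f m t q.1 q.2 := fun hf =>
      Measurable.tsum fun k => hf.measurable_traceInt m k ht
    exact (((hmc ((measurableSeries_iff.2 hf.measurable).iterate_opH hG σ p)).sub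
      (hmc ((measurableSeries_iff.2 hf'.measurable).iterate_opH hG σ p))).enorm.pow_const
        2).aemeasurable
  have := (lintegral_eq_zero_iff' hmeasδ).1 hzero
  filter_upwards [this] with q hq
  simp only [Pi.zero_apply, pow_eq_zero_iff two_ne_zero, enorm_eq_zero] at hq
  exact sub_eq_zero.1 hq

end ChaosBounds

end StratonovichSPDE

namespace StratonovichSPDE

/-! ### Measurability of slices as `L²`-valued maps -/

section BochnerSlices

variable {X Y : Type*} [MeasurableSpace X] [MeasurableSpace Y]

/-- A map into a second countable metric space is measurable as soon as its distances to all points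
are. -/
lemma measurable_of_measurable_dist {E : Type*} [PseudoMetricSpace E] [SecondCountableTopology E]
    [MeasurableSpace E] [BorelSpace E] {F : X → E} (h : ∀ g, Measurable fun x => dist (F x) g) :
    Measurable F := by
  refine measurable_of_isOpen fun s hs => ?_
  have h1 : ∀ g : s, ∃ r > 0, Metric.ball (g : E) r ⊆ s := fun g => Metric.isOpen_iff.1 hs g g.2
  choose r hr hrs using h1
  obtain ⟨A, hA, hAeq⟩ := TopologicalSpace.isOpen_iUnion_countable
    (fun g : s => Metric.ball (g : E) (r g)) fun g => Metric.isOpen_ball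
  have h2 : s = ⋃ g ∈ A, Metric.ball (g : E) (r g) := by
    rw [hAeq]
    refine Set.Subset.antisymm (fun y hy => Set.mem_iUnion.2 ⟨⟨y, hy⟩, Metric.mem_ball_self (hr _)⟩)
      (Set.iUnion_subset hrs)
  rw [h2, Set.preimage_iUnion₂]
  exact MeasurableSet.biUnion hA fun g _ => measurableSet_lt (h g) measurable_const

open scoped Classical in
/-- The slices of a measurable function, as a map into `L²`, form a measurable map. -/
lemma stronglyMeasurable_toLp_slice {ν : Measure Y} [SFinite ν] [IsSeparable ν] {K : X → Y → ℝ}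
    (hK : Measurable fun q : X × Y => K q.1 q.2) :
    StronglyMeasurable fun x => if h : MemLp (K x) 2 ν then h.toLp else 0 := by
  have hn : ∀ g : Y → ℝ, Measurable g → Measurable fun x => eLpNorm (fun y => K x y - g y) 2 ν := by
    intro g hg
    simp only [eLpNorm_eq_lintegral_rpow_enorm_toReal (p := 2) (by simp) (by simp)]
    have : Measurable fun q : X × Y => ‖K q.1 q.2 - g q.2‖ₑ ^ (2 : ℝ≥0∞).toReal :=
      ((hK.sub (hg.comp measurable_snd)).enorm).pow_const _
    exact this.lintegral_prod_right'.pow_const _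
  have hx : ∀ x, Measurable (K x) := fun x => hK.comp (measurable_prodMk_left (x := x))
  have hset : MeasurableSet {x | MemLp (K x) 2 ν} := by
    have h0 := hn 0 measurable_const
    simp only [Pi.zero_apply, sub_zero] at h0
    have : {x | MemLp (K x) 2 ν} = {x | eLpNorm (fun y => K x y) 2 ν < ∞} := by
      ext x
      exact ⟨fun h => h.2, fun h => ⟨(hx x).aestronglyMeasurable, h⟩⟩
    rw [this]
    exact measurableSet_lt h0 measurable_const
  borelize ↥(Lp ℝ 2 ν)
  have : Fact ((2 : ℝ≥0∞) ≠ ∞) := ⟨by simp⟩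
  refine Measurable.stronglyMeasurable (measurable_of_measurable_dist fun g => ?_)
  -- The distance to a fixed `g` is an explicit norm of the slice, measurable in `x` by Tonelli; off
  -- the set of square-integrable slices it is constant.
  have hd : (fun x => dist (if h : MemLp (K x) 2 ν then h.toLp else 0) g) = fun x =>
      if MemLp (K x) 2 ν then (eLpNorm (fun y => K x y - g y) 2 ν).toReal else dist 0 g := by
    ext x
    split_ifs with h
    · rw [dist_eq_norm, Lp.norm_def]
      congr 1
      refine eLpNorm_congr_ae ?_
      filter_upwards [Lp.coeFn_sub h.toLp g, h.coeFn_toLp] with y k1 k2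
      rw [k1, Pi.sub_apply, k2]
    · rfl
  rw [hd]
  exact Measurable.ite hset (hn g (Lp.stronglyMeasurable g).measurable).ennreal_toReal
    measurable_const

end BochnerSlices

/-! ### Double series with geometric decay -/

section DoubleSeries

lemma tsum_half_pow_prod_le : ∑' q : ℕ × ℕ, (1 / 2 : ℝ≥0∞) ^ (q.1 + 2 * q.2) ≤ 4 := by
  have h : ∀ q : ℕ × ℕ, (1 / 2 : ℝ≥0∞) ^ (q.1 + 2 * q.2) ≤ (1 / 2) ^ q.1 * (1 / 2) ^ q.2 := by
    intro q
    rw [← pow_add]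
    exact pow_le_pow_right_of_le_one' (by simp) (by omega)
  refine (ENNReal.tsum_le_tsum h).trans (le_of_eq ?_)
  rw [ENNReal.tsum_prod (f := fun i j => (1 / 2 : ℝ≥0∞) ^ i * (1 / 2) ^ j)]
  simp only [ENNReal.tsum_mul_left, ENNReal.tsum_mul_right, tsum_half_pow]
  norm_num

lemma sq_tsum_tail_le (b : ℕ × ℕ → ℝ≥0∞) (N : ℕ) :
    (∑' q, if N ≤ q.1 + 2 * q.2 then b q else 0) ^ 2 ≤
      4 * ∑' q : ℕ × ℕ, if N ≤ q.1 + 2 * q.2 then 2 ^ (q.1 + 2 * q.2) * b q ^ 2 else 0 := by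
  refine (sq_tsum_le_of_sq_le (g := fun q : ℕ × ℕ => (1 / 2 : ℝ≥0∞) ^ (q.1 + 2 * q.2))
    (h := fun q : ℕ × ℕ => if N ≤ q.1 + 2 * q.2 then 2 ^ (q.1 + 2 * q.2) * b q ^ 2 else 0)
    fun q => ?_).trans (mul_le_mul_left tsum_half_pow_prod_le _)
  split_ifs
  · rw [← mul_assoc, ← mul_pow, one_div, ENNReal.inv_mul_cancel (by simp) (by simp)]
    simp
  · simp

lemma two_pow_mul_sixteenth_le {N e : ℕ} (h : N ≤ e) :
    (2 : ℝ≥0∞) ^ e * (1 / 16) ^ e ≤ (1 / 2) ^ N * (1 / 2) ^ e := by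
  have h3 : (1 / 16 : ℝ≥0∞) = (1 / 2) ^ 4 := by
    rw [one_div, one_div, ← ENNReal.inv_pow]; norm_num
  have h4 : (2 : ℝ≥0∞) * (1 / 2) ^ 4 = (1 / 2) ^ 3 := by
    rw [pow_succ', ← mul_assoc, one_div, ENNReal.mul_inv_cancel (by simp) (by simp), one_mul]
  have h5 : (1 / 2 : ℝ≥0∞) ≤ 1 := by simp
  rw [← mul_pow, h3, h4, ← pow_mul, ← pow_add]
  exact pow_le_pow_right_of_le_one' h5 (by omega)

variable {X E : Type*} [MeasurableSpace X] {μ : Measure X} [NormedAddCommGroup E]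
  {a : ℕ × ℕ → X → E} {B : ℝ≥0∞}

/-- Weighted Cauchy-Schwarz on the tail uses one power of `2` per unit of `m + 2k`. The decay
`16^{-(m+2k)}` leaves enough for summation and for the factor `2^{-N}`, with constants depending
only on `B`; this makes the convergence uniform in time. -/
lemma lintegral_sq_tsum_tail_le (ha : ∀ q, AEStronglyMeasurable (a q) μ)
    (hB : ∀ q, ∫⁻ x, ‖a q x‖ₑ ^ 2 ∂μ ≤ B * (1 / 16) ^ (q.1 + 2 * q.2)) (N : ℕ) :
    ∫⁻ x, (∑' q, if N ≤ q.1 + 2 * q.2 then ‖a q x‖ₑ else 0) ^ 2 ∂μ ≤ 16 * B * (1 / 2) ^ N := by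
  calc ∫⁻ x, (∑' q, if N ≤ q.1 + 2 * q.2 then ‖a q x‖ₑ else 0) ^ 2 ∂μ
      ≤ ∫⁻ x, 4 * ∑' q : ℕ × ℕ,
          (if N ≤ q.1 + 2 * q.2 then 2 ^ (q.1 + 2 * q.2) * ‖a q x‖ₑ ^ 2 else 0) ∂μ :=
        lintegral_mono fun x => sq_tsum_tail_le _ N
    _ = 4 * ∑' q : ℕ × ℕ, if N ≤ q.1 + 2 * q.2 then
          2 ^ (q.1 + 2 * q.2) * ∫⁻ x, ‖a q x‖ₑ ^ 2 ∂μ else 0 := by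
        rw [lintegral_const_mul' _ _ (by simp), lintegral_tsum fun q => ?_]
        · congr 1
          refine tsum_congr fun q => ?_
          split_ifs
          · rw [lintegral_const_mul' _ _ (by simp)]
          · simp
        · split_ifs
          · exact ((ha q).enorm.pow_const 2).const_mul _
          · exact aemeasurable_const
    _ ≤ 4 * ∑' q : ℕ × ℕ, B * (1 / 2) ^ N * (1 / 2) ^ (q.1 + 2 * q.2) := by
        refine mul_le_mul_right (ENNReal.tsum_le_tsum fun q => ?_) _
        split_ifs with h
        · calc _ ≤ (2 : ℝ≥0∞) ^ (q.1 + 2 * q.2) * (B * (1 / 16) ^ (q.1 + 2 * q.2)) :=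
                mul_le_mul_right (hB q) _
            _ = B * (2 ^ (q.1 + 2 * q.2) * (1 / 16) ^ (q.1 + 2 * q.2)) := by ring
            _ ≤ B * ((1 / 2) ^ N * (1 / 2) ^ (q.1 + 2 * q.2)) :=
                mul_le_mul_right (two_pow_mul_sixteenth_le h) _
            _ = _ := by ring
        · exact zero_le
    _ ≤ 4 * (B * (1 / 2) ^ N * 4) := by
        rw [ENNReal.tsum_mul_left]
        exact mul_le_mul_right (mul_le_mul_right tsum_half_pow_prod_le _) _
    _ = _ := by ring

lemma ae_summable_norm (ha : ∀ q, AEStronglyMeasurable (a q) μ)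
    (hB : ∀ q, ∫⁻ x, ‖a q x‖ₑ ^ 2 ∂μ ≤ B * (1 / 16) ^ (q.1 + 2 * q.2)) (hBt : B ≠ ∞) :
    ∀ᵐ x ∂μ, Summable fun q => ‖a q x‖ := by
  have h := lintegral_sq_tsum_tail_le ha hB 0
  simp only [zero_le, if_true, pow_zero, mul_one] at h
  have hm : AEMeasurable (fun x => (∑' q, ‖a q x‖ₑ) ^ 2) μ :=
    (AEMeasurable.tsum fun q => (ha q).enorm).pow_const 2
  have h2 : ∫⁻ x, (∑' q, ‖a q x‖ₑ) ^ 2 ∂μ ≠ ∞ :=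
    (h.trans_lt (ENNReal.mul_lt_top (by simp) hBt.lt_top)).ne
  filter_upwards [ae_lt_top' hm h2] with x hx
  have h3 : ∑' q, ‖a q x‖ₑ ≠ ∞ := by
    intro hcon
    simp [hcon] at hx
  simp only [enorm_eq_nnnorm] at h3
  exact NNReal.summable_coe.2 (ENNReal.tsum_coe_ne_top_iff_summable.1 h3)

lemma sum_range_chaosPairs {M : Type*} [AddCommMonoid M] (b : ℕ × ℕ → M) (N : ℕ) :
    ∑ n ∈ Finset.range N, ∑ q ∈ chaosPairs n, b q =
      ∑ q ∈ (Finset.range N).biUnion chaosPairs, b q := by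
  rw [Finset.sum_biUnion]
  intro i _ j _ hij
  rw [Function.onFun, Finset.disjoint_left]
  intro q h1 h2
  exact hij ((mem_chaosPairs.1 h1).symm.trans (mem_chaosPairs.1 h2))

variable [CompleteSpace E]

/-- Partial sums are taken along the Stratonovich order `m + 2k`, so the remainder is exactly a tail
in that order. -/
lemma enorm_tsum_sub_sum_le {b : ℕ × ℕ → E} (hb : Summable fun q => ‖b q‖) (N : ℕ) :
    ‖∑' q, b q - ∑ n ∈ Finset.range N, ∑ q ∈ chaosPairs n, b q‖ₑ ≤
      ∑' q : ℕ × ℕ, if N ≤ q.1 + 2 * q.2 then ‖b q‖ₑ else 0 := by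
  classical
  have hmem : ∀ q : ℕ × ℕ, q ∈ (Finset.range N).biUnion chaosPairs ↔ q.1 + 2 * q.2 < N := by
    intro q
    simp [mem_chaosPairs]
  rw [sum_range_chaosPairs, ← Summable.sum_add_tsum_compl (s := (Finset.range N).biUnion chaosPairs)
    hb.of_norm, add_sub_cancel_left, tsum_subtype ((↑((Finset.range N).biUnion chaosPairs) :
      Set (ℕ × ℕ))ᶜ) b]
  refine (enorm_tsum_le_tsum_enorm).trans (ENNReal.tsum_le_tsum fun q => ?_)
  by_cases hq : N ≤ q.1 + 2 * q.2
  · rw [if_pos hq, Set.indicator_of_mem]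
    rw [Set.mem_compl_iff, Finset.mem_coe, hmem]
    omega
  · rw [Set.indicator_of_notMem]
    · simp
    · rw [Set.mem_compl_iff, not_not, Finset.mem_coe, hmem]
      omega

lemma aestronglyMeasurable_tsum_prod (ha : ∀ q, AEStronglyMeasurable (a q) μ)
    (hs : ∀ᵐ x ∂μ, Summable fun q => ‖a q x‖) :
    AEStronglyMeasurable (fun x => ∑' q, a q x) μ := by
  refine aestronglyMeasurable_of_tendsto_ae (u := (atTop : Filter (Finset (ℕ × ℕ))))
    (f := fun s x => ∑ q ∈ s, a q x)
    (fun s => Finset.aestronglyMeasurable_fun_sum s fun q _ => ha q) ?_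
  filter_upwards [hs] with x hx
  exact hx.of_norm.hasSum

lemma eLpNorm_tsum_sub_sum_le (ha : ∀ q, AEStronglyMeasurable (a q) μ)
    (hB : ∀ q, ∫⁻ x, ‖a q x‖ₑ ^ 2 ∂μ ≤ B * (1 / 16) ^ (q.1 + 2 * q.2)) (hBt : B ≠ ∞) (N : ℕ) :
    eLpNorm (fun x => ∑' q, a q x - ∑ n ∈ Finset.range N, ∑ q ∈ chaosPairs n, a q x) 2 μ ≤
      (16 * B * (1 / 2) ^ N) ^ (1 / 2 : ℝ) := by
  have h : eLpNorm (fun x => ∑' q, a q x - ∑ n ∈ Finset.range N, ∑ q ∈ chaosPairs n, a q x) 2 μ ^ 2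
      ≤ 16 * B * (1 / 2) ^ N := by
    rw [eLpNorm_two_sq]
    refine le_trans (lintegral_mono_ae ?_) (lintegral_sq_tsum_tail_le ha hB N)
    filter_upwards [ae_summable_norm ha hB hBt] with x hx
    exact pow_le_pow_left₀ zero_le (enorm_tsum_sub_sum_le hx N) 2
  have h2 := ENNReal.rpow_le_rpow h (z := 1 / 2) (by norm_num)
  rwa [← ENNReal.rpow_natCast, ← ENNReal.rpow_mul, show ((2 : ℕ) : ℝ) * (1 / 2) = 1 by norm_num,
    ENNReal.rpow_one] at h2

end DoubleSeries

end StratonovichSPDE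

namespace StratonovichSPDE

/-! ### From chaos coefficients to random fields -/

section Fields

variable {d : ℕ} {σ T 𝔪 : ℝ} {G : ℝ → Space d → Space d → ℝ} {f : StratSeries d}
  {Ω : Type*} [MeasurableSpace Ω] {P : Measure Ω} [IsProbabilityMeasure P]

lemma enorm_traceInt_le_absChaosCoef (f : StratSeries d) (m k : ℕ) (t : ℝ) (x : Space d)
    (y : Fin m → Space d) : ‖traceInt (fun n => f n t x) m k y‖ₑ ≤ absChaosCoef f m t x y :=
  (enorm_traceInt_le y).trans (ENNReal.le_tsum (f := fun k => ENNReal.ofReal (huMeyerCoef m k) *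
    ∫⁻ z : Fin k → Space d, ‖f (m + 2 * k) t x (traceTuple y z)‖ₑ) k)

lemma memLp_two_of_enorm_le {α : Type*} [MeasurableSpace α] {μ : Measure α} {g : α → ℝ}
    {b : α → ℝ≥0∞} (hg : AEStronglyMeasurable g μ) (h : ∀ y, ‖g y‖ₑ ≤ b y)
    (hb : ∫⁻ y, b y ^ 2 ∂μ ≠ ∞) : MemLp g 2 μ := by
  refine ⟨hg, ?_⟩
  have h1 : eLpNorm g 2 μ ^ 2 < ∞ := by
    rw [eLpNorm_two_sq]
    exact (lintegral_mono fun y => pow_le_pow_left₀ zero_le (h y) 2).trans_lt hb.lt_top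
  exact (ENNReal.pow_lt_top_iff.1 h1).resolve_right (by norm_num)

/-- The partial Hu-Meyer sums converge pointwise wherever the absolute coefficient is finite, and
their errors are dominated by twice that coefficient, which is square integrable. -/
lemma tendsto_sum_traceLp (hf : MeasurableSeries T f) (m : ℕ) {t : ℝ} (ht : t ∈ Set.Ioo 0 T)
    {x : Space d} (hb : ∫⁻ y : Fin m → Space d, absChaosCoef f m t x y ^ 2 ≠ ∞) :
    ∃ h : MemLp (chaosCoef f m t x) 2, Tendsto
      (fun K => ∑ k ∈ Finset.range K, traceLp (fun n => f n t x) m k) atTop (𝓝 h.toLp) := by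
  have hmt : ∀ k, Measurable (traceInt (fun n => f n t x) m k) := fun k =>
    (hf.measurable_traceInt m k ht).comp (measurable_prodMk_left (x := x))
  have hmc : Measurable (chaosCoef f m t x) := Measurable.tsum hmt
  have hma : Measurable (absChaosCoef f m t x) :=
    (hf.measurable_absChaosCoef m ht).comp (measurable_prodMk_left (x := x))
  have hL : ∀ k, MemLp (traceInt (fun n => f n t x) m k) 2 := fun k =>
    memLp_two_of_enorm_le (hmt k).aestronglyMeasurable
      (enorm_traceInt_le_absChaosCoef f m k t x) hb
  have hg : MemLp (chaosCoef f m t x) 2 :=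
    memLp_two_of_enorm_le hmc.aestronglyMeasurable (enorm_chaosCoef_le f m t x) hb
  refine ⟨hg, ?_⟩
  have hae : ∀ᵐ y : Fin m → Space d, absChaosCoef f m t x y < ∞ := by
    filter_upwards [ae_lt_top (hma.pow_const 2) hb] with y hy
    by_contra hcon
    rw [not_lt, top_le_iff] at hcon
    simp [hcon] at hy
  have hcoe : ∀ K, (∑ k ∈ Finset.range K, traceLp (fun n => f n t x) m k :
      Lp ℝ 2 (volume : Measure (Fin m → Space d))) =ᵐ[volume]
      fun y => ∑ k ∈ Finset.range K, traceInt (fun n => f n t x) m k y := by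
    intro K
    have h1 : ∀ᵐ y : Fin m → Space d, ∀ k, traceLp (fun n => f n t x) m k y =
        traceInt (fun n => f n t x) m k y := by
      rw [ae_all_iff]; intro k
      rw [traceLp_eq (hL k)]
      exact (hL k).coeFn_toLp
    filter_upwards [h1, Lp.coeFn_finsetSum (Finset.range K)
      fun k => traceLp (fun n => f n t x) m k] with y k1 k2
    rw [k2]
    simp [k1]
  rw [← tendsto_eLpNorm_sub_iff hcoe hg.coeFn_toLp]
  have hlim : Tendsto (fun K : ℕ => ∫⁻ y : Fin m → Space d,
      ‖chaosCoef f m t x y - ∑ k ∈ Finset.range K, traceInt (fun n => f n t x) m k y‖ₑ ^ 2)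
      atTop (𝓝 0) := by
    rw [← lintegral_zero (μ := (volume : Measure (Fin m → Space d)))]
    refine tendsto_lintegral_of_dominated_convergence
      (fun y => (2 * absChaosCoef f m t x y) ^ 2) (fun K => ?_) (fun K => ?_) ?_ ?_
    · exact (hmc.sub (Finset.measurable_fun_sum _ fun k _ => hmt k)).enorm.pow_const 2
    · refine ae_of_all _ fun y => pow_le_pow_left₀ zero_le ?_ 2
      rw [two_mul]
      refine enorm_sub_le.trans (add_le_add (enorm_chaosCoef_le f m t x y) ?_)
      refine (enorm_sum_le _ _).trans ((ENNReal.sum_le_tsum _).trans ?_)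
      exact ENNReal.tsum_le_tsum fun k => enorm_traceInt_le y
    · simp only [mul_pow]
      rw [lintegral_const_mul' _ _ (by simp)]
      exact ENNReal.mul_ne_top (by simp) hb
    · filter_upwards [hae] with y hy
      have h1 := (summable_traceInt_of_absChaosCoef_lt_top hy).hasSum.tendsto_sum_nat
      have h2 := (tendsto_const_nhds (x := chaosCoef f m t x y)).sub h1
      have h3 : chaosCoef f m t x y - ∑' k, traceInt (fun n => f n t x) m k y = 0 :=
        sub_self _
      rw [h3] at h2
      have h4 := (ENNReal.continuous_pow 2).tendsto _ |>.comp h2.enorm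
      simpa [Function.comp_def] using h4
  have h5 := hlim.ennrpow_const (1 / 2)
  rw [ENNReal.zero_rpow_of_pos (by norm_num)] at h5
  refine h5.congr fun K => ?_
  rw [← eLpNorm_two_sq volume, ← ENNReal.rpow_natCast, ← ENNReal.rpow_mul,
    show ((2 : ℕ) : ℝ) * (1 / 2) = 1 by norm_num, ENNReal.rpow_one]

lemma isWienerIto_tsum (hd : 1 ≤ d) (W : WhiteNoise d P) (hf : MeasurableSeries T f) (m : ℕ) {t : ℝ}
    (ht : t ∈ Set.Ioo 0 T) {x : Space d}
    (hb : ∫⁻ y : Fin m → Space d, absChaosCoef f m t x y ^ 2 ≠ ∞)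
    (hs : Summable fun k => wienerIto hd W m (traceLp (fun n => f n t x) m k)) :
    IsWienerIto W m (chaosCoef f m t x)
      (∑' k, wienerIto hd W m (traceLp (fun n => f n t x) m k)) := by
  obtain ⟨h, hlim⟩ := tendsto_sum_traceLp hf m ht hb
  have h1 := ((wienerIto hd W m).continuous.tendsto _).comp hlim
  simp only [Function.comp_def, map_sum] at h1
  rw [tendsto_nhds_unique hs.hasSum.tendsto_sum_nat h1]
  exact isWienerIto_wienerIto hd W h

/-- The Wiener-Itô components of two fields with the same chaos coefficients coincide. -/
lemma IsChaosField.ae_eq (hd : 1 ≤ d) {W : WhiteNoise d P} {f f' : StratSeries d}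
    {V V' : ℕ → ℝ → Space d → L2Omega P} (hV : IsChaosField W T f V) (hV' : IsChaosField W T f' V')
    (h : FieldEq σ G T f f') (m : ℕ) {t : ℝ} (ht : t ∈ Set.Ioo 0 T) :
    ∀ᵐ x : Space d, V m t x = V' m t x := by
  have h1 := Measure.ae_ae_of_ae_prod (h 0 m t ht)
  filter_upwards [hV m t ht, hV' m t ht, h1] with x k1 k2 k3
  rw [k1.eq_wienerIto hd, k2.eq_wienerIto hd, (MemLp.toLp_eq_toLp_iff k1.1 k2.1).2 k3]

/-- Equality holds at every point, not just almost everywhere, so the values of the Duhamel series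
on diagonals do not depend on the representative of `u₀` either. -/
lemma freeSeries_congr_ae {u₀ u₁ : Space d → ℝ} (h : u₀ =ᵐ[volume] u₁) :
    freeSeries G u₀ = freeSeries G u₁ := by
  funext n t x y
  cases n with
  | zero =>
    refine integral_congr_ae ?_
    filter_upwards [h] with ξ hξ
    rw [hξ]
  | succ n => rfl

lemma InM.ae_lintegral_absChaosCoef_sq_ne_top {c : ℕ → ℝ} (hc : IsWeight c) (hf : InM σ G T c f)
    (m : ℕ) {t : ℝ} (ht : t ∈ Set.Ioo 0 T) :
    ∀ᵐ x : Space d, ∫⁻ y : Fin m → Space d, absChaosCoef f m t x y ^ 2 ≠ ∞ := by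
  obtain ⟨C, hC⟩ := hf.bound
  have hm : Measurable fun x : Space d => ∫⁻ y : Fin m → Space d, absChaosCoef f m t x y ^ 2 :=
    (((measurableSeries_iff.2 hf.measurable).measurable_absChaosCoef m
      ht).pow_const 2).lintegral_prod_right'
  have h1 : ∫⁻ x, ∫⁻ y : Fin m → Space d, absChaosCoef f m t x y ^ 2 ≠ ∞ := by
    intro h
    have := hC m 0 t ht
    rw [Function.iterate_zero, id, h, ENNReal.mul_top (by simpa using hc.pos 0)] at this
    exact absurd this (by simp)
  filter_upwards [ae_lt_top hm h1] with x hx using hx.ne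

end Fields

end StratonovichSPDE

namespace StratonovichSPDE

/-! ### The Duhamel solution as a random field -/

section Duhamel

variable {d : ℕ} {Ω : Type*} [MeasurableSpace Ω] {P : Measure Ω} [IsProbabilityMeasure P]

lemma enorm_wienerIto_traceLp_sq_le (hd : 1 ≤ d) (W : WhiteNoise d P)
    {F : (n : ℕ) → (Fin n → Space d) → ℝ} {m k : ℕ} (hF : Measurable (F (m + 2 * k))) :
    ‖wienerIto hd W m (traceLp F m k)‖ₑ ^ 2 ≤
      (m ! : ℝ≥0∞) * ENNReal.ofReal (huMeyerCoef m k) ^ 2 * traceSq F m k := by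
  by_cases hfin : traceSq F m k = ∞
  · rw [hfin, ENNReal.mul_top]
    · exact le_top
    · simp [Nat.factorial_ne_zero, huMeyerCoef_pos m k]
  · have h1 := ENNReal.ofReal_le_ofReal (norm_wienerIto_sq_le hd W (traceLp F m k))
    rw [ENNReal.ofReal_mul (by positivity), ENNReal.ofReal_pow (norm_nonneg _), ofReal_norm,
      ENNReal.ofReal_natCast] at h1
    rw [mul_assoc]
    exact h1.trans (mul_le_mul_right (norm_traceLp_sq_le hF hfin) _)

variable {σ T 𝔪 : ℝ} {G : ℝ → Space d → Space d → ℝ}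

/-- The Itô component `(m,k)` of the Duhamel series: the contribution to the `m`-th chaos of the
term of order `m + 2k`. -/
noncomputable def duhamelChaos (hd : 1 ≤ d) (W : WhiteNoise d P) (σ : ℝ)
    (G : ℝ → Space d → Space d → ℝ) (u₀ : Space d → ℝ) (t : ℝ) (q : ℕ × ℕ) (x : Space d) :
    L2Omega P :=
  wienerIto hd W q.1 (traceLp (fun n => duhamelSeries σ G u₀ n t x) q.1 q.2)

variable {u₀ : Space d → ℝ}

lemma measurable_duhamelSeries_slice (hG : IsGreen 𝔪 T G) (hu : Measurable u₀) (n : ℕ) {t : ℝ}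
    (ht : t ∈ Set.Ioo 0 T) (x : Space d) : Measurable (duhamelSeries σ G u₀ n t x) :=
  ((measurableSeries_duhamelSeries hG hu).measurable_slice n ht).comp
    (measurable_prodMk_left (x := x))

lemma aestronglyMeasurable_duhamelChaos (hd : 1 ≤ d) (W : WhiteNoise d P) (hG : IsGreen 𝔪 T G)
    (hu : Measurable u₀) {t : ℝ} (ht : t ∈ Set.Ioo 0 T) (q : ℕ × ℕ) :
    AEStronglyMeasurable (duhamelChaos hd W σ G u₀ t q) volume :=
  ((wienerIto hd W q.1).continuous.comp_stronglyMeasurable (stronglyMeasurable_toLp_slice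
    ((measurableSeries_duhamelSeries (σ := σ) hG hu).measurable_traceInt q.1 q.2
      ht))).aestronglyMeasurable

lemma IsGreen.exists_lintegral_duhamelChaos_sq_le (hd : 1 ≤ d) (W : WhiteNoise d P)
    (hG : IsGreen 𝔪 T G) (hα : (d : ℝ) / 𝔪 < 1) (hu : Measurable u₀) (hu2 : MemLp u₀ 2) :
    ∃ B : ℝ≥0, ∀ t ∈ Set.Ioo 0 T, ∀ q : ℕ × ℕ,
      ∫⁻ x, ‖duhamelChaos hd W σ G u₀ t q x‖ₑ ^ 2 ≤ B * (1 / 16) ^ (q.1 + 2 * q.2) := by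
  obtain ⟨R, hR⟩ := hG.exists_trace_bound hα σ
  refine ⟨R * (eLpNorm u₀ 2 volume).toNNReal ^ 2, fun t ht q => ?_⟩
  refine le_trans (lintegral_mono fun x => enorm_wienerIto_traceLp_sq_le hd W
    (measurable_duhamelSeries_slice hG hu (q.1 + 2 * q.2) ht x)) ?_
  rw [lintegral_const_mul' _ _ (by finiteness)]
  push_cast
  rw [ENNReal.coe_toNNReal hu2.2.ne]
  exact hR u₀ hu q.1 q.2 t ht

lemma IsGreen.exists_lintegral_traceSq_le (hG : IsGreen 𝔪 T G) (hα : (d : ℝ) / 𝔪 < 1)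
    (hu : Measurable u₀) (hu2 : MemLp u₀ 2) : ∃ K : ℕ × ℕ → ℝ≥0, ∀ t ∈ Set.Ioo 0 T, ∀ q : ℕ × ℕ,
      ∫⁻ x, traceSq (fun n => duhamelSeries σ G u₀ n t x) q.1 q.2 ≤ K q := by
  obtain ⟨R, hR⟩ := hG.exists_trace_bound hα σ
  have hc : ∀ q : ℕ × ℕ, (q.1 ! : ℝ≥0∞) * ENNReal.ofReal (huMeyerCoef q.1 q.2) ^ 2 ≠ 0 := fun q => by
    simp [Nat.factorial_ne_zero, huMeyerCoef_pos q.1 q.2]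
  have hfin : ∀ q : ℕ × ℕ, R * eLpNorm u₀ 2 volume ^ 2 * (1 / 16) ^ (q.1 + 2 * q.2) /
      ((q.1 ! : ℝ≥0∞) * ENNReal.ofReal (huMeyerCoef q.1 q.2) ^ 2) ≠ ∞ := fun q =>
    ENNReal.div_ne_top (ENNReal.mul_ne_top (ENNReal.mul_ne_top ENNReal.coe_ne_top
      (ENNReal.pow_ne_top hu2.2.ne)) (ENNReal.pow_ne_top (by simp))) (hc q)
  refine ⟨fun q => (R * eLpNorm u₀ 2 volume ^ 2 * (1 / 16) ^ (q.1 + 2 * q.2) /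
    ((q.1 ! : ℝ≥0∞) * ENNReal.ofReal (huMeyerCoef q.1 q.2) ^ 2)).toNNReal, fun t ht q => ?_⟩
  rw [ENNReal.coe_toNNReal (hfin q), ENNReal.le_div_iff_mul_le (Or.inl (hc q))
    (Or.inl (by finiteness)), mul_comm]
  exact hR u₀ hu q.1 q.2 t ht

/-- By the Hu-Meyer formula, `uₙ` is the sum of the Itô components with `m + 2k = n`; the double
family is summable at a rate uniform in `t`. -/
lemma isDuhamelSolution_duhamelChaos (hd : 1 ≤ d) (W : WhiteNoise d P) (hG : IsGreen 𝔪 T G)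
    (hα : (d : ℝ) / 𝔪 < 1) (hu : Measurable u₀) (hu2 : MemLp u₀ 2) :
    IsDuhamelSolution W σ G T u₀ fun t x => ∑' q, duhamelChaos hd W σ G u₀ t q x := by
  obtain ⟨B, hB⟩ := hG.exists_lintegral_duhamelChaos_sq_le (σ := σ) hd W hα hu hu2
  obtain ⟨K, hK⟩ := hG.exists_lintegral_traceSq_le (σ := σ) hα hu hu2
  have hm := fun t (ht : t ∈ Set.Ioo 0 T) =>
    aestronglyMeasurable_duhamelChaos (σ := σ) hd W hG hu ht
  have htr := fun t (ht : t ∈ Set.Ioo 0 T) (q : ℕ × ℕ) =>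
    (measurableSeries_duhamelSeries (σ := σ) hG hu).measurable_traceSq q.1 q.2 ht
  have hbound := fun t (ht : t ∈ Set.Ioo 0 T) (N : ℕ) =>
    eLpNorm_tsum_sub_sum_le (hm t ht) (hB t ht) ENNReal.coe_ne_top N
  have hU : ∀ t ∈ Set.Ioo 0 T, eLpNorm (fun x => ∑' q, duhamelChaos hd W σ G u₀ t q x) 2 volume ≤
      (16 * (B : ℝ≥0∞)) ^ (1 / 2 : ℝ) := by
    intro t ht
    simpa using hbound t ht 0
  have hfin : (16 * (B : ℝ≥0∞)) ^ (1 / 2 : ℝ) ≠ ∞ :=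
    ENNReal.rpow_ne_top_of_nonneg (by norm_num) (by finiteness)
  refine ⟨fun n t x => ∑ q ∈ chaosPairs n, duhamelChaos hd W σ G u₀ t q x, ?_, ?_, ?_, ?_, ?_, ?_⟩
  · intro n t ht
    have h1 : ∀ᵐ x : Space d, ∀ q : ℕ × ℕ,
        traceSq (fun n => duhamelSeries σ G u₀ n t x) q.1 q.2 < ∞ := by
      rw [ae_all_iff]
      exact fun q => ae_lt_top (htr t ht q) ((hK t ht q).trans_lt ENNReal.coe_lt_top).ne
    filter_upwards [h1] with x hx
    exact isStratonovich_sum_wienerIto hd W (F := fun n => duhamelSeries σ G u₀ n t x)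
      (measurable_duhamelSeries_slice hG hu n ht x)
      (fun π y => duhamelSeries_comp_perm u₀ n t x y π) fun q _ => (hx q).ne
  · intro n
    refine ⟨Fintype.card (Pairing (n + n)) * ∑ q ∈ chaosPairs n, K q, fun t ht => ?_⟩
    refine (lintegral_mono fun x => stratNormSq_le (fun n => duhamelSeries σ G u₀ n t x)
      (measurable_duhamelSeries_slice hG hu n ht x)
      fun π y => duhamelSeries_comp_perm u₀ n t x y π).trans ?_
    rw [lintegral_const_mul' _ _ (by simp), lintegral_finsetSum _ fun q _ => htr t ht q]
    push_cast
    exact mul_le_mul_right (Finset.sum_le_sum fun q _ => hK t ht q) _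
  · intro n t ht
    refine memLp_finsetSum _ fun q _ => ⟨hm t ht q, ?_⟩
    have h1 : eLpNorm (duhamelChaos hd W σ G u₀ t q) 2 volume ^ 2 < ∞ := by
      rw [eLpNorm_two_sq]
      exact (hB t ht q).trans_lt (ENNReal.mul_lt_top ENNReal.coe_lt_top
        (ENNReal.pow_lt_top (by simp)))
    exact (ENNReal.pow_lt_top_iff.1 h1).resolve_right (by norm_num)
  · exact fun t ht => ⟨aestronglyMeasurable_tsum_prod (hm t ht)
      (ae_summable_norm (hm t ht) (hB t ht) ENNReal.coe_ne_top), (hU t ht).trans_lt hfin.lt_top⟩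
  · refine ⟨((16 * (B : ℝ≥0∞)) ^ (1 / 2 : ℝ)).toNNReal, fun t ht => ?_⟩
    rw [ENNReal.coe_toNNReal hfin]
    exact hU t ht
  · have h1 : Tendsto (fun N : ℕ => 16 * (B : ℝ≥0∞) * (1 / 2) ^ N) atTop (𝓝 0) := by
      have h2 := ENNReal.Tendsto.const_mul (a := 16 * (B : ℝ≥0∞))
        (ENNReal.tendsto_pow_atTop_nhds_zero_of_lt_one (r := 1 / 2) (by simp))
        (Or.inr (by finiteness))
      simpa using h2
    have h3 := h1.ennrpow_const (1 / 2)
    rw [ENNReal.zero_rpow_of_pos (by norm_num)] at h3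
    exact tendsto_of_tendsto_of_tendsto_of_le_of_le tendsto_const_nhds h3 (fun _ => zero_le)
      fun N => iSup₂_le fun t ht => hbound t ht N

lemma isChaosField_duhamelChaos (hd : 1 ≤ d) (W : WhiteNoise d P) (hG : IsGreen 𝔪 T G)
    (hα0 : 0 ≤ (d : ℝ) / 𝔪) (hα : (d : ℝ) / 𝔪 < 1) (hu : Measurable u₀) (hu1 : MemLp u₀ 1)
    (hu2 : MemLp u₀ 2) : IsChaosField W T (duhamelSeries σ G u₀)
      fun m t x => ∑' k, duhamelChaos hd W σ G u₀ t (m, k) x := by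
  obtain ⟨B, hB⟩ := hG.exists_lintegral_duhamelChaos_sq_le (σ := σ) hd W hα hu hu2
  intro m t ht
  filter_upwards [(hG.inM_duhamelSeries hα0 hα σ hu hu1 hu2).ae_lintegral_absChaosCoef_sq_ne_top
    isWeight_two_pow m ht, ae_summable_norm (aestronglyMeasurable_duhamelChaos hd W hG hu ht)
      (hB t ht) ENNReal.coe_ne_top] with x h1 h2
  exact isWienerIto_tsum hd W (measurableSeries_duhamelSeries hG hu) m ht h1 (h2.of_norm.prod_factor m)

/-- The same absolutely summable double family, grouped by the chaos order `m` instead of the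
Stratonovich order `m + 2k`. -/
lemma ae_hasSum_duhamelChaos (hd : 1 ≤ d) (W : WhiteNoise d P) (hG : IsGreen 𝔪 T G)
    (hα : (d : ℝ) / 𝔪 < 1) (hu : Measurable u₀) (hu2 : MemLp u₀ 2) {t : ℝ}
    (ht : t ∈ Set.Ioo 0 T) : ∀ᵐ x : Space d, HasSum
      (fun m => ∑' k, duhamelChaos hd W σ G u₀ t (m, k) x)
      (∑' q, duhamelChaos hd W σ G u₀ t q x) := by
  obtain ⟨B, hB⟩ := hG.exists_lintegral_duhamelChaos_sq_le (σ := σ) hd W hα hu hu2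
  filter_upwards [ae_summable_norm (aestronglyMeasurable_duhamelChaos hd W hG hu ht)
      (hB t ht) ENNReal.coe_ne_top] with x h
  exact h.of_norm.hasSum.prod_fiberwise fun m => (h.of_norm.prod_factor m).hasSum

end Duhamel

end StratonovichSPDE

/-! ### Existence, chaos expansion and uniqueness -/

theorem theorem3p1 {d : ℕ} (hd : 1 ≤ d) {Ω : Type*} [MeasurableSpace Ω] (P : Measure Ω)
    [IsProbabilityMeasure P] (W : WhiteNoise d P) (𝔪 : ℝ) (h𝔪 : (d : ℝ) < 𝔪) (σ : ℝ)
    (T : ℝ) (hT : 0 < T) (G : ℝ → Space d → Space d → ℝ) (hG : IsGreen 𝔪 T G) :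
    ∃ c : ℕ → ℝ, IsWeight c ∧
      ∀ u₀ : Space d → ℝ, MemLp u₀ 1 volume → MemLp u₀ 2 volume →
        ∃ (U : ℝ → Space d → L2Omega P) (V : ℕ → ℝ → Space d → L2Omega P),
          -- the Duhamel solution and its chaos expansion
          IsDuhamelSolution W σ G T u₀ U ∧
          IsChaosField W T (duhamelSeries σ G u₀) V ∧
          (∀ t ∈ Set.Ioo 0 T, ∀ᵐ x : Space d, HasSum (fun m => V m t x) (U t x)) ∧
          -- it lies in the space and is a mild solution
          InM σ G T c (duhamelSeries σ G u₀) ∧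
          IsMild σ G T u₀ (duhamelSeries σ G u₀) ∧
          -- it is the only one, whatever the weights
          ∀ c' : ℕ → ℝ, IsWeight c' → ∀ f : StratSeries d, InM σ G T c' f →
            IsMild σ G T u₀ f →
              FieldEq σ G T f (duhamelSeries σ G u₀) ∧
              ∀ V' : ℕ → ℝ → Space d → L2Omega P, IsChaosField W T f V' →
                ∀ m, ∀ t ∈ Set.Ioo 0 T, ∀ᵐ x : Space d, V' m t x = V m t x := by
  have hd' : (1 : ℝ) ≤ d := by exact_mod_cast hd
  have hα0 : 0 ≤ (d : ℝ) / 𝔪 := by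
    have : 0 < 𝔪 := by linarith
    positivity
  have hα : (d : ℝ) / 𝔪 < 1 := (div_lt_one (by linarith)).2 h𝔪
  -- The trace bound decays like `16^{-n}` for every `u₀`, with only its constant depending on `u₀`;
  -- this leaves room for the geometric weight `2^p`.
  refine ⟨fun p => 2 ^ p, isWeight_two_pow, fun u₀ hu1 hu2 => ?_⟩
  -- A Borel representative is needed for joint measurability of the coefficients; the free series,
  -- and hence the Duhamel series, is unchanged.
  set u₁ := hu1.1.aemeasurable.mk u₀ with hu₁
  have hae : u₀ =ᵐ[volume] u₁ := hu1.1.aemeasurable.ae_eq_mk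
  have hu : Measurable u₁ := hu1.1.aemeasurable.measurable_mk
  have hfree : freeSeries G u₀ = freeSeries G u₁ := freeSeries_congr_ae hae
  have hD : duhamelSeries σ G u₀ = duhamelSeries σ G u₁ := by
    unfold duhamelSeries; rw [hfree]
  replace hu1 : MemLp u₁ 1 := hu1.ae_eq hae
  replace hu2 : MemLp u₁ 2 := hu2.ae_eq hae
  simp only [IsDuhamelSolution, IsMild, hD, hfree]
  have hV := isChaosField_duhamelChaos (σ := σ) hd W hG hα0 hα hu hu1 hu2
  have hM := hG.inM_duhamelSeries hα0 hα σ hu hu1 hu2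
  refine ⟨_, _, isDuhamelSolution_duhamelChaos hd W hG hα hu hu2, hV,
    fun t ht => ae_hasSum_duhamelChaos hd W hG hα hu hu2 ht, hM, isMild_duhamelSeries u₁,
    fun c' hc' f hf hfm => ?_⟩
  have hfe : FieldEq σ G T f (duhamelSeries σ G u₁) :=
    IsMild.fieldEq hG hα0 hα hu hu1 hu2 hc' isWeight_two_pow hf hM hfm (isMild_duhamelSeries u₁)
  exact ⟨hfe, fun V' hV' m t ht => hV'.ae_eq hd hV hfe m ht⟩
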